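/- There is an absolute constant $C>0$ such that the following holds. Let $n\ge 1$, let $P=\{x\in\mathbb R^n:\langle a_i,x\rangle\le b_i,\ i\in[m]\}$ be an $n$-dimensional polytope (bounded), and let $\delta>0$. A *feasible basis* is a set $B\subseteq[m]$ of $n$ indices such that $(a_i)_{i\in B}$ is linearly independent and the point $x$ with $\langle a_i,x\rangle=b_i$ $(i\in B)$ lies in $P$; it is *optimal* for an objective $d$ if moreover $d\in\operatorname{cone}\{a_i:i\in B\}$. Assume that $P$ satisfies the local $\delta$-distance property: for each feasible basis $B$ and each $i\in B$, the Euclidean distance of $a_i$ from $\operatorname{span}\{a_j:j\in B\setminus\{i\}\}$ is at least $\delta\|a_i\|$. Let $B$ be a feasible basis (of the given vertex) and $d\in\mathbb R^n$ an objective, and run the following randomized algorithm. *Optimization algorithm.* It works on faces of $P$, starting with $P$ itself. On a $k$-dimensional stage there is a set $S$ of $n-k$ indices of the current basis $B$ that stay fixed (the face is the set of points of $P$ at which the constraints in $S$ are tight); let $\pi$ be the orthogonal projection onto $W=\{a_i:i\in S\}^\perp$. If $k=0$ or $\pi(d)=0$, return $B$. Otherwise put $c=\sum_{i\in B\setminus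 S}\pi(a_i)/\|\pi(a_i)\|$ and $\hat d=2\pi(d)/\|\pi(d)\|$, and sample, independently of everything before, $X\in W$ with density proportional to $e^{-\|x\|}$ conditioned on $\|X\|\le 2k$. Follow the segments $[c,c+X]$, $[c+X,\hat d+X]$, $[\hat d+X,\tilde d]$, where $\tilde d=\hat d+\frac{\delta}{2k^3}X$, by the shadow simplex method. With the basis $B$ thus reached, write $\tilde d=\sum_{i\in B\setminus S}\lambda_i\,\pi(a_i)/\|\pi(a_i)\|$, choose $i^\star$ with $\lambda_{i^\star}>1/k$ (the first such position in $B$), add $i^\star$ to $S$, and recurse on this smaller face with the basis $B$ and the objective $d$. *Shadow simplex method* for a segment $[c,d]$ on the face given by $S$, from a basis $B$. The right-hand sides are perturbed symbolically to $b_i+\varepsilon^{e_i}$ with distinct positive integer exponents $e_i$, those of the rows of the initial basis of the whole algorithm being larger than all others; expressions in $\varepsilon$ are compared for all sufficiently small $\varepsilon>0$. Let $T_{ji}$, $c_i$, $d_i$ $(i\in B)$ be the coordinates of $a_j$, $c$, $d$ in the basis $(a_i)_{i\in B}$. Repeat: let $i^\star$ minimize $\lambda=c_i/(c_i-d_i)$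 over $i\in B\setminus S$ with $c_i>d_i$; if there is no such $i$ or the minimum is at least $1$, return $B$; otherwise let $j^\star$ minimize $\bigl(\sum_{i\in B}T_{ji}(b_i+\varepsilon^{e_i})-b_j-\varepsilon^{e_j}\bigr)/T_{ji^\star}$ over $j\notin B$ with $T_{ji^\star}<0$, replace $i^\star$ by $j^\star$ in $B$ (a *pivot*), and update all coordinates by a rank-one Gauss elimination. Then: 1. With probability $1$ the algorithm terminates and returns a basis that is optimal for $d$; the corresponding point is a vertex of $P$ at which $\langle d,\cdot\rangle$ is maximal over $P$. 2. The total number of pivots has finite expectation, which is at most $C\,\frac{n^3}{\delta}\ln\frac n\delta$ if $n\ge2$, and at most $C\,\frac1\delta\bigl(1+\ln\frac1\delta\bigr)$ if $n=1$. 3. Each iteration that makes a pivot takes at most $C\,mn$ arithmetic operations (additions, subtractions, multiplications, divisions and comparisons). -/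

import Mathlib

open MeasureTheory

namespace ShadowSimplex

/-- Euclidean space `ℝⁿ`. -/
abbrev Euc (n : ℕ) : Type := EuclideanSpace ℝ (Fin n)

/-! ### Polyhedra, bases, the local `δ`-distance property -/

/-- `P = {x : ⟨aᵢ, x⟩ ≤ bᵢ for all i}`; the `a i` are the rows of the constraint matrix. -/
def polyhedron {m n : ℕ} (a : Fin m → Euc n) (b : Fin m → ℝ) : Set (Euc n) :=
  {x | ∀ i, inner ℝ (a i) x ≤ b i}

/-- A feasible basis: `n` linearly independent rows whose common tight point lies in `P`
(this point is then a vertex of `P`). -/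
def IsFeasibleBasis {m n : ℕ} (a : Fin m → Euc n) (b : Fin m → ℝ) (B : Finset (Fin m)) : Prop :=
  B.card = n ∧ LinearIndependent ℝ (fun i : B => a i) ∧
    ∃ x ∈ polyhedron a b, ∀ i ∈ B, inner ℝ (a i) x = b i

/-- A basis is optimal for the objective `d` if it is feasible and `d` lies in the cone generated
by its rows. -/
def IsOptimalBasis {m n : ℕ} (a : Fin m → Euc n) (b : Fin m → ℝ) (d : Euc n)
    (B : Finset (Fin m)) : Prop :=
  IsFeasibleBasis a b B ∧ ∃ μ : Fin m → ℝ, (∀ i, 0 ≤ μ i) ∧ d = ∑ i ∈ B, μ i • a i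

/-- The `δ`-distance property of a family of (linearly independent) vectors. -/
def DeltaDistance {ι : Type} {n : ℕ} (δ : ℝ) (v : ι → Euc n) : Prop :=
  ∀ i, δ * ‖v i‖ ≤ Metric.infDist (v i) (Submodule.span ℝ (v '' {j | j ≠ i}) : Set (Euc n))

/-- The local `δ`-distance property: every feasible basis has the `δ`-distance property. -/
def LocalDeltaDistance {m n : ℕ} (a : Fin m → Euc n) (b : Fin m → ℝ) (δ : ℝ) : Prop :=
  ∀ B : Finset (Fin m), IsFeasibleBasis a b B → DeltaDistance δ (fun i : B => a i)

/-! ### Real computations with a count of the operations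

Additions, subtractions, multiplications, divisions and comparisons of reals cost one unit each.
Comparisons of exponents of monomials, and of row indices, are charged one unit each as well. -/

/-- A value together with the number of operations spent on computing it. -/
structure Counted (α : Type) where
  val : α
  ops : ℕ

instance : Monad Counted where
  pure x := ⟨x, 0⟩
  bind x f := ⟨(f x.val).val, x.ops + (f x.val).ops⟩

noncomputable section

def rAdd (x y : ℝ) : Counted ℝ := ⟨x + y, 1⟩
def rSub (x y : ℝ) : Counted ℝ := ⟨x - y, 1⟩
def rMul (x y : ℝ) : Counted ℝ := ⟨x * y, 1⟩
def rDiv (x y : ℝ) : Counted ℝ := ⟨x / y, 1⟩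
open Classical in
def rLt (x y : ℝ) : Counted Bool := ⟨decide (x < y), 1⟩
def nLt (x y : ℕ) : Counted Bool := ⟨decide (x < y), 1⟩

/-- Compute all entries of a vector; the costs add up. -/
def forEach {k : ℕ} {α : Type} (f : Fin k → Counted α) : Counted (Fin k → α) :=
  ⟨fun i => (f i).val, ∑ i, (f i).ops⟩

/-- Inner product of two coordinate vectors. -/
def dot {n : ℕ} (u v : Fin n → ℝ) : Counted ℝ :=
  (List.finRange n).foldlM (fun s k => do
    let t ← rMul (u k) (v k)
    rAdd s t) 0

/-- Is row `j` one of the `n` rows of the basis? -/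
def isBasic {m n : ℕ} (basis : Fin n → Fin m) (j : Fin m) : Counted Bool :=
  ⟨decide (∃ k, basis k = j), n⟩

/-! ### Sparse polynomials in the symbolic perturbation parameter `ε`

A polynomial `∑ x ε^e` is stored as a list of pairs `(e, x)` sorted by increasing exponents `e`. -/

abbrev SparsePoly : Type := List (ℕ × ℝ)

/-- Insert a monomial (with an exponent that does not occur yet) at its place. -/
def insertTerm (t : ℕ × ℝ) : SparsePoly → Counted SparsePoly
  | [] => pure [t]
  | s :: p => do
    let before ← nLt t.1 s.1
    if before then pure (t :: s :: p)
    else do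
      let q ← insertTerm t p
      pure (s :: q)

/-- `x < y`, and if `x = y` the outcome of `next`. -/
def ltThen (x y : ℝ) (next : Counted Bool) : Counted Bool := do
  let l ← rLt x y
  if l then pure true
  else do
    let g ← rLt y x
    if g then pure false else next

/-- The order of `ℝ[ε]`: `p < q` iff `p(ε) < q(ε)` for all sufficiently small `ε > 0`. -/
def polyLt : SparsePoly → SparsePoly → Counted Bool
  | [], [] => pure false
  | [], (_, y) :: q => ltThen 0 y (polyLt [] q)
  | (_, x) :: p, [] => ltThen x 0 (polyLt p [])
  | (e, x) :: p, (f, y) :: q => do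
    let ef ← nLt e f
    if ef then ltThen x 0 (polyLt p ((f, y) :: q))
    else do
      let fe ← nLt f e
      if fe then ltThen 0 y (polyLt ((e, x) :: p) q)
      else ltThen x y (polyLt p q)
  termination_by p q => p.length + q.length

/-- Insert position `k` into a list of positions that is sorted by the exponents `f`. -/
def insertPos {n : ℕ} (f : Fin n → ℕ) (k : Fin n) : List (Fin n) → Counted (List (Fin n))
  | [] => pure [k]
  | l :: ls => do
    let before ← nLt (f k) (f l)
    if before then pure (k :: l :: ls)
    else do
      let r ← insertPos f k ls
      pure (l :: r)

/-- All positions of the basis, sorted by the exponents `f`. -/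
def sortPositions {n : ℕ} (f : Fin n → ℕ) : Counted (List (Fin n)) :=
  (List.finRange n).foldlM (fun ls k => insertPos f k ls) []

/-! ### The shadow simplex method

The polyhedron is `A x ≤ b + γ(ε)` with the symbolic perturbation `γ(ε)ᵢ = ε ^ e i`.
The positions in `S` of the basis are frozen: the method works on the face of the polyhedron on
which the rows at these positions are tight. With `S = ∅` the face is the whole polyhedron. -/

/-- The data after Gauss elimination: `A U`, `Uᵀ c`, `Uᵀ d` with `(A U)_basis = I`. -/
structure Tableau (m n : ℕ) where
  basis : Fin n → Fin m
  T : Fin m → Fin n → ℝ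
  c : Fin n → ℝ
  d : Fin n → ℝ

/-- `Uᵀ v` for `U = A_B⁻¹`, i.e. the coordinates of `v` in the basis of the rows `a (B k)`. -/
def coords {m n : ℕ} (a : Fin m → Euc n) (B : Fin n → Fin m) (v : Euc n) : Fin n → ℝ :=
  Matrix.vecMul (fun l => v l) (Matrix.of fun k l => a (B k) l)⁻¹

/-- The initial Gauss elimination. -/
def initialTableau {m n : ℕ} (a : Fin m → Euc n) (B : Fin n → Fin m) (c d : Euc n) :
    Tableau m n where
  basis := B
  T := fun j => coords a B (a j)
  c := coords a B c
  d := coords a B d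

/-- The leaving position `i⋆ = argmin {cᵢ / (cᵢ - dᵢ) : cᵢ > dᵢ}` among the positions that are not
frozen, together with the minimum `λ⋆`. -/
def leaving {m n : ℕ} (S : Finset (Fin n)) (t : Tableau m n) : Counted (Option (Fin n × ℝ)) :=
  (List.finRange n).foldlM (fun best i =>
    if i ∈ S then pure best
    else do
      let decr ← rLt (t.d i) (t.c i)
      if decr then do
        let s ← rSub (t.c i) (t.d i)
        let r ← rDiv (t.c i) s
        match best with
        | none => pure (some (i, r))
        | some (i₀, r₀) => do
          let better ← rLt r r₀
          pure (if better then some (i, r) else some (i₀, r₀))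
      else pure best) none

/-- The polynomial `(⟨T_j, b_B + γ(ε)_B⟩ - b_j - ε ^ e j) / T_{j i}`. The list `ord` holds the
positions of the basis in the order of their exponents, all of which are positive. -/
def ratioPoly {m n : ℕ} (b : Fin m → ℝ) (e : Fin m → ℕ) (t : Tableau m n) (ord : List (Fin n))
    (i : Fin n) (j : Fin m) : Counted SparsePoly := do
  let s ← dot (t.T j) (fun k => b (t.basis k))
  let s' ← rSub s (b j)
  let x₀ ← rDiv s' (t.T j i)
  let x ← forEach fun k => rDiv (t.T j k) (t.T j i)
  let y ← rDiv (-1) (t.T j i)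
  let p ← insertTerm (e j, y) (ord.map fun k => (e (t.basis k), x k))
  pure ((0, x₀) :: p)

/-- The entering row
`j⋆ = argmin {(⟨T_j, b_B + γ(ε)_B⟩ - b_j - ε ^ e j) / T_{j i} : j ∉ B, T_{j i} < 0}`. -/
def entering {m n : ℕ} (b : Fin m → ℝ) (e : Fin m → ℕ) (t : Tableau m n) (i : Fin n) :
    Counted (Option (Fin m × SparsePoly)) := do
  let ord ← sortPositions fun k => e (t.basis k)
  (List.finRange m).foldlM (fun best j => do
    let basic ← isBasic t.basis j
    if basic then pure best
    else do
      let blocking ← rLt (t.T j i) 0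
      if blocking then do
        let p ← ratioPoly b e t ord i j
        match best with
        | none => pure (some (j, p))
        | some (j₀, p₀) => do
          let better ← polyLt p p₀
          pure (if better then some (j, p) else some (j₀, p₀))
      else pure best) none

/-- Rank-one Gauss elimination: the row `p` after the column operations that turn the row `q` into
the `i`-th unit vector. -/
def eliminate {n : ℕ} (i : Fin n) (q p : Fin n → ℝ) : Counted (Fin n → ℝ) := do
  let z ← rDiv (p i) (q i)
  forEach fun k =>
    if k = i then pure z
    else do
      let w ← rMul z (q k)
      rSub (p k) w

/-- Replace the row at position `i` of the basis by the row `j` and update the tableau. -/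
def exchange {m n : ℕ} (t : Tableau m n) (i : Fin n) (j : Fin m) : Counted (Tableau m n) := do
  let T' ← forEach fun l => eliminate i (t.T j) (t.T l)
  let c' ← eliminate i (t.T j) t.c
  let d' ← eliminate i (t.T j) t.d
  pure { basis := Function.update t.basis i j, T := T', c := c', d := d' }

/-- Outcome of one iteration of the loop: return the current basis, fail because no row blocks the
ray, or pivot to a new basis. -/
inductive Outcome (m n : ℕ) where
  | finished : Outcome m n
  | unbounded : Outcome m n
  | pivot (t : Tableau m n) : Outcome m n

/-- One iteration of the loop of the shadow simplex method. -/
def iteration {m n : ℕ} (b : Fin m → ℝ) (e : Fin m → ℕ) (S : Finset (Fin n)) (t : Tableau m n) :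
    Counted (Outcome m n) := do
  let l ← leaving S t
  match l with
  | none => pure Outcome.finished
  | some (i, r) => do
    let inside ← rLt r 1
    if inside then do
      let j ← entering b e t i
      match j with
      | none => pure Outcome.unbounded
      | some (j, _) => do
        let t' ← exchange t i j
        pure (Outcome.pivot t')
    else pure Outcome.finished

/-- A basis that has been reached, and for each pivot so far the number of operations of the
iteration that made it. -/
structure Output (m n : ℕ) where
  basis : Fin n → Fin m
  pivotCosts : List ℕ

/-- At most `N` iterations of the loop; `none` if the loop has not returned a basis by then. -/
def loop {m n : ℕ} (b : Fin m → ℝ) (e : Fin m → ℕ) (S : Finset (Fin n)) :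
    ℕ → Tableau m n → Option (Output m n)
  | 0, _ => none
  | N + 1, t =>
    match (iteration b e S t).val with
    | Outcome.finished => some { basis := t.basis, pivotCosts := [] }
    | Outcome.unbounded => none
    | Outcome.pivot t' =>
      (loop b e S N t').map fun r =>
        { basis := r.basis, pivotCosts := (iteration b e S t).ops :: r.pivotCosts }

open Classical in
/-- Follow the segment `[c, d]`, starting with the basis `B`; `none` if the loop fails or does not
terminate. -/
def shadowSimplex {m n : ℕ} (a : Fin m → Euc n) (b : Fin m → ℝ) (e : Fin m → ℕ)
    (S : Finset (Fin n)) (B : Fin n → Fin m) (c d : Euc n) : Option (Output m n) :=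
  if h : ∃ N, (loop b e S N (initialTableau a B c d)).isSome then
    loop b e S (Nat.find h) (initialTableau a B c d)
  else none

/-! ### The exponential distribution -/

/-- The measure on `ℝᵏ` with density `exp (-‖x‖)`. -/
def expMeasure (k : ℕ) : Measure (Euc k) :=
  volume.withDensity fun x => ENNReal.ofReal (Real.exp (-‖x‖))

/-- The exponential distribution on `ℝᵏ`, conditioned on `‖x‖ ≤ 2 k`. (The conditioning normalizes
the measure.) -/
def truncExp (k : ℕ) : Measure (Euc k) :=
  ProbabilityTheory.cond (expMeasure k) (Metric.closedBall 0 (2 * (k : ℝ)))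

instance (k : ℕ) : IsProbabilityMeasure (truncExp k) := by
  have hs : MeasurableSet (Metric.closedBall (0 : Euc k) (2 * (k : ℝ))) :=
    Metric.isClosed_closedBall.measurableSet
  have hm : Measurable fun x : Euc k => ENNReal.ofReal (Real.exp (-‖x‖)) := by fun_prop
  have hv : volume (Metric.closedBall (0 : Euc k) (2 * (k : ℝ))) ≠ 0 := by
    rcases Nat.eq_zero_or_pos k with rfl | hk
    · have : Metric.closedBall (0 : Euc 0) (2 * ((0 : ℕ) : ℝ)) = Set.univ := by
        ext x
        simp [Subsingleton.elim x 0]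
      rw [this]
      exact isOpen_univ.measure_ne_zero _ Set.univ_nonempty
    · exact (Metric.measure_closedBall_pos volume _ (by positivity)).ne'
  apply ProbabilityTheory.cond_isProbabilityMeasure_of_finite
  · rw [expMeasure, withDensity_apply _ hs]
    intro h
    rw [lintegral_eq_zero_iff hm] at h
    have h0 : volume.restrict (Metric.closedBall (0 : Euc k) (2 * (k : ℝ))) Set.univ = 0 := by
      have := (ae_iff.1 h)
      simpa [Real.exp_pos] using this
    rw [Measure.restrict_apply_univ] at h0
    exact hv h0
  · rw [expMeasure, withDensity_apply _ hs]
    refine ((lintegral_mono (g := fun _ => (1 : ENNReal)) fun x => ?_).trans_lt ?_).ne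
    · rw [← ENNReal.ofReal_one]
      exact ENNReal.ofReal_le_ofReal (by simp)
    · simpa using (isCompact_closedBall (0 : Euc k) (2 * (k : ℝ))).measure_lt_top

/-- The joint law of independent samples, one on `ℝᵏ` for every dimension `k`. -/
def sampleLaw : Measure ((k : ℕ) → Euc k) := Measure.infinitePi truncExp

/-- A linear isometry of `ℝᵏ` onto the `k`-dimensional subspace `W`. (The exponential distribution
is invariant under rotations, so it does not matter which one.) -/
def embedding {n : ℕ} (k : ℕ) (W : Submodule ℝ (Euc n)) : Euc k →ₗ[ℝ] Euc n :=
  Classical.epsilon fun L => (∀ x, ‖L x‖ = ‖x‖) ∧ LinearMap.range L = W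

/-! ### The optimization algorithm -/

/-- Exponents of the perturbation: distinct, positive, and those of the rows of `B` come last. (Only
the order of the exponents matters to the algorithm.) -/
def exponent {m n : ℕ} (B : Fin n → Fin m) (i : Fin m) : ℕ :=
  if ∃ k, B k = i then m + i + 1 else i + 1

open Classical in
/-- The algorithm on the `k`-dimensional face of `P` on which the rows at the frozen positions `S` of
the basis `B` are tight; `π` is the orthogonal projection onto the direction space `W` of that face.
The entry `X k` is the random sample that is used in dimension `k`. -/
def optimizeFace {m n : ℕ} (a : Fin m → Euc n) (b : Fin m → ℝ) (δ : ℝ) (d : Euc n)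
    (e : Fin m → ℕ) (X : (k : ℕ) → Euc k) :
    ℕ → Finset (Fin n) → (Fin n → Fin m) → Option (Output m n)
  | 0, _, B => some { basis := B, pivotCosts := [] }
  | k + 1, S, B =>
    let W : Submodule ℝ (Euc n) := (Submodule.span ℝ ((fun l => a (B l)) '' (S : Set (Fin n))))ᗮ
    let π : Euc n → Euc n := fun x => W.starProjection x
    if π d = 0 then some { basis := B, pivotCosts := [] }
    else
      let c : Euc n := ∑ i ∈ Sᶜ, ‖π (a (B i))‖⁻¹ • π (a (B i))
      let d' : Euc n := (2 / ‖π d‖) • π d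
      let x : Euc n := embedding (k + 1) W (X (k + 1))
      let d'' : Euc n := d' + (δ / (2 * ((k + 1 : ℕ) : ℝ) ^ 3)) • x
      (shadowSimplex a b e S B c (c + x)).bind fun r₁ =>
      (shadowSimplex a b e S r₁.basis (c + x) (d' + x)).bind fun r₂ =>
      (shadowSimplex a b e S r₂.basis (d' + x) d'').bind fun r₃ =>
      ((List.finRange n).find? fun i => decide (i ∉ S ∧
        1 / ((k + 1 : ℕ) : ℝ) < coords a r₃.basis d'' i * ‖π (a (r₃.basis i))‖)).bind fun i =>
      (optimizeFace a b δ d e X k (insert i S) r₃.basis).map fun r₄ =>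
        { basis := r₄.basis
          pivotCosts := r₁.pivotCosts ++ r₂.pivotCosts ++ r₃.pivotCosts ++ r₄.pivotCosts }

/-- The algorithm on `P = {A x ≤ b}` with parameter `δ`, initial feasible basis `B`, objective `d`
and random samples `X`. -/
def optimize {m n : ℕ} (a : Fin m → Euc n) (b : Fin m → ℝ) (δ : ℝ) (B : Fin n → Fin m) (d : Euc n)
    (X : (k : ℕ) → Euc k) : Option (Output m n) :=
  optimizeFace a b δ d (exponent B) X n ∅ B

/-- The total number of shadow simplex pivots. -/
def numPivots {m n : ℕ} : Option (Output m n) → ℕ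
  | none => 0
  | some r => r.pivotCosts.length

end

end ShadowSimplex

open ShadowSimplex

/-!
The perturbed right-hand sides `b i + ε ^ e i` make every vertex simple: the slack of a row outside of
a basis is a polynomial in `ε` in which the monomial of that row survives (`EpsFeasible.strict`). A
basis that is feasible for all small `ε > 0` is feasible for `P`, and the ratio test preserves this
(`EpsFeasible.update`, `iteration_spec`). On the face on which the rows in `S₀` are tight, such a basis
has an open normal cone, generated by its rows modulo the span of the rows in `S₀`; different cones are
disjoint (`faceBases_disjoint`). The shadow simplex method on a segment that meets no two facets of a
cone at once visits the bases whose cones the segment crosses, so that the number of its pivots is at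
most the number of cones that the segment leaves (`shadowSimplex_spec`). Almost all samples make all
segments generic in this sense (`ae_genericSample`).

*Expected number of pivots.* By the `δ`-distance property each cone contains the ball of radius `δ`
around its center, the sum of the normalized rows, which has norm at most `k` (`coneCenter_add_mem`,
`norm_coneCenter_le`). If a short step of length `h` leaves a cone `K`, then shifting its endpoint by
slightly more than `h / δ` times the center of `K` returns to `K`. A shift of the sample by `v` changes
the exponential measure by at most a factor `e ^ ‖v‖`, so the probability of leaving `K` in this step is
at most about `h k / (δ σ)` times the probability of being in `K`, where `σ` is the scale of the sample
(`expMeasure_step_le`). The cones are disjoint, so summing over them costs nothing; summing over the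
steps of a fine partition and passing to the limit bounds the expected number of exits of a segment of
length `L` by a multiple of `L k / (δ σ)` (`lintegral_exitCount_le`). On the first and the third segment
of a stage the scale of the sample varies, and they are cut dyadically; the first one may start at a
scale of order `δ / k`, because below it stays in the ball around the center, and the third one ends at
the scale `δ / (2 k ^ 3)`. Hence a stage costs `O (k ^ 2 / δ * log (k / δ))` expected pivots
(`lintegral_stageExits_le`). The samples of different stages are independent, and Fubini's theorem adds
up the `n` stages (`lintegral_numPivots_le`); for this the output must be a measurable function of the
samples (`optimizeFace_measurable`).

*Correctness.* The endpoint of the third segment has norm more than `1`, hence a normalized coordinate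
larger than `1 / k` (`exists_large_coord`). If the method went on to shrink the sample to zero, it would
move by less than `δ / k ^ 2`, and a normalized coordinate changes by at most `1 / δ` times the
distance; so the row in question would stay in the basis. One of the finitely many bases is reached at
arbitrarily small scales and is therefore optimal for the objective on the face, which shows that some
maximizer lies on the smaller face (`FaceOptimal.insert`). In the end the objective is normal to the
face, and every basis of the face is optimal for it (`FaceOptimal.coords_nonneg`).

The bound on the operations of an iteration is a direct count (`ops_iteration_le`).
-/

open Filter Topology
open scoped ENNReal

namespace ShadowSimplex

section

variable {m n : ℕ}

/-! ### Coordinates with respect to a basis of rows -/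

/-- `coords` as a linear map. -/
noncomputable def coordsL (a : Fin m → Euc n) (B : Fin n → Fin m) : Euc n →ₗ[ℝ] (Fin n → ℝ) where
  toFun := coords a B
  map_add' x y := by
    rw [coords, coords, coords, ← Matrix.add_vecMul]; rfl
  map_smul' c x := by
    rw [coords, coords, RingHom.id_apply, ← Matrix.smul_vecMul]; rfl

lemma coords_eq_coordsL (a : Fin m → Euc n) (B : Fin n → Fin m) (v : Euc n) (k : Fin n) :
    coords a B v k = ((LinearMap.proj k).comp (coordsL a B)) v := rfl

lemma coords_add (a : Fin m → Euc n) (B : Fin n → Fin m) (x y : Euc n) (k : Fin n) :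
    coords a B (x + y) k = coords a B x k + coords a B y k := by
  simp only [coords_eq_coordsL, map_add]

lemma coords_sub (a : Fin m → Euc n) (B : Fin n → Fin m) (x y : Euc n) (k : Fin n) :
    coords a B (x - y) k = coords a B x k - coords a B y k := by
  simp only [coords_eq_coordsL, map_sub]

lemma coords_smul (a : Fin m → Euc n) (B : Fin n → Fin m) (c : ℝ) (x : Euc n) (k : Fin n) :
    coords a B (c • x) k = c * coords a B x k := by
  simp only [coords_eq_coordsL, map_smul, smul_eq_mul]

lemma coords_sum {ι : Type*} (a : Fin m → Euc n) (B : Fin n → Fin m) (s : Finset ι)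
    (f : ι → Euc n) (k : Fin n) :
    coords a B (∑ i ∈ s, f i) k = ∑ i ∈ s, coords a B (f i) k := by
  simp only [coords_eq_coordsL, map_sum]

lemma continuous_coords (a : Fin m → Euc n) (B : Fin n → Fin m) (k : Fin n) :
    Continuous fun v => coords a B v k :=
  ((LinearMap.proj k).comp (coordsL a B)).continuous_of_finiteDimensional

lemma isUnit_rows {a : Fin m → Euc n} {B : Fin n → Fin m}
    (hB : LinearIndependent ℝ fun k => a (B k)) :
    IsUnit (Matrix.of fun k l => a (B k) l : Matrix (Fin n) (Fin n) ℝ) := by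
  rw [← Matrix.linearIndependent_rows_iff_isUnit]
  exact hB.map' (WithLp.linearEquiv 2 ℝ (Fin n → ℝ)).toLinearMap (LinearEquiv.ker _)

lemma sum_coords {a : Fin m → Euc n} {B : Fin n → Fin m}
    (hB : LinearIndependent ℝ fun k => a (B k)) (v : Euc n) :
    ∑ k, coords a B v k • a (B k) = v := by
  have h : Matrix.vecMul (coords a B v) (Matrix.of fun k l => a (B k) l) = fun l => v l := by
    rw [coords, Matrix.vecMul_vecMul, Matrix.nonsing_inv_mul _
      ((Matrix.isUnit_iff_isUnit_det _).1 (isUnit_rows hB)), Matrix.vecMul_one]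
  ext l
  have := congrFun h l
  simpa [Matrix.vecMul, dotProduct] using this

lemma coords_unique {a : Fin m → Euc n} {B : Fin n → Fin m}
    (hB : LinearIndependent ℝ fun k => a (B k)) {v : Euc n} {μ : Fin n → ℝ}
    (h : ∑ k, μ k • a (B k) = v) : coords a B v = μ := by
  have h0 := Fintype.linearIndependent_iff.1 hB (fun k => coords a B v k - μ k) (by
    simp only [sub_smul, Finset.sum_sub_distrib, sum_coords hB, h, sub_self])
  funext k
  exact sub_eq_zero.1 (h0 k)

lemma coords_row {a : Fin m → Euc n} {B : Fin n → Fin m}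
    (hB : LinearIndependent ℝ fun k => a (B k)) (l : Fin n) :
    coords a B (a (B l)) = Pi.single l 1 :=
  coords_unique hB (by simp [Pi.single_apply, ite_smul])

lemma inner_eq_sum_coords {a : Fin m → Euc n} {B : Fin n → Fin m}
    (hB : LinearIndependent ℝ fun k => a (B k)) (v x : Euc n) :
    inner ℝ v x = ∑ k, coords a B v k * inner ℝ (a (B k)) x := by
  conv_lhs => rw [← sum_coords hB v]
  simp only [sum_inner, real_inner_smul_left]

lemma injective_of_linInd {a : Fin m → Euc n} {B : Fin n → Fin m}
    (hB : LinearIndependent ℝ fun k => a (B k)) : Function.Injective B := fun k l h =>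
  hB.injective (by simp only [h])

/-- The solution of `⟨a (B k), x⟩ = r k` for all positions `k`. -/
noncomputable def vert (a : Fin m → Euc n) (B : Fin n → Fin m) (r : Fin n → ℝ) : Euc n :=
  WithLp.toLp 2 ((Matrix.of fun k l => a (B k) l)⁻¹.mulVec r)

lemma inner_vert {a : Fin m → Euc n} {B : Fin n → Fin m}
    (hB : LinearIndependent ℝ fun k => a (B k)) (r : Fin n → ℝ) (k : Fin n) :
    inner ℝ (a (B k)) (vert a B r) = r k := by
  have h : (Matrix.of fun k l => a (B k) l).mulVec
      ((Matrix.of fun k l => a (B k) l)⁻¹.mulVec r) = r := by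
    rw [Matrix.mulVec_mulVec, Matrix.mul_nonsing_inv _
      ((Matrix.isUnit_iff_isUnit_det _).1 (isUnit_rows hB)), Matrix.one_mulVec]
  have := congrFun h k
  rw [← this]
  simp [vert, PiLp.inner_apply, Matrix.mulVec, dotProduct, mul_comm]

lemma inner_vert_eq_sum {a : Fin m → Euc n} {B : Fin n → Fin m}
    (hB : LinearIndependent ℝ fun k => a (B k)) (v : Euc n) (r : Fin n → ℝ) :
    inner ℝ v (vert a B r) = ∑ k, coords a B v k * r k := by
  rw [inner_eq_sum_coords hB]
  simp only [inner_vert hB]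

lemma eq_of_inner_rows {a : Fin m → Euc n} {B : Fin n → Fin m}
    (hB : LinearIndependent ℝ fun k => a (B k)) {x y : Euc n}
    (h : ∀ k, inner ℝ (a (B k)) x = inner ℝ (a (B k)) y) : x = y := by
  refine ext_inner_left ℝ fun v => ?_
  rw [inner_eq_sum_coords hB, inner_eq_sum_coords hB]
  simp only [h]

lemma sum_update (a : Fin m → Euc n) (B : Fin n → Fin m) (i : Fin n) (j : Fin m)
    (g : Fin n → ℝ) :
    ∑ k, g k • a (Function.update B i j k) =
      g i • a j + ∑ k ∈ Finset.univ.erase i, g k • a (B k) := by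
  rw [← Finset.add_sum_erase _ _ (Finset.mem_univ i), Function.update_self]
  congr 1
  exact Finset.sum_congr rfl fun k hk => by
    rw [Function.update_of_ne (Finset.ne_of_mem_erase hk)]

lemma coords_erase_sum {a : Fin m → Euc n} {B : Fin n → Fin m}
    (hB : LinearIndependent ℝ fun k => a (B k)) (i : Fin n) (g : Fin n → ℝ) (l : Fin n) :
    coords a B (∑ k ∈ Finset.univ.erase i, g k • a (B k)) l = if l = i then 0 else g l := by
  simp only [coords_sum, coords_smul, coords_row hB, Pi.single_apply]
  split_ifs with h
  · exact Finset.sum_eq_zero fun k hk => by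
      rw [if_neg (by rintro rfl; exact Finset.ne_of_mem_erase hk h), mul_zero]
  · rw [Finset.sum_eq_single l] <;> simp_all [eq_comm]

/-- A pivot on a nonzero entry leads to a basis. -/
lemma linInd_update {a : Fin m → Euc n} {B : Fin n → Fin m}
    (hB : LinearIndependent ℝ fun k => a (B k)) {i : Fin n} {j : Fin m}
    (hij : coords a B (a j) i ≠ 0) :
    LinearIndependent ℝ fun k => a (Function.update B i j k) := by
  rw [Fintype.linearIndependent_iff]
  intro g hg
  rw [sum_update] at hg
  have h : ∀ l, g i * coords a B (a j) l + (if l = i then 0 else g l) = 0 := fun l => by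
    rw [← coords_smul, ← coords_erase_sum hB, ← coords_add, hg]
    simp [coords_eq_coordsL]
  have hi : g i = 0 := by
    have := h i
    simp only [if_true, add_zero, mul_eq_zero, hij, or_false] at this
    exact this
  intro l
  by_cases hl : l = i
  · rw [hl, hi]
  · simpa [hi, hl] using h l

/-- The rank-one Gauss elimination computes the coordinates in the basis after a pivot. -/
lemma coords_update {a : Fin m → Euc n} {B : Fin n → Fin m}
    (hB : LinearIndependent ℝ fun k => a (B k)) {i : Fin n} {j : Fin m}
    (hij : coords a B (a j) i ≠ 0) (v : Euc n) :
    coords a (Function.update B i j) v = fun k =>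
      if k = i then coords a B v i / coords a B (a j) i
      else coords a B v k - coords a B v i / coords a B (a j) i * coords a B (a j) k := by
  apply coords_unique (linInd_update hB hij)
  rw [sum_update]
  have : ∀ l, coords a B
      ((if i = i then coords a B v i / coords a B (a j) i
        else coords a B v i - coords a B v i / coords a B (a j) i * coords a B (a j) i) • a j +
      ∑ k ∈ Finset.univ.erase i, (if k = i then coords a B v i / coords a B (a j) i
        else coords a B v k - coords a B v i / coords a B (a j) i * coords a B (a j) k) •
          a (B k)) l = coords a B v l := fun l => by
    rw [coords_add, coords_erase_sum hB, coords_smul]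
    by_cases hl : l = i
    · subst hl; simp [hij]
    · simp [hl]
  exact (sum_coords hB _).symm.trans ((Finset.sum_congr rfl fun l _ => by rw [this l]).trans
    (sum_coords hB v))

/-! ### Bases that are feasible for the perturbed polyhedron -/

/-- The right-hand sides `b i + ε ^ e i`. -/
def rhs (b : Fin m → ℝ) (e : Fin m → ℕ) (ε : ℝ) (i : Fin m) : ℝ := b i + ε ^ e i

/-- The vertex of the perturbed polyhedron that belongs to the basis `B`. -/
noncomputable def pvert (a : Fin m → Euc n) (b : Fin m → ℝ) (e : Fin m → ℕ) (B : Fin n → Fin m)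
    (ε : ℝ) : Euc n := vert a B fun k => rhs b e ε (B k)

/-- `B` is a basis whose vertex is feasible for the perturbed right-hand sides, for all sufficiently
small `ε > 0`. -/
def EpsFeasible (a : Fin m → Euc n) (b : Fin m → ℝ) (e : Fin m → ℕ) (B : Fin n → Fin m) : Prop :=
  LinearIndependent ℝ (fun k => a (B k)) ∧
    ∀ᶠ ε in 𝓝[>] (0 : ℝ), pvert a b e B ε ∈ polyhedron a (rhs b e ε)

variable {a : Fin m → Euc n} {b : Fin m → ℝ} {e : Fin m → ℕ} {B : Fin n → Fin m}

lemma inner_pvert (hB : LinearIndependent ℝ fun k => a (B k)) (ε : ℝ) (k : Fin n) :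
    inner ℝ (a (B k)) (pvert a b e B ε) = rhs b e ε (B k) := inner_vert hB _ k

/-- A perturbed vertex satisfies no further constraint with equality: its slack is a polynomial in
`ε` in which the monomial `ε ^ e j` occurs. -/
lemma EpsFeasible.strict (he : Function.Injective e) (hpos : ∀ i, 0 < e i)
    (hB : EpsFeasible a b e B) :
    ∀ᶠ ε in 𝓝[>] (0 : ℝ), ∀ j, j ∉ Set.range B →
      inner ℝ (a j) (pvert a b e B ε) < rhs b e ε j := by
  rw [eventually_all]
  intro j
  rw [eventually_imp_distrib_left]
  intro hj
  let p : Polynomial ℝ := ∑ k, Polynomial.C (coords a B (a j) k) *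
    (Polynomial.C (b (B k)) + Polynomial.X ^ e (B k)) -
      (Polynomial.C (b j) + Polynomial.X ^ e j)
  have hp : ∀ ε, p.eval ε = inner ℝ (a j) (pvert a b e B ε) - rhs b e ε j := fun ε => by
    rw [pvert, inner_vert_eq_sum hB.1]
    simp [p, rhs, Polynomial.eval_finsetSum]
  have hp0 : p ≠ 0 := by
    intro h
    have h1 : p.coeff (e j) = -1 := by
      have hk : ∀ k, e j ≠ e (B k) := fun k h => hj ⟨k, (he h).symm⟩
      have h0 : e j ≠ 0 := (hpos j).ne'
      simp [p, Polynomial.coeff_C, Polynomial.coeff_X_pow, hk, h0]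
    rw [h] at h1
    norm_num at h1
  have hroot : ∀ᶠ ε in 𝓝[>] (0 : ℝ), p.eval ε ≠ 0 := by
    have h1 : ∀ᶠ ε in 𝓝[≠] (0 : ℝ), p.eval ε ≠ 0 := by
      have hfin : {ε | p.eval ε = 0}.Finite := by
        have := p.roots.toFinset.finite_toSet
        refine this.subset fun ε hε => ?_
        simpa [hp0] using hε
      have := hfin.isClosed.isOpen_compl
      have hd : ∀ᶠ ε in 𝓝[≠] (0 : ℝ), ε ∉ {ε | p.eval ε = 0} \ {0} :=
        (eventually_nhdsWithin_of_eventually_nhds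
          ((hfin.subset Set.sdiff_subset).isClosed.isOpen_compl.eventually_mem (by simp)))
      filter_upwards [hd, self_mem_nhdsWithin] with ε h1 h2 h3
      exact h1 ⟨h3, h2⟩
    exact h1.filter_mono (nhdsWithin_mono _ fun x hx => ne_of_gt hx)
  filter_upwards [hroot, hB.2] with ε h1 h2
  rw [hp] at h1
  exact lt_of_le_of_ne (h2 j) (sub_ne_zero.1 h1)

/-- The slack polynomial divided by `T j i`, i.e. the expression of the ratio test. -/
noncomputable def ratio (a : Fin m → Euc n) (b : Fin m → ℝ) (e : Fin m → ℕ) (B : Fin n → Fin m)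
    (i : Fin n) (j : Fin m) (ε : ℝ) : ℝ :=
  (∑ k, coords a B (a j) k * rhs b e ε (B k) - rhs b e ε j) / coords a B (a j) i

/-- The edge direction that decreases the `i`-th tight constraint. -/
lemma inner_edge (hB : LinearIndependent ℝ fun k => a (B k)) (i : Fin n) (v : Euc n) :
    inner ℝ v (vert a B (Pi.single i 1)) = coords a B v i := by
  rw [inner_vert_eq_sum hB]
  simp [Pi.single_apply]

/-- The ratio test leads from a feasible basis to a feasible basis. -/
lemma EpsFeasible.update (hB : EpsFeasible a b e B) {i : Fin n} {j : Fin m}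
    (hj : coords a B (a j) i < 0)
    (hmin : ∀ l, l ∉ Set.range B → coords a B (a l) i < 0 →
      ∀ᶠ ε in 𝓝[>] (0 : ℝ), ratio a b e B i j ε ≤ ratio a b e B i l ε) :
    EpsFeasible a b e (Function.update B i j) := by
  have hB' := linInd_update hB.1 hj.ne
  refine ⟨hB', ?_⟩
  have hmin' : ∀ᶠ ε in 𝓝[>] (0 : ℝ), ∀ l, l ∉ Set.range B → coords a B (a l) i < 0 →
      ratio a b e B i j ε ≤ ratio a b e B i l ε := by
    rw [eventually_all]; intro l
    rw [eventually_imp_distrib_left]; intro h1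
    rw [eventually_imp_distrib_left]; intro h2
    exact hmin l h1 h2
  filter_upwards [hmin', hB.2] with ε hε hfeas
  have hs : ∀ l, ratio a b e B i l ε =
      (inner ℝ (a l) (pvert a b e B ε) - rhs b e ε l) / coords a B (a l) i := fun l => by
    rw [ratio, pvert, inner_vert_eq_sum hB.1]
  set x := pvert a b e B ε with hx
  set t := ratio a b e B i j ε with ht
  have htpos : 0 ≤ t := by
    rw [ht, hs]
    exact div_nonneg_of_nonpos (sub_nonpos.2 (hfeas j)) hj.le
  have hval : ∀ v, inner ℝ v (x - t • vert a B (Pi.single i 1)) =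
      inner ℝ v x - t * coords a B v i := fun v => by
    rw [inner_sub_right, real_inner_smul_right, inner_edge hB.1]
  have hx' : pvert a b e (Function.update B i j) ε = x - t • vert a B (Pi.single i 1) := by
    apply eq_of_inner_rows hB'
    intro k
    rw [inner_pvert hB', hval]
    by_cases hk : k = i
    · subst hk
      rw [Function.update_self, ht, hs, div_mul_cancel₀ _ hj.ne]
      ring
    · rw [Function.update_of_ne hk, hx, inner_pvert hB.1, coords_row hB.1, Pi.single_apply,
        if_neg (Ne.symm hk)]
      ring
  rw [hx']
  intro l
  rw [hval]
  by_cases hneg : coords a B (a l) i < 0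
  · by_cases hl : l ∈ Set.range B
    · obtain ⟨k, rfl⟩ := hl
      rw [coords_row hB.1, Pi.single_apply] at hneg
      split_ifs at hneg <;> linarith
    · have h := hε l hl hneg
      rw [hs l, le_div_iff_of_neg hneg] at h
      linarith
  · have := mul_nonneg htpos (not_lt.1 hneg)
    linarith [hfeas l]

/-- In a bounded polyhedron every edge ray is blocked. -/
lemma exists_blocking (hbdd : Bornology.IsBounded (polyhedron a b))
    (hne : (polyhedron a b).Nonempty) (hB : LinearIndependent ℝ fun k => a (B k)) (i : Fin n) :
    ∃ j, coords a B (a j) i < 0 := by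
  by_contra! h
  obtain ⟨x, hx⟩ := hne
  set u := vert a B (Pi.single i 1) with hu
  have hu0 : 0 < ‖u‖ := by
    rw [norm_pos_iff]
    intro h0
    have h1 := inner_edge hB i (a (B i))
    rw [← hu, h0, inner_zero_right, coords_row hB] at h1
    simp at h1
  obtain ⟨R, hR⟩ := hbdd.subset_closedBall x
  have hmem : x - ((|R| + 1) / ‖u‖) • u ∈ polyhedron a b := fun l => by
    rw [inner_sub_right, real_inner_smul_right, inner_edge hB]
    have := mul_nonneg (div_nonneg (by positivity : (0:ℝ) ≤ |R| + 1) hu0.le) (h l)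
    linarith [hx l]
  have := hR hmem
  rw [Metric.mem_closedBall, dist_eq_norm, sub_sub_cancel_left, norm_neg, norm_smul,
    Real.norm_of_nonneg (by positivity), div_mul_cancel₀ _ hu0.ne'] at this
  linarith [le_abs_self R]

/-- If the perturbed vertex of `B` maximizes `d`, then `d` lies in the cone of the rows of `B`,
because the vertex is nondegenerate. -/
lemma EpsFeasible.coords_nonneg (he : Function.Injective e) (hpos : ∀ i, 0 < e i)
    (hB : EpsFeasible a b e B) {d : Euc n}
    (hmax : ∀ᶠ ε in 𝓝[>] (0 : ℝ), ∀ x ∈ polyhedron a (rhs b e ε),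
      inner ℝ d x ≤ inner ℝ d (pvert a b e B ε)) (i : Fin n) : 0 ≤ coords a B d i := by
  by_contra! hneg
  obtain ⟨ε, h1, h2, h3⟩ := (hmax.and (hB.2.and (hB.strict he hpos))).exists
  set x := pvert a b e B ε with hx
  set u := vert a B (Pi.single i 1) with hu
  have hval : ∀ v t, inner ℝ v (x - t • u) = inner ℝ v x - t * coords a B v i := fun v t => by
    rw [inner_sub_right, real_inner_smul_right, inner_edge hB.1]
  have hcont : ∀ l, ∀ᶠ t in 𝓝[>] (0 : ℝ), inner ℝ (a l) (x - t • u) ≤ rhs b e ε l := by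
    intro l
    by_cases hl : l ∈ Set.range B
    · obtain ⟨k, rfl⟩ := hl
      filter_upwards [self_mem_nhdsWithin] with t ht
      rw [hval, hx, inner_pvert hB.1, coords_row hB.1, Pi.single_apply]
      have : (0:ℝ) < t := ht
      split_ifs <;> linarith
    · have hc : Continuous fun t : ℝ => inner ℝ (a l) (x - t • u) := by fun_prop
      have : ∀ᶠ t in 𝓝 (0 : ℝ), inner ℝ (a l) (x - t • u) < rhs b e ε l :=
        hc.continuousAt.eventually_lt continuousAt_const (by simpa using h3 l hl)
      filter_upwards [eventually_nhdsWithin_of_eventually_nhds this] with t ht using ht.le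
  obtain ⟨t, ht, ht0⟩ := ((eventually_all.2 hcont).and self_mem_nhdsWithin).exists
  have ht0 : (0:ℝ) < t := ht0
  have := h1 _ ht
  rw [hval] at this
  nlinarith [mul_neg_of_pos_of_neg ht0 hneg]

lemma tendsto_rhs (hpos : ∀ i, 0 < e i) (i : Fin m) :
    Tendsto (fun ε => rhs b e ε i) (𝓝[>] (0 : ℝ)) (𝓝 (b i)) := by
  have : ContinuousAt (fun ε : ℝ => rhs b e ε i) 0 := by unfold rhs; fun_prop
  have h := this.tendsto
  simp only [rhs, zero_pow (hpos i).ne', add_zero] at h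
  exact h.mono_left nhdsWithin_le_nhds

lemma EpsFeasible.vert_mem (hpos : ∀ i, 0 < e i) (hB : EpsFeasible a b e B) :
    vert a B (fun k => b (B k)) ∈ polyhedron a b := by
  intro j
  rw [inner_vert_eq_sum hB.1]
  refine le_of_tendsto_of_tendsto
    (tendsto_finsetSum _ fun k _ => (tendsto_rhs (b := b) hpos (B k)).const_mul _)
    (tendsto_rhs hpos j) ?_
  filter_upwards [hB.2] with ε h
  have := h j
  rwa [pvert, inner_vert_eq_sum hB.1] at this

lemma EpsFeasible.isFeasibleBasis (hpos : ∀ i, 0 < e i) (hB : EpsFeasible a b e B) :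
    IsFeasibleBasis a b (Finset.univ.image B) := by
  have hinj := injective_of_linInd hB.1
  refine ⟨by rw [Finset.card_image_of_injective _ hinj, Finset.card_univ, Fintype.card_fin], ?_,
    _, hB.vert_mem hpos, ?_⟩
  · have h1 : LinearIndepOn ℝ a (Set.range B) := (linearIndepOn_range_iff hinj a).2 hB.1
    have h2 : ((Finset.univ.image B : Finset (Fin m)) : Set (Fin m)) = Set.range B := by simp
    rw [← h2] at h1
    exact h1
  · intro i hi
    obtain ⟨k, -, rfl⟩ := Finset.mem_image.1 hi
    exact inner_vert hB.1 _ k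

lemma linInd_of_isFeasibleBasis (h : IsFeasibleBasis a b (Finset.univ.image B)) :
    LinearIndependent ℝ fun k => a (B k) := by
  have hinj : Function.Injective B := by
    have h1 : (Finset.univ.image B).card = (Finset.univ : Finset (Fin n)).card := by
      rw [h.1, Finset.card_univ, Fintype.card_fin]
    have h2 := Finset.card_image_iff.1 h1
    rwa [Finset.coe_univ, Set.injOn_univ] at h2
  have h1 := h.2.1
  have h2 : ((Finset.univ.image B : Finset (Fin m)) : Set (Fin m)) = Set.range B := by simp
  have h3 : LinearIndepOn ℝ a (Finset.univ.image B : Finset (Fin m)) := h1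
  rw [h2] at h3
  exact (linearIndepOn_range_iff hinj a).1 h3

lemma exponent_injective (B : Fin n → Fin m) : Function.Injective (exponent B) := by
  intro i j h
  unfold exponent at h
  ext
  split_ifs at h <;> omega

lemma exponent_pos (B : Fin n → Fin m) (i : Fin m) : 0 < exponent B i := by
  unfold exponent; split_ifs <;> omega

/-- The initial basis stays feasible, since its own rows are perturbed least. -/
lemma epsFeasible_exponent (h : IsFeasibleBasis a b (Finset.univ.image B)) :
    EpsFeasible a b (exponent B) B := by
  have hB := linInd_of_isFeasibleBasis h
  refine ⟨hB, ?_⟩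
  obtain ⟨x, hx, htight⟩ := h.2.2
  have hxv : ∀ j, ∑ k, coords a B (a j) k * b (B k) ≤ b j := fun j => by
    have := hx j
    rw [inner_eq_sum_coords hB] at this
    convert this using 3 with k
    exact (htight (B k) (Finset.mem_image_of_mem _ (Finset.mem_univ k))).symm
  unfold polyhedron
  simp only [Set.mem_ofPred_eq]
  rw [eventually_all]
  intro j
  by_cases hj : j ∈ Set.range B
  · obtain ⟨k, rfl⟩ := hj
    exact Eventually.of_forall fun ε => (inner_pvert hB ε k).le
  · set M := ∑ k, |coords a B (a j) k| with hM
    have hM0 : 0 ≤ M := Finset.sum_nonneg fun _ _ => abs_nonneg _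
    have h1 : ∀ᶠ ε in 𝓝[>] (0 : ℝ), ε < 1 / (M + 1) :=
      eventually_nhdsWithin_of_eventually_nhds (eventually_lt_nhds (by positivity))
    filter_upwards [h1, self_mem_nhdsWithin] with ε hε hε0
    have hε0 : (0:ℝ) < ε := hε0
    have hε1 : ε * (M + 1) ≤ 1 := by
      rw [lt_div_iff₀ (by positivity)] at hε; exact hε.le
    have hεle : ε ≤ 1 := by nlinarith
    rw [pvert, inner_vert_eq_sum hB]
    have hj' : exponent B j = j + 1 := by
      unfold exponent; exact if_neg hj
    have hsum : ∑ k, coords a B (a j) k * ε ^ exponent B (B k) ≤ ε ^ ((j:ℕ) + 1) := by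
      calc _ ≤ ∑ k, |coords a B (a j) k| * ε ^ ((j:ℕ) + 2) := by
            refine Finset.sum_le_sum fun k _ => ?_
            have hk : exponent B (B k) = m + B k + 1 := by
              unfold exponent; exact if_pos ⟨k, rfl⟩
            rw [hk]
            have := j.isLt
            have h2 : ε ^ (m + (B k : ℕ) + 1) ≤ ε ^ ((j:ℕ) + 2) :=
              pow_le_pow_of_le_one hε0.le hεle (by omega)
            exact mul_le_mul (le_abs_self _) h2 (by positivity) (abs_nonneg _)
        _ = M * ε * ε ^ ((j:ℕ) + 1) := by rw [← Finset.sum_mul]; ring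
        _ ≤ 1 * ε ^ ((j:ℕ) + 1) := by
            apply mul_le_mul_of_nonneg_right _ (by positivity)
            nlinarith
        _ = _ := one_mul _
    simp only [rhs, mul_add, Finset.sum_add_distrib, hj']
    linarith [hxv j]

end

section

variable {m n : ℕ}

/-! ### Values computed by the counted programs -/

section Counted

variable {α β : Type}

@[simp] lemma val_pure (x : α) : (pure x : Counted α).val = x := rfl
@[simp] lemma val_bind (x : Counted α) (f : α → Counted β) :
    (x >>= f).val = (f x.val).val := rfl
@[simp] lemma ops_pure (x : α) : (pure x : Counted α).ops = 0 := rfl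
@[simp] lemma ops_bind (x : Counted α) (f : α → Counted β) :
    (x >>= f).ops = x.ops + (f x.val).ops := rfl
@[simp] lemma val_ite (c : Prop) [Decidable c] (x y : Counted α) :
    (if c then x else y).val = if c then x.val else y.val := apply_ite _ _ _ _
@[simp] lemma ops_ite (c : Prop) [Decidable c] (x y : Counted α) :
    (if c then x else y).ops = if c then x.ops else y.ops := apply_ite _ _ _ _
@[simp] lemma val_rAdd (x y : ℝ) : (rAdd x y).val = x + y := rfl
@[simp] lemma val_rSub (x y : ℝ) : (rSub x y).val = x - y := rfl
@[simp] lemma val_rMul (x y : ℝ) : (rMul x y).val = x * y := rfl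
@[simp] lemma val_rDiv (x y : ℝ) : (rDiv x y).val = x / y := rfl
@[simp] lemma val_rLt (x y : ℝ) : (rLt x y).val = true ↔ x < y := by simp [rLt]
@[simp] lemma val_nLt (x y : ℕ) : (nLt x y).val = true ↔ x < y := by simp [nLt]
@[simp] lemma val_forEach {k : ℕ} (f : Fin k → Counted α) :
    (forEach f).val = fun i => (f i).val := rfl
@[simp] lemma val_isBasic (B : Fin n → Fin m) (j : Fin m) :
    (isBasic B j).val = true ↔ j ∈ Set.range B := by simp [isBasic]

lemma foldlM_val (f : β → α → Counted β) (l : List α) (s : β) :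
    (l.foldlM f s).val = l.foldl (fun s x => (f s x).val) s := by
  induction l generalizing s with
  | nil => rfl
  | cons x l ih => rw [List.foldlM_cons, val_bind, ih, List.foldl_cons]

/-- Invariants of a left fold; `P l s` says that `s` is a correct state after processing `l`. -/
lemma foldl_invariant {f : β → α → β} {P : List α → β → Prop} {s : β} (h0 : P [] s)
    (hs : ∀ l s x, P l s → P (l ++ [x]) (f s x)) (l : List α) : P l (l.foldl f s) := by
  suffices h : ∀ l l' s, P l' s → P (l' ++ l) (l.foldl f s) from h l [] s h0
  intro l
  induction l with
  | nil => intro l' s h; simpa using h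
  | cons x l ih =>
    intro l' s h
    have := ih (l' ++ [x]) _ (hs _ _ x h)
    rwa [List.append_assoc] at this

end Counted

lemma val_dot (u v : Fin n → ℝ) : (dot u v).val = ∑ k, u k * v k := by
  rw [dot, foldlM_val]
  have := foldl_invariant (f := fun s k => s + u k * v k)
    (P := fun (l : List (Fin n)) s => s = (l.map fun k => u k * v k).sum) (s := 0) (by simp)
    (by intro l s x h; simp [h]) (List.finRange n)
  simpa [List.sum_ofFn, List.finRange, List.map_ofFn] using this

/-! ### Sparse polynomials in `ε` -/

namespace SparsePoly

/-- The value of a sparse polynomial. -/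
noncomputable def eval (p : SparsePoly) (ε : ℝ) : ℝ := (p.map fun t => t.2 * ε ^ t.1).sum

/-- The monomials are listed by strictly increasing exponents. -/
def Sorted (p : SparsePoly) : Prop := p.Pairwise fun s t => s.1 < t.1

@[simp] lemma eval_nil (ε : ℝ) : eval [] ε = 0 := rfl
@[simp] lemma eval_cons (t : ℕ × ℝ) (p : SparsePoly) (ε : ℝ) :
    eval (t :: p) ε = t.2 * ε ^ t.1 + eval p ε := by simp [eval]

end SparsePoly

/-- `g ε = o(ε ^ e)` as `ε → 0+`. -/
def IsSmall (e : ℕ) (g : ℝ → ℝ) : Prop := Tendsto (fun ε => g ε / ε ^ e) (𝓝[>] 0) (𝓝 0)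

lemma IsSmall.sub {e : ℕ} {g h : ℝ → ℝ} (hg : IsSmall e g) (hh : IsSmall e h) :
    IsSmall e fun ε => g ε - h ε := by
  have := Tendsto.sub hg hh
  simp only [sub_zero, ← sub_div] at this
  exact this

lemma isSmall_eval {e : ℕ} {p : SparsePoly} (h : ∀ t ∈ p, e < t.1) :
    IsSmall e (SparsePoly.eval p) := by
  induction p with
  | nil => simp [IsSmall]
  | cons t p ih =>
    have h1 := ih fun s hs => h s (List.mem_cons_of_mem _ hs)
    have h2 : Tendsto (fun ε : ℝ => t.2 * ε ^ (t.1 - e)) (𝓝[>] 0) (𝓝 0) := by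
      have hc : Continuous fun ε : ℝ => t.2 * ε ^ (t.1 - e) := by fun_prop
      have := (hc.tendsto 0).mono_left (nhdsWithin_le_nhds (s := Set.Ioi 0))
      have he := h t List.mem_cons_self
      rwa [zero_pow (by omega), mul_zero] at this
    have := h2.add h1
    rw [add_zero] at this
    refine this.congr' ?_
    filter_upwards [self_mem_nhdsWithin] with ε hε
    have hε : (0:ℝ) < ε := hε
    have he := h t List.mem_cons_self
    rw [SparsePoly.eval_cons, add_div, pow_sub₀ _ hε.ne' he.le]
    rw [mul_div_assoc, div_eq_mul_inv (ε ^ t.1)]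

lemma IsSmall.eventually_pos {e : ℕ} {g : ℝ → ℝ} (hg : IsSmall e g) {x : ℝ} (hx : 0 < x) :
    ∀ᶠ ε in 𝓝[>] (0 : ℝ), 0 < x * ε ^ e + g ε := by
  filter_upwards [hg.eventually_const_lt (neg_lt_zero.2 hx), self_mem_nhdsWithin] with ε h hε
  have hε : (0:ℝ) < ε := hε
  rw [lt_div_iff₀ (by positivity)] at h
  linarith

lemma IsSmall.eventually_neg {e : ℕ} {g : ℝ → ℝ} (hg : IsSmall e g) {x : ℝ} (hx : x < 0) :
    ∀ᶠ ε in 𝓝[>] (0 : ℝ), x * ε ^ e + g ε < 0 := by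
  filter_upwards [hg.eventually_lt_const (neg_pos.2 hx), self_mem_nhdsWithin] with ε h hε
  have hε : (0:ℝ) < ε := hε
  rw [div_lt_iff₀ (by positivity)] at h
  linarith

/-- `c` is the truth value of `0 < D ε` for small `ε > 0`. -/
def Decides (c : Bool) (D : ℝ → ℝ) : Prop :=
  (c = true → ∀ᶠ ε in 𝓝[>] (0 : ℝ), 0 < D ε) ∧ (c = false → ∀ᶠ ε in 𝓝[>] (0 : ℝ), D ε ≤ 0)

lemma ltThen_decides {x y : ℝ} {e : ℕ} {next : Counted Bool} {g D : ℝ → ℝ}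
    (hD : ∀ ε, D ε = (y - x) * ε ^ e + g ε) (hg : IsSmall e g) (hnext : Decides next.val g) :
    Decides (ltThen x y next).val D := by
  have hv : (ltThen x y next).val = if x < y then true else if y < x then false else next.val := by
    simp [ltThen]
  rw [hv]
  split_ifs with h1 h2
  · refine ⟨fun _ => ?_, by simp⟩
    filter_upwards [hg.eventually_pos (sub_pos.2 h1)] with ε h
    rwa [hD]
  · refine ⟨by simp, fun _ => ?_⟩
    filter_upwards [hg.eventually_neg (sub_neg.2 h2)] with ε h
    rw [hD]; exact h.le
  · have hxy : x = y := le_antisymm (not_lt.1 h2) (not_lt.1 h1)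
    have : D = g := by funext ε; rw [hD, hxy]; ring
    rwa [this]

open SparsePoly in
/-- The symbolic comparison agrees with the comparison of the values for small `ε`. -/
lemma polyLt_decides (p q : SparsePoly) (hp : p.Sorted) (hq : q.Sorted) :
    Decides (polyLt p q).val fun ε => q.eval ε - p.eval ε := by
  suffices h : ∀ N (p q : SparsePoly), p.length + q.length ≤ N → p.Sorted → q.Sorted →
      Decides (polyLt p q).val fun ε => q.eval ε - p.eval ε from h _ p q le_rfl hp hq
  intro N
  induction N with
  | zero =>
    intro p q h _ _
    have h1 : p = [] := List.eq_nil_of_length_eq_zero (by omega)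
    have h2 : q = [] := List.eq_nil_of_length_eq_zero (by omega)
    subst h1 h2
    simp [polyLt, Decides]
  | succ N ih =>
    intro p q h hp hq
    match p, q with
    | [], [] => simp [polyLt, Decides]
    | [], (f, y) :: q =>
      have hq' := List.pairwise_cons.1 hq
      rw [polyLt]
      refine ltThen_decides (e := f) (fun ε => ?_)
        ((isSmall_eval hq'.1).sub (isSmall_eval (p := []) (by simp)))
        (ih [] q (by simp at h ⊢; omega) hp hq'.2)
      simp
    | (e, x) :: p, [] =>
      have hp' := List.pairwise_cons.1 hp
      rw [polyLt]
      refine ltThen_decides (e := e) (fun ε => ?_)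
        ((isSmall_eval (p := []) (by simp)).sub (isSmall_eval hp'.1))
        (ih p [] (by simp at h ⊢; omega) hp'.2 hq)
      simp; ring
    | (e, x) :: p, (f, y) :: q =>
      have hp' := List.pairwise_cons.1 hp
      have hq' := List.pairwise_cons.1 hq
      simp only [List.length_cons] at h
      rw [polyLt]
      simp only [val_bind, val_ite, val_nLt]
      split_ifs with h1 h2
      · refine ltThen_decides (e := e) (fun ε => ?_)
          ((isSmall_eval (p := (f, y) :: q) ?_).sub (isSmall_eval hp'.1))
          (ih p ((f, y) :: q) (by simp; omega) hp'.2 hq)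
        · simp; ring
        · intro t ht
          rcases List.mem_cons.1 ht with rfl | ht
          · exact h1
          · exact h1.trans (hq'.1 t ht)
      · refine ltThen_decides (e := f) (fun ε => ?_)
          ((isSmall_eval hq'.1).sub (isSmall_eval (p := (e, x) :: p) ?_))
          (ih ((e, x) :: p) q (by simp; omega) hp hq'.2)
        · simp; ring
        · intro t ht
          rcases List.mem_cons.1 ht with rfl | ht
          · exact h2
          · exact h2.trans (hp'.1 t ht)
      · have hef : e = f := by omega
        subst hef
        refine ltThen_decides (e := e) (fun ε => ?_)
          ((isSmall_eval hq'.1).sub (isSmall_eval hp'.1))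
          (ih p q (by omega) hp'.2 hq'.2)
        simp; ring

lemma insertTerm_perm (t : ℕ × ℝ) (p : SparsePoly) : (insertTerm t p).val.Perm (t :: p) := by
  induction p with
  | nil => exact List.Perm.refl _
  | cons s p ih =>
    simp only [insertTerm, val_bind, val_ite, val_nLt, val_pure]
    split_ifs
    · exact List.Perm.refl _
    · exact (ih.cons s).trans (List.Perm.swap t s p)

lemma insertTerm_sorted {t : ℕ × ℝ} {p : SparsePoly} (hp : p.Sorted) (ht : ∀ s ∈ p, s.1 ≠ t.1) :
    SparsePoly.Sorted (insertTerm t p).val := by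
  induction p with
  | nil => exact List.pairwise_singleton _ _
  | cons s p ih =>
    have hp' := List.pairwise_cons.1 hp
    simp only [insertTerm, val_bind, val_ite, val_nLt, val_pure]
    split_ifs with h
    · refine List.pairwise_cons.2 ⟨fun u hu => ?_, hp⟩
      rcases List.mem_cons.1 hu with rfl | hu
      · exact h
      · exact h.trans (hp'.1 u hu)
    · refine List.pairwise_cons.2 ⟨fun u hu => ?_,
        ih hp'.2 fun u hu => ht u (List.mem_cons_of_mem _ hu)⟩
      rcases List.mem_cons.1 ((insertTerm_perm t p).mem_iff.1 hu) with rfl | hu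
      · exact lt_of_le_of_ne (not_lt.1 h) (ht s List.mem_cons_self)
      · exact hp'.1 u hu

lemma insertPos_perm (f : Fin n → ℕ) (k : Fin n) (l : List (Fin n)) :
    (insertPos f k l).val.Perm (k :: l) := by
  induction l with
  | nil => exact List.Perm.refl _
  | cons s l ih =>
    simp only [insertPos, val_bind, val_ite, val_nLt, val_pure]
    split_ifs
    · exact List.Perm.refl _
    · exact (ih.cons s).trans (List.Perm.swap k s l)

lemma insertPos_sorted {f : Fin n → ℕ} {k : Fin n} {l : List (Fin n)}
    (hl : l.Pairwise fun i j => f i < f j) (hk : ∀ i ∈ l, f i ≠ f k) :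
    (insertPos f k l).val.Pairwise fun i j => f i < f j := by
  induction l with
  | nil => exact List.pairwise_singleton _ _
  | cons s l ih =>
    have hl' := List.pairwise_cons.1 hl
    simp only [insertPos, val_bind, val_ite, val_nLt, val_pure]
    split_ifs with h
    · refine List.pairwise_cons.2 ⟨fun u hu => ?_, hl⟩
      rcases List.mem_cons.1 hu with rfl | hu
      · exact h
      · exact h.trans (hl'.1 u hu)
    · refine List.pairwise_cons.2 ⟨fun u hu => ?_,
        ih hl'.2 fun u hu => hk u (List.mem_cons_of_mem _ hu)⟩
      rcases List.mem_cons.1 ((insertPos_perm f k l).mem_iff.1 hu) with rfl | hu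
      · exact lt_of_le_of_ne (not_lt.1 h) (hk s List.mem_cons_self)
      · exact hl'.1 u hu

lemma sortPositions_perm (f : Fin n → ℕ) : (sortPositions f).val.Perm (List.finRange n) := by
  rw [sortPositions, foldlM_val]
  refine foldl_invariant (P := fun l s => List.Perm s l) (List.Perm.refl _) ?_ _
  intro l s x h
  exact (insertPos_perm f x s).trans ((h.cons x).trans (List.perm_append_singleton x l).symm)

lemma sortPositions_sorted {f : Fin n → ℕ} (hf : Function.Injective f) :
    (sortPositions f).val.Pairwise fun i j => f i < f j := by
  rw [sortPositions, foldlM_val]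
  have := foldl_invariant (f := fun s x => (insertPos f x s).val)
    (P := fun l s => l.Nodup → List.Perm s l ∧ s.Pairwise fun i j => f i < f j)
    (s := []) (by simp) ?_ (List.finRange n)
  · exact (this (List.nodup_finRange n)).2
  intro l s x h hnd
  rw [List.nodup_append] at hnd
  obtain ⟨h1, h2⟩ := h hnd.1
  refine ⟨(insertPos_perm f x s).trans
    ((h1.cons x).trans (List.perm_append_singleton x l).symm), insertPos_sorted h2 ?_⟩
  intro i hi he
  exact hnd.2.2 i (h1.mem_iff.1 hi) x (by simp) (hf he)

section Ratio

variable {b : Fin m → ℝ} {e : Fin m → ℕ} {t : Tableau m n}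

/-- The exponent `0` of the constant term comes first because all other exponents are positive, and
`e j` does not occur among the exponents of the basis because `j` is not basic. -/
lemma ratioPoly_sorted (he : Function.Injective e) (hpos : ∀ i, 0 < e i)
    (hB : Function.Injective t.basis) (i : Fin n) {j : Fin m} (hj : j ∉ Set.range t.basis) :
    SparsePoly.Sorted
      (ratioPoly b e t (sortPositions fun k => e (t.basis k)).val i j).val := by
  have h1 := sortPositions_sorted (f := fun k => e (t.basis k)) (he.comp hB)
  simp only [ratioPoly, val_bind, val_pure]
  refine List.pairwise_cons.2 ⟨fun u hu => ?_, insertTerm_sorted ?_ ?_⟩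
  · rcases List.mem_cons.1 ((insertTerm_perm _ _).mem_iff.1 hu) with rfl | hu
    · exact hpos j
    · obtain ⟨k, -, rfl⟩ := List.mem_map.1 hu
      exact hpos _
  · exact List.pairwise_map.2 h1
  · intro s hs
    obtain ⟨k, -, rfl⟩ := List.mem_map.1 hs
    exact fun h => hj ⟨k, he h⟩

lemma ratioPoly_eval (i : Fin n) (j : Fin m) (ε : ℝ) :
    SparsePoly.eval (ratioPoly b e t (sortPositions fun k => e (t.basis k)).val i j).val ε =
      (∑ k, t.T j k * rhs b e ε (t.basis k) - rhs b e ε j) / t.T j i := by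
  simp only [ratioPoly, val_bind, val_pure, SparsePoly.eval_cons]
  have h1 : ∀ p q : SparsePoly, p.Perm q → p.eval ε = q.eval ε := fun p q h =>
    (h.map _).sum_eq
  rw [h1 _ _ (insertTerm_perm _ _), SparsePoly.eval_cons]
  have h2 : SparsePoly.eval ((sortPositions fun k => e (t.basis k)).val.map fun k =>
      (e (t.basis k), t.T j k / t.T j i)) ε =
      ∑ k, t.T j k / t.T j i * ε ^ e (t.basis k) := by
    rw [SparsePoly.eval, List.map_map, ((sortPositions_perm _).map _).sum_eq]
    simp [List.finRange, List.sum_ofFn, List.map_ofFn, Function.comp_def]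
  simp only [val_forEach, val_rDiv, val_rSub, val_dot, h2, pow_zero, mul_one]
  simp only [rhs, mul_add, Finset.sum_add_distrib, div_mul_eq_mul_div, ← Finset.sum_div]
  ring

end Ratio

/-! ### One iteration of the loop -/

/-- `leaving` computes the first position, outside of `S`, whose coordinate vanishes along the
segment, with the time at which it vanishes. -/
lemma leaving_spec (S : Finset (Fin n)) (t : Tableau m n) :
    ((leaving S t).val = none ∧ ∀ k, k ∉ S → t.c k ≤ t.d k) ∨
    ∃ i r, (leaving S t).val = some (i, r) ∧ i ∉ S ∧ t.d i < t.c i ∧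
      r = t.c i / (t.c i - t.d i) ∧
      ∀ k, k ∉ S → t.d k < t.c k → r ≤ t.c k / (t.c k - t.d k) := by
  rw [leaving, foldlM_val]
  have := foldl_invariant (P := fun (l : List (Fin n)) (s : Option (Fin n × ℝ)) =>
      (s = none ∧ ∀ k ∈ l, k ∉ S → t.c k ≤ t.d k) ∨
      ∃ i r, s = some (i, r) ∧ i ∉ S ∧ t.d i < t.c i ∧ r = t.c i / (t.c i - t.d i) ∧
        ∀ k ∈ l, k ∉ S → t.d k < t.c k → r ≤ t.c k / (t.c k - t.d k))
    (f := fun best i => (if i ∈ S then pure best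
    else do
      let decr ← rLt (t.d i) (t.c i)
      if decr then do
        let s ← rSub (t.c i) (t.d i)
        let r ← rDiv (t.c i) s
        match best with
        | none => pure (some (i, r))
        | some (i₀, r₀) => do
          let better ← rLt r r₀
          pure (if better then some (i, r) else some (i₀, r₀))
      else pure best : Counted (Option (Fin n × ℝ))).val) (s := none) (by simp) ?_ (List.finRange n)
  · rcases this with ⟨h1, h2⟩ | ⟨i, r, h1, h2, h3, h4, h5⟩
    · exact Or.inl ⟨h1, fun k => h2 k (List.mem_finRange k)⟩
    · exact Or.inr ⟨i, r, h1, h2, h3, h4, fun k => h5 k (List.mem_finRange k)⟩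
  intro l s x h
  simp only [val_ite, val_bind, val_rLt, val_rSub, val_rDiv, val_pure]
  split_ifs with h1 h2
  · rcases h with ⟨rfl, h⟩ | ⟨i, r, rfl, hi, hlt, hr, h⟩
    · left; refine ⟨rfl, fun k hk hkS => ?_⟩
      rcases List.mem_append.1 hk with hk | hk
      · exact h k hk hkS
      · rw [List.mem_singleton.1 hk] at hkS; exact absurd h1 hkS
    · right; refine ⟨i, r, rfl, hi, hlt, hr, fun k hk hkS => ?_⟩
      rcases List.mem_append.1 hk with hk | hk
      · exact h k hk hkS
      · rw [List.mem_singleton.1 hk] at hkS; exact absurd h1 hkS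
  · right
    rcases h with ⟨rfl, h⟩ | ⟨i, r, rfl, hi, hlt, hr, h⟩
    · refine ⟨x, _, rfl, h1, h2, rfl, fun k hk hkS hlt => ?_⟩
      rcases List.mem_append.1 hk with hk | hk
      · exact absurd hlt (not_lt.2 (h k hk hkS))
      · rw [List.mem_singleton.1 hk]
    · simp only [val_bind, val_pure, val_rLt]
      split_ifs with h3
      · refine ⟨x, _, rfl, h1, h2, rfl, fun k hk hkS hlt => ?_⟩
        rcases List.mem_append.1 hk with hk | hk
        · exact h3.le.trans (h k hk hkS hlt)
        · rw [List.mem_singleton.1 hk]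
      · refine ⟨i, r, rfl, hi, hlt, hr, fun k hk hkS hlt => ?_⟩
        rcases List.mem_append.1 hk with hk | hk
        · exact h k hk hkS hlt
        · rw [List.mem_singleton.1 hk]; exact not_lt.1 h3
  · rcases h with ⟨rfl, h⟩ | ⟨i, r, rfl, hi, hlt, hr, h⟩
    · left; refine ⟨rfl, fun k hk hkS => ?_⟩
      rcases List.mem_append.1 hk with hk | hk
      · exact h k hk hkS
      · rw [List.mem_singleton.1 hk]; exact not_lt.1 h2
    · right; refine ⟨i, r, rfl, hi, hlt, hr, fun k hk hkS hlt => ?_⟩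
      rcases List.mem_append.1 hk with hk | hk
      · exact h k hk hkS hlt
      · rw [List.mem_singleton.1 hk] at hlt; exact absurd hlt h2

/-- `entering` computes a row that minimizes the perturbed ratio among the blocking rows. -/
lemma entering_spec {b : Fin m → ℝ} {e : Fin m → ℕ} {t : Tableau m n}
    (he : Function.Injective e) (hpos : ∀ i, 0 < e i) (hB : Function.Injective t.basis)
    (i : Fin n) :
    ((entering b e t i).val = none ∧ ∀ j, j ∉ Set.range t.basis → 0 ≤ t.T j i) ∨
    ∃ j p, (entering b e t i).val = some (j, p) ∧ j ∉ Set.range t.basis ∧ t.T j i < 0 ∧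
      ∀ l, l ∉ Set.range t.basis → t.T l i < 0 → ∀ᶠ ε in 𝓝[>] (0 : ℝ),
        (∑ k, t.T j k * rhs b e ε (t.basis k) - rhs b e ε j) / t.T j i ≤
        (∑ k, t.T l k * rhs b e ε (t.basis k) - rhs b e ε l) / t.T l i := by
  rw [entering, val_bind, foldlM_val]
  set ord := (sortPositions fun k => e (t.basis k)).val with hord
  set ρ : Fin m → ℝ → ℝ := fun j ε =>
    (∑ k, t.T j k * rhs b e ε (t.basis k) - rhs b e ε j) / t.T j i with hρ
  have hcmp : ∀ j l, j ∉ Set.range t.basis → l ∉ Set.range t.basis →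
      Decides (polyLt (ratioPoly b e t ord i j).val (ratioPoly b e t ord i l).val).val
        fun ε => ρ l ε - ρ j ε := fun j l hj hl => by
    have := polyLt_decides _ _ (ratioPoly_sorted (b := b) he hpos hB i hj)
      (ratioPoly_sorted (b := b) he hpos hB i hl)
    simpa only [ratioPoly_eval] using this
  have := foldl_invariant (P := fun (l : List (Fin m)) (s : Option (Fin m × SparsePoly)) =>
      (s = none ∧ ∀ j ∈ l, j ∉ Set.range t.basis → 0 ≤ t.T j i) ∨
      ∃ j, s = some (j, (ratioPoly b e t ord i j).val) ∧ j ∉ Set.range t.basis ∧ t.T j i < 0 ∧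
        ∀ k ∈ l, k ∉ Set.range t.basis → t.T k i < 0 → ∀ᶠ ε in 𝓝[>] (0 : ℝ), ρ j ε ≤ ρ k ε)
    (f := fun best j => (do
      let basic ← isBasic t.basis j
      if basic then pure best
      else do
        let blocking ← rLt (t.T j i) 0
        if blocking then do
          let p ← ratioPoly b e t ord i j
          match best with
          | none => pure (some (j, p))
          | some (j₀, p₀) => do
            let better ← polyLt p p₀
            pure (if better then some (j, p) else some (j₀, p₀))
        else pure best : Counted (Option (Fin m × SparsePoly))).val)
    (s := none) (by simp) ?_ (List.finRange m)
  · rcases this with ⟨h1, h2⟩ | ⟨j, h1, h2, h3, h4⟩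
    · exact Or.inl ⟨h1, fun j => h2 j (List.mem_finRange j)⟩
    · exact Or.inr ⟨j, _, h1, h2, h3, fun l => h4 l (List.mem_finRange l)⟩
  intro l s x h
  simp only [val_ite, val_bind, val_rLt, val_pure, val_isBasic]
  split_ifs with h1 h2
  · rcases h with ⟨rfl, h⟩ | ⟨j, rfl, hj, hlt, h⟩
    · left; refine ⟨rfl, fun k hk hkS => ?_⟩
      rcases List.mem_append.1 hk with hk | hk
      · exact h k hk hkS
      · rw [List.mem_singleton.1 hk] at hkS; exact absurd h1 hkS
    · right; refine ⟨j, rfl, hj, hlt, fun k hk hkS => ?_⟩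
      rcases List.mem_append.1 hk with hk | hk
      · exact h k hk hkS
      · rw [List.mem_singleton.1 hk] at hkS; exact absurd h1 hkS
  · right
    rcases h with ⟨rfl, h⟩ | ⟨j, rfl, hj, hlt, h⟩
    · refine ⟨x, rfl, h1, h2, fun k hk hkS hlt => ?_⟩
      rcases List.mem_append.1 hk with hk | hk
      · exact absurd hlt (not_lt.2 (h k hk hkS))
      · rw [List.mem_singleton.1 hk]; exact Eventually.of_forall fun _ => le_rfl
    · have hd := hcmp x j h1 hj
      simp only [val_bind, val_pure]
      split_ifs with h3
      · have hd := hd.1 h3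
        refine ⟨x, rfl, h1, h2, fun k hk hkS hlt => ?_⟩
        rcases List.mem_append.1 hk with hk | hk
        · filter_upwards [hd, h k hk hkS hlt] with ε h4 h5
          linarith
        · rw [List.mem_singleton.1 hk]; exact Eventually.of_forall fun _ => le_rfl
      · have hd := hd.2 (by simpa using h3)
        refine ⟨j, rfl, hj, hlt, fun k hk hkS hlt => ?_⟩
        rcases List.mem_append.1 hk with hk | hk
        · exact h k hk hkS hlt
        · rw [List.mem_singleton.1 hk]
          filter_upwards [hd] with ε h4
          linarith
  · rcases h with ⟨rfl, h⟩ | ⟨j, rfl, hj, hlt, h⟩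
    · left; refine ⟨rfl, fun k hk hkS => ?_⟩
      rcases List.mem_append.1 hk with hk | hk
      · exact h k hk hkS
      · rw [List.mem_singleton.1 hk]; exact not_lt.1 h2
    · right; refine ⟨j, rfl, hj, hlt, fun k hk hkS hlt => ?_⟩
      rcases List.mem_append.1 hk with hk | hk
      · exact h k hk hkS hlt
      · rw [List.mem_singleton.1 hk] at hlt; exact absurd hlt h2

lemma val_eliminate (i : Fin n) (q p : Fin n → ℝ) :
    (eliminate i q p).val = fun k => if k = i then p i / q i else p k - p i / q i * q k := by
  simp [eliminate]

variable {a : Fin m → Euc n} {b : Fin m → ℝ} {e : Fin m → ℕ} {B : Fin n → Fin m}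

/-- A pivot maps the tableau of a basis to the tableau of the new basis. Hence the tableau of the loop
is always the initial tableau of its current basis. -/
lemma val_exchange (hB : LinearIndependent ℝ fun k => a (B k)) (c d : Euc n) {i : Fin n}
    {j : Fin m} (hij : coords a B (a j) i ≠ 0) :
    (exchange (initialTableau a B c d) i j).val =
      initialTableau a (Function.update B i j) c d := by
  simp only [exchange, val_bind, val_pure, val_forEach, val_eliminate, initialTableau,
    coords_update hB hij]

/-- One iteration of the loop on the tableau of a feasible basis of a bounded polyhedron: either no
coordinate becomes negative before the end of the segment, or the basis changes by a pivot that
preserves feasibility. -/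
lemma iteration_spec (he : Function.Injective e) (hpos : ∀ i, 0 < e i)
    (hbdd : Bornology.IsBounded (polyhedron a b)) (hB : EpsFeasible a b e B)
    (S : Finset (Fin n)) (c d : Euc n) :
    ((iteration b e S (initialTableau a B c d)).val = Outcome.finished ∧
      ∀ k, k ∉ S → coords a B d k < coords a B c k →
        1 ≤ coords a B c k / (coords a B c k - coords a B d k)) ∨
    ∃ i j, (iteration b e S (initialTableau a B c d)).val =
        Outcome.pivot (initialTableau a (Function.update B i j) c d) ∧ i ∉ S ∧
      coords a B (a j) i < 0 ∧ EpsFeasible a b e (Function.update B i j) ∧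
      coords a B d i < coords a B c i ∧
      coords a B c i / (coords a B c i - coords a B d i) < 1 ∧
      ∀ k, k ∉ S → coords a B d k < coords a B c k →
        coords a B c i / (coords a B c i - coords a B d i) ≤
          coords a B c k / (coords a B c k - coords a B d k) := by
  have hinj := injective_of_linInd hB.1
  simp only [iteration, val_bind]
  rcases leaving_spec S (initialTableau a B c d) with ⟨h1, h2⟩ | ⟨i, r, h1, hiS, hlt, hr, h2⟩
  · left
    simp only [h1]
    exact ⟨rfl, fun k hk hlt => absurd hlt (not_lt.2 (h2 k hk))⟩
  · simp only [h1, val_bind, val_ite, val_pure, val_rLt]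
    split_ifs with hr1
    · right
      rcases entering_spec (b := b) (t := initialTableau a B c d) he hpos hinj i with
        ⟨h3, h4⟩ | ⟨j, p, h3, hj, hneg, h4⟩
      · exfalso
        obtain ⟨j, hj⟩ := exists_blocking hbdd ⟨_, hB.vert_mem hpos⟩ hB.1 i
        by_cases hjB : j ∈ Set.range B
        · obtain ⟨k, rfl⟩ := hjB
          rw [coords_row hB.1, Pi.single_apply] at hj
          split_ifs at hj <;> linarith
        · exact absurd hj (not_lt.2 (h4 j hjB))
      · refine ⟨i, j, ?_, hiS, hneg, hB.update hneg fun l hl hl' => h4 l hl hl', hlt, ?_, ?_⟩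
        · simp only [h3, val_bind, val_pure]
          rw [val_exchange hB.1 c d (ne_of_lt hneg)]
        · rw [hr] at hr1; exact hr1
        · rw [hr] at h2; exact h2
    · left
      exact ⟨rfl, fun k hk hk' => (not_lt.1 hr1).trans (h2 k hk hk')⟩

end

section

variable {m n : ℕ}

/-! ### Operation counts -/

@[simp] lemma ops_rAdd (x y : ℝ) : (rAdd x y).ops = 1 := rfl
@[simp] lemma ops_rSub (x y : ℝ) : (rSub x y).ops = 1 := rfl
@[simp] lemma ops_rMul (x y : ℝ) : (rMul x y).ops = 1 := rfl
@[simp] lemma ops_rDiv (x y : ℝ) : (rDiv x y).ops = 1 := rfl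
@[simp] lemma ops_rLt (x y : ℝ) : (rLt x y).ops = 1 := rfl
@[simp] lemma ops_nLt (x y : ℕ) : (nLt x y).ops = 1 := rfl
@[simp] lemma ops_isBasic (B : Fin n → Fin m) (j : Fin m) : (isBasic B j).ops = n := rfl

lemma ops_forEach_le {α : Type} {k K : ℕ} {f : Fin k → Counted α} (h : ∀ i, (f i).ops ≤ K) :
    (forEach f).ops ≤ k * K := by
  have := Finset.sum_le_card_nsmul Finset.univ (fun i => (f i).ops) K fun i _ => h i
  simpa [forEach] using this

/-- The cost of a loop whose state satisfies an invariant `P`, under which each step costs at most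
`K`. -/
lemma ops_foldlM_le {α β : Type} {f : β → α → Counted β} {P : β → Prop} {K : ℕ}
    (h : ∀ s x, P s → P (f s x).val ∧ (f s x).ops ≤ K) (l : List α) {s : β} (hs : P s) :
    (l.foldlM f s).ops ≤ l.length * K := by
  induction l generalizing s with
  | nil => simp
  | cons x l ih =>
    rw [List.foldlM_cons, ops_bind, List.length_cons]
    have := ih (h s x hs).1
    have := (h s x hs).2
    linarith [Nat.succ_mul l.length K]

lemma ops_dot (u v : Fin n → ℝ) : (dot u v).ops ≤ n * 2 := by
  have := ops_foldlM_le (f := fun s k => do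
    let t ← rMul (u k) (v k)
    rAdd s t) (P := fun _ => True) (K := 2) (by intro s x _; simp) (List.finRange n) (s := 0) trivial
  rwa [List.length_finRange] at this

lemma ops_ltThen_le (x y : ℝ) (next : Counted Bool) : (ltThen x y next).ops ≤ 2 + next.ops := by
  simp only [ltThen, ops_bind, ops_rLt, ops_ite, ops_pure]
  split_ifs <;> omega

lemma ops_polyLt_le (p q : SparsePoly) : (polyLt p q).ops ≤ 4 * (p.length + q.length) := by
  suffices h : ∀ N (p q : SparsePoly), p.length + q.length ≤ N →
      (polyLt p q).ops ≤ 4 * (p.length + q.length) from h _ p q le_rfl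
  intro N
  induction N with
  | zero =>
    intro p q h
    have h1 : p = [] := List.eq_nil_of_length_eq_zero (by omega)
    have h2 : q = [] := List.eq_nil_of_length_eq_zero (by omega)
    subst h1 h2
    simp [polyLt]
  | succ N ih =>
    intro p q h
    match p, q with
    | [], [] => simp [polyLt]
    | [], (f, y) :: q =>
      rw [polyLt]
      have h1 := ops_ltThen_le 0 y (polyLt [] q)
      have h2 := ih [] q (by simp at h ⊢; omega)
      simp only [List.length_cons, List.length_nil] at *
      omega
    | (e, x) :: p, [] =>
      rw [polyLt]
      have h1 := ops_ltThen_le x 0 (polyLt p [])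
      have h2 := ih p [] (by simp at h ⊢; omega)
      simp only [List.length_cons, List.length_nil] at *
      omega
    | (e, x) :: p, (f, y) :: q =>
      rw [polyLt]
      have h1 := ops_ltThen_le x 0 (polyLt p ((f, y) :: q))
      have h2 := ih p ((f, y) :: q) (by simp at h ⊢; omega)
      have h3 := ops_ltThen_le 0 y (polyLt ((e, x) :: p) q)
      have h4 := ih ((e, x) :: p) q (by simp at h ⊢; omega)
      have h5 := ops_ltThen_le x y (polyLt p q)
      have h6 := ih p q (by simp at h ⊢; omega)
      simp only [ops_bind, ops_nLt, ops_ite, List.length_cons] at *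
      split_ifs <;> omega

lemma ops_insertTerm_le (t : ℕ × ℝ) (p : SparsePoly) : (insertTerm t p).ops ≤ p.length := by
  induction p with
  | nil => simp [insertTerm]
  | cons s p ih =>
    simp only [insertTerm, ops_bind, ops_nLt, ops_ite, ops_pure, List.length_cons]
    split_ifs <;> omega

lemma ops_insertPos_le (f : Fin n → ℕ) (k : Fin n) (l : List (Fin n)) :
    (insertPos f k l).ops ≤ l.length := by
  induction l with
  | nil => simp [insertPos]
  | cons s p ih =>
    simp only [insertPos, ops_bind, ops_nLt, ops_ite, ops_pure, List.length_cons]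
    split_ifs <;> omega

lemma ops_sortPositions_le (f : Fin n → ℕ) : (sortPositions f).ops ≤ n * n := by
  suffices h : ∀ l s : List (Fin n), (l.foldlM (fun ls k => insertPos f k ls) s).ops ≤
      l.length * (s.length + l.length) by
    have := h (List.finRange n) []
    simpa [sortPositions] using this
  intro l
  induction l with
  | nil => simp
  | cons x l ih =>
    intro s
    rw [List.foldlM_cons, ops_bind, List.length_cons]
    have h1 := ih (insertPos f x s).val
    have h2 := ops_insertPos_le f x s
    rw [(insertPos_perm f x s).length_eq, List.length_cons] at h1
    nlinarith

lemma ops_eliminate_le (i : Fin n) (q p : Fin n → ℝ) : (eliminate i q p).ops ≤ 1 + n * 2 := by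
  simp only [eliminate, ops_bind, ops_rDiv]
  have := ops_forEach_le (K := 2) (f := fun k => if k = i then pure ((rDiv (p i) (q i)).val) else do
      let w ← rMul (rDiv (p i) (q i)).val (q k)
      rSub (p k) w) (by intro k; simp only [ops_ite, ops_pure, ops_bind, ops_rMul, ops_rSub]; split_ifs <;> omega)
  omega

lemma ops_exchange_le (t : Tableau m n) (i : Fin n) (j : Fin m) :
    (exchange t i j).ops ≤ (m + 2) * (1 + n * 2) := by
  simp only [exchange, ops_bind, ops_pure]
  have h1 := ops_forEach_le (f := fun l => eliminate i (t.T j) (t.T l))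
    fun l => ops_eliminate_le i (t.T j) (t.T l)
  have h2 := ops_eliminate_le i (t.T j) t.c
  have h3 := ops_eliminate_le i (t.T j) t.d
  linarith [add_mul m 2 (1 + n * 2)]

lemma ops_leaving_le (S : Finset (Fin n)) (t : Tableau m n) : (leaving S t).ops ≤ n * 4 := by
  rw [leaving]
  refine (ops_foldlM_le (P := fun _ => True) (K := 4) ?_ (List.finRange n) trivial).trans
    (by rw [List.length_finRange])
  intro s x _
  refine ⟨trivial, ?_⟩
  rcases s with _ | ⟨i, r⟩ <;> simp <;> split_ifs <;> omega

/-- The length of the ratio polynomials, one term for each row of the basis and two more, bounds the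
cost of comparing them. -/
lemma ratioPoly_ops_length (b : Fin m → ℝ) (e : Fin m → ℕ) (t : Tableau m n)
    {ord : List (Fin n)} (hord : ord.length = n) (i : Fin n) (j : Fin m) :
    (ratioPoly b e t ord i j).ops ≤ 4 * n + 3 ∧
      (ratioPoly b e t ord i j).val.length = n + 2 := by
  simp only [ratioPoly, ops_bind, ops_pure, val_bind, val_pure, List.length_cons]
  constructor
  · have h1 := ops_dot (t.T j) fun k => b (t.basis k)
    have h2 := ops_forEach_le (K := 1) (f := fun k => rDiv (t.T j k) (t.T j i)) fun k => le_rfl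
    refine le_trans (Nat.add_le_add h1 (Nat.add_le_add_left (Nat.add_le_add_left
      (Nat.add_le_add h2 (Nat.add_le_add_left (Nat.add_le_add_right
        (ops_insertTerm_le _ _) _) _)) _) _)) ?_
    rw [List.length_map, hord, ops_rSub, ops_rDiv, ops_rDiv]
    omega
  · rw [(insertTerm_perm _ _).length_eq, List.length_cons, List.length_map, hord]

lemma ops_entering_le (b : Fin m → ℝ) (e : Fin m → ℕ) (t : Tableau m n) (i : Fin n) :
    (entering b e t i).ops ≤ n * n + m * (13 * n + 20) := by
  rw [entering, ops_bind]
  have hord : (sortPositions fun k => e (t.basis k)).val.length = n := by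
    rw [(sortPositions_perm _).length_eq, List.length_finRange]
  set ord := (sortPositions fun k => e (t.basis k)).val
  refine Nat.add_le_add (ops_sortPositions_le _) ?_
  refine (ops_foldlM_le (P := fun s => ∀ j p, s = some (j, p) → p.length = n + 2)
    (K := 13 * n + 20) ?_ (List.finRange m) (by simp)).trans (by rw [List.length_finRange])
  intro s x hs
  obtain ⟨h1, h2⟩ := ratioPoly_ops_length b e t hord i x
  set p := ratioPoly b e t ord i x with hp
  rcases s with _ | ⟨j, q⟩
  · simp only [val_bind, val_ite, val_pure, ops_bind, ops_ite, ops_pure, ops_isBasic, ops_rLt]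
    refine ⟨?_, by split_ifs <;> omega⟩
    intro j' p' h
    split_ifs at h
    simp only [Option.some.injEq, Prod.mk.injEq] at h
    rw [← h.2, h2]
  · have hq := hs j q rfl
    have h3 := ops_polyLt_le p.val q
    rw [h2, hq] at h3
    simp only [val_bind, val_ite, val_pure, ops_bind, ops_ite, ops_pure, ops_isBasic, ops_rLt]
    refine ⟨?_, by split_ifs <;> omega⟩
    intro j' p' h
    split_ifs at h <;> simp only [Option.some.injEq, Prod.mk.injEq] at h <;> rw [← h.2] <;>
      assumption

lemma ops_iteration_le (hn : 1 ≤ n) (hnm : n ≤ m) (b : Fin m → ℝ) (e : Fin m → ℕ)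
    (S : Finset (Fin n)) (t : Tableau m n) : (iteration b e S t).ops ≤ 48 * (m * n) := by
  have hkey : n * 4 + (1 + (n * n + m * (13 * n + 20) + (m + 2) * (1 + n * 2))) ≤
      48 * (m * n) := by
    have h1 : n * n ≤ m * n := Nat.mul_le_mul_right n hnm
    have h2 : m ≤ m * n := Nat.le_mul_of_pos_right m hn
    have h3 : n ≤ m * n := Nat.le_mul_of_pos_left n (by omega)
    nlinarith
  refine le_trans ?_ hkey
  have hl := ops_leaving_le S t
  simp only [iteration, ops_bind]
  rcases (leaving S t).val with _ | ⟨i, r⟩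
  · simp only [ops_pure]; omega
  · simp only [ops_bind, ops_rLt, ops_ite, ops_pure]
    have h1 := ops_entering_le b e t i
    split_ifs
    · rcases (entering b e t i).val with _ | ⟨j, p⟩
      · simp only [ops_pure]; omega
      · simp only [ops_bind, ops_pure]
        have h2 := ops_exchange_le t i j
        omega
    · omega

lemma loop_costs (hn : 1 ≤ n) (hnm : n ≤ m) (b : Fin m → ℝ) (e : Fin m → ℕ)
    (S : Finset (Fin n)) (N : ℕ) (t : Tableau m n) {r : Output m n} (h : loop b e S N t = some r) :
    ∀ x ∈ r.pivotCosts, x ≤ 48 * (m * n) := by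
  induction N generalizing t r with
  | zero => simp [loop] at h
  | succ N ih =>
    rw [loop] at h
    rcases hi : (iteration b e S t).val with _ | _ | t' <;> rw [hi] at h
    · simp only [Option.some.injEq] at h
      subst h; simp
    · simp at h
    · simp only [Option.map_eq_some_iff] at h
      obtain ⟨r', h1, rfl⟩ := h
      intro x hx
      rcases List.mem_cons.1 hx with rfl | hx
      · exact ops_iteration_le hn hnm b e S t
      · exact ih t' h1 x hx

lemma shadowSimplex_costs (hn : 1 ≤ n) (hnm : n ≤ m) {a : Fin m → Euc n} {b : Fin m → ℝ}
    {e : Fin m → ℕ} {S : Finset (Fin n)} {B : Fin n → Fin m} {c d : Euc n} {r : Output m n}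
    (h : shadowSimplex a b e S B c d = some r) : ∀ x ∈ r.pivotCosts, x ≤ 48 * (m * n) := by
  rw [shadowSimplex] at h
  split_ifs at h
  exact loop_costs hn hnm b e S _ _ h

lemma optimizeFace_costs (hn : 1 ≤ n) (hnm : n ≤ m) {a : Fin m → Euc n} {b : Fin m → ℝ}
    {e : Fin m → ℕ} {δ : ℝ} {d : Euc n} {X : (k : ℕ) → Euc k} (k : ℕ) {S : Finset (Fin n)}
    {B : Fin n → Fin m} {r : Output m n} (h : optimizeFace a b δ d e X k S B = some r) :
    ∀ x ∈ r.pivotCosts, x ≤ 48 * (m * n) := by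
  induction k generalizing S B r with
  | zero =>
    simp only [optimizeFace, Option.some.injEq] at h
    subst h; simp
  | succ k ih =>
    rw [optimizeFace] at h
    simp only at h
    split_ifs at h
    · simp only [Option.some.injEq] at h
      subst h; simp
    · simp only [Option.bind_eq_some_iff, Option.map_eq_some_iff] at h
      obtain ⟨r₁, h1, r₂, h2, r₃, h3, i, -, r₄, h4, rfl⟩ := h
      intro x hx
      simp only [List.mem_append] at hx
      rcases hx with ((hx | hx) | hx) | hx
      · exact shadowSimplex_costs hn hnm h1 x hx
      · exact shadowSimplex_costs hn hnm h2 x hx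
      · exact shadowSimplex_costs hn hnm h3 x hx
      · exact ih h4 x hx

end

section

variable {m n : ℕ} {a : Fin m → Euc n} {b : Fin m → ℝ} {e : Fin m → ℕ} {B : Fin n → Fin m}

/-! ### The normal cones of a face -/

/-- The open normal cone that belongs to the set `R` of rows on the face on which the rows in `S₀`
are tight: the coefficients of the rows in `S₀` are arbitrary, i.e. the cone contains the span of
these rows. -/
def cone (a : Fin m → Euc n) (S₀ R : Finset (Fin m)) : Set (Euc n) :=
  {z | ∃ μ : Fin m → ℝ, (∀ i ∈ R, i ∉ S₀ → 0 < μ i) ∧ ∑ i ∈ R, μ i • a i = z}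

lemma mem_cone_iff (hB : LinearIndependent ℝ fun k => a (B k)) (S₀ : Finset (Fin m)) {z : Euc n} :
    z ∈ cone a S₀ (Finset.univ.image B) ↔ ∀ k, B k ∉ S₀ → 0 < coords a B z k := by
  have hinj := injective_of_linInd hB
  constructor
  · rintro ⟨μ, h1, h2⟩ k hk
    rw [Finset.sum_image fun x _ y _ h => hinj h] at h2
    rw [coords_unique hB (μ := fun k => μ (B k)) h2]
    exact h1 _ (Finset.mem_image_of_mem _ (Finset.mem_univ k)) hk
  · intro h
    refine ⟨fun i => Function.extend B (coords a B z) 0 i, fun i hi hiS => ?_, ?_⟩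
    · obtain ⟨k, -, rfl⟩ := Finset.mem_image.1 hi
      simp only [hinj.extend_apply]
      exact h k hiS
    · rw [Finset.sum_image fun x _ y _ h => hinj h]
      simp only [hinj.extend_apply]
      exact sum_coords hB z

open Classical in
/-- The row sets of the feasible bases of the perturbed face on which the rows in `S₀` are tight. -/
noncomputable def faceBases (a : Fin m → Euc n) (b : Fin m → ℝ) (e : Fin m → ℕ)
    (S₀ : Finset (Fin m)) : Finset (Finset (Fin m)) :=
  Finset.univ.filter fun R => S₀ ⊆ R ∧
    ∃ B : Fin n → Fin m, EpsFeasible a b e B ∧ Finset.univ.image B = R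

lemma image_mem_faceBases {S₀ : Finset (Fin m)} (hB : EpsFeasible a b e B)
    (hS : S₀ ⊆ Finset.univ.image B) : Finset.univ.image B ∈ faceBases a b e S₀ := by
  classical
  rw [faceBases, Finset.mem_filter]
  exact ⟨Finset.mem_univ _, hS, B, hB, rfl⟩

/-- The cones of different bases are disjoint: the perturbed vertices of both bases would be the
unique maximizer of the same objective on the face. -/
lemma faceBases_disjoint (he : Function.Injective e) (hpos : ∀ i, 0 < e i) {S₀ R R' : Finset (Fin m)}
    (hR : R ∈ faceBases a b e S₀) (hR' : R' ∈ faceBases a b e S₀) {z : Euc n}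
    (hz : z ∈ cone a S₀ R) (hz' : z ∈ cone a S₀ R') : R = R' := by
  classical
  suffices key : ∀ R R', R ∈ faceBases a b e S₀ → R' ∈ faceBases a b e S₀ →
      z ∈ cone a S₀ R → z ∈ cone a S₀ R' → R ⊆ R' from
    Finset.Subset.antisymm (key R R' hR hR' hz hz') (key R' R hR' hR hz' hz)
  rintro R R' hR hR' ⟨μ, hμ, hz⟩ ⟨ν, hν, hz'⟩
  rw [faceBases, Finset.mem_filter] at hR hR'
  obtain ⟨-, hS, B, hB, rfl⟩ := hR
  obtain ⟨-, hS', B', hB', rfl⟩ := hR'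
  obtain ⟨ε, h1, h2, h3⟩ := (hB.2.and (hB'.2.and (hB'.strict he hpos))).exists
  set x := pvert a b e B ε with hx
  set x' := pvert a b e B' ε with hx'
  have hxt : ∀ i ∈ Finset.univ.image B, inner ℝ (a i) x = rhs b e ε i := fun i hi => by
    obtain ⟨k, -, rfl⟩ := Finset.mem_image.1 hi
    exact inner_pvert hB.1 ε k
  have hxt' : ∀ i ∈ Finset.univ.image B', inner ℝ (a i) x' = rhs b e ε i := fun i hi => by
    obtain ⟨k, -, rfl⟩ := Finset.mem_image.1 hi
    exact inner_pvert hB'.1 ε k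
  have e1 : inner ℝ z x - inner ℝ z x' =
      ∑ i ∈ Finset.univ.image B, μ i * (rhs b e ε i - inner ℝ (a i) x') := by
    rw [← inner_sub_right, ← hz, sum_inner]
    refine Finset.sum_congr rfl fun i hi => ?_
    rw [real_inner_smul_left, inner_sub_right, hxt i hi]
  have e2 : inner ℝ z x' - inner ℝ z x =
      ∑ i ∈ Finset.univ.image B', ν i * (rhs b e ε i - inner ℝ (a i) x) := by
    rw [← inner_sub_right, ← hz', sum_inner]
    refine Finset.sum_congr rfl fun i hi => ?_
    rw [real_inner_smul_left, inner_sub_right, hxt' i hi]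
  have p1 : ∀ i ∈ Finset.univ.image B, 0 ≤ μ i * (rhs b e ε i - inner ℝ (a i) x') := by
    intro i hi
    by_cases hiS : i ∈ S₀
    · rw [hxt' i (hS' hiS)]; simp
    · exact mul_nonneg (hμ i hi hiS).le (sub_nonneg.2 (h2 i))
  have p2 : ∀ i ∈ Finset.univ.image B', 0 ≤ ν i * (rhs b e ε i - inner ℝ (a i) x) := by
    intro i hi
    by_cases hiS : i ∈ S₀
    · rw [hxt i (hS hiS)]; simp
    · exact mul_nonneg (hν i hi hiS).le (sub_nonneg.2 (h1 i))
  have hsum0 : ∑ i ∈ Finset.univ.image B, μ i * (rhs b e ε i - inner ℝ (a i) x') = 0 := by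
    have := Finset.sum_nonneg p1
    have := Finset.sum_nonneg p2
    linarith
  intro i hi
  by_cases hiS : i ∈ S₀
  · exact hS' hiS
  · have h0 := (Finset.sum_eq_zero_iff_of_nonneg p1).1 hsum0 i hi
    by_contra hni
    have hlt := h3 i fun ⟨k, hk⟩ => hni (hk ▸ Finset.mem_image_of_mem _ (Finset.mem_univ k))
    exact absurd h0 (mul_pos (hμ i hi hiS) (sub_pos.2 hlt)).ne'

/-! ### Following a segment -/

/-- The segment does not meet two facets of a cone at the same time, except perhaps at its start,
and does not end on a facet. -/
def GenericSegment (a : Fin m → Euc n) (b : Fin m → ℝ) (e : Fin m → ℕ) (S₀ : Finset (Fin m))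
    (c d : Euc n) : Prop :=
  ∀ B : Fin n → Fin m, EpsFeasible a b e B → S₀ ⊆ Finset.univ.image B →
    (∀ k, B k ∉ S₀ → coords a B d k ≠ 0) ∧
    ∀ t : ℝ, 0 < t → t ≤ 1 → ∀ k l, k ≠ l → B k ∉ S₀ → B l ∉ S₀ →
      coords a B (c + t • (d - c)) k = 0 → coords a B (c + t • (d - c)) l ≠ 0

open Classical in
/-- The cones that the segment `[c, d]` leaves at or after the time `s`. -/
noncomputable def exitsFrom (a : Fin m → Euc n) (b : Fin m → ℝ) (e : Fin m → ℕ)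
    (S₀ : Finset (Fin m)) (c d : Euc n) (s : ℝ) : Finset (Finset (Fin m)) :=
  (faceBases a b e S₀).filter fun R =>
    (∃ t, s ≤ t ∧ t ≤ 1 ∧ c + t • (d - c) ∈ cone a S₀ R) ∧ d ∉ cone a S₀ R

/-- The cones that the segment `[c, d]` leaves. -/
noncomputable def exits (a : Fin m → Euc n) (b : Fin m → ℝ) (e : Fin m → ℕ)
    (S₀ : Finset (Fin m)) (c d : Euc n) : Finset (Finset (Fin m)) :=
  exitsFrom a b e S₀ c d 0

lemma loop_succ_of_some {S : Finset (Fin n)} {N : ℕ} {t : Tableau m n} {r : Output m n}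
    (h : loop b e S N t = some r) : loop b e S (N + 1) t = some r := by
  induction N generalizing t r with
  | zero => simp [loop] at h
  | succ N ih =>
    rw [loop] at h ⊢
    rcases hi : (iteration b e S t).val with _ | _ | t' <;> rw [hi] at h
    · exact h
    · simp at h
    · simp only [Option.map_eq_some_iff] at h ⊢
      obtain ⟨r', h1, rfl⟩ := h
      exact ⟨r', ih h1, rfl⟩

lemma loop_of_le {S : Finset (Fin n)} {N N' : ℕ} (hN : N ≤ N') {t : Tableau m n} {r : Output m n}
    (h : loop b e S N t = some r) : loop b e S N' t = some r := by
  induction hN with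
  | refl => exact h
  | step _ ih => exact loop_succ_of_some ih

lemma shadowSimplex_eq_some_iff {S : Finset (Fin n)} {c d : Euc n} {r : Output m n} :
    shadowSimplex a b e S B c d = some r ↔
      ∃ N, loop b e S N (initialTableau a B c d) = some r := by
  rw [shadowSimplex]
  constructor
  · intro h
    split_ifs at h with h'
    exact ⟨_, h⟩
  · rintro ⟨N, hN⟩
    have h' : ∃ N, (loop b e S N (initialTableau a B c d)).isSome := ⟨N, by rw [hN]; rfl⟩
    rw [dif_pos h']
    obtain ⟨r', hr'⟩ := Option.isSome_iff_exists.1 (Nat.find_spec h')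
    have h1 := loop_of_le (le_max_left _ N) hr'
    have h2 := loop_of_le (le_max_right (Nat.find h') N) hN
    rw [hr', ← h1, h2]

/-- The loop follows a generic segment to its end, with at most one pivot for each cone that the
segment leaves. A row whose (normalized) coefficient is so large that it cannot drop to zero on the
rest of the segment keeps its position; `ρ` bounds the rate of change. -/
lemma loop_spec (he : Function.Injective e) (hpos : ∀ i, 0 < e i)
    (hbdd : Bornology.IsBounded (polyhedron a b)) {ρ : ℝ}
    (hρ : ∀ B : Fin n → Fin m, EpsFeasible a b e B → ∀ z k,
      |coords a B z k| * ‖a (B k)‖ ≤ ρ * ‖z‖)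
    {S : Finset (Fin n)} {S₀ : Finset (Fin m)} {c d : Euc n}
    (hgen : GenericSegment a b e S₀ c d) (N : ℕ) {B : Fin n → Fin m} {s : ℝ} (hs0 : 0 ≤ s)
    (hs1 : s < 1) (hS : S.image B = S₀) (hB : EpsFeasible a b e B)
    (hstart : ∀ k, k ∉ S → 0 < coords a B (c + s • (d - c)) k)
    (hN : (exitsFrom a b e S₀ c d s).card < N) :
    ∃ r, loop b e S N (initialTableau a B c d) = some r ∧ EpsFeasible a b e r.basis ∧
      (∀ k ∈ S, r.basis k = B k) ∧ (∀ k, k ∉ S → 0 < coords a r.basis d k) ∧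
      r.pivotCosts.length ≤ (exitsFrom a b e S₀ c d s).card ∧
      ∀ k, k ∉ S → (1 - s) * (ρ * ‖d - c‖) < coords a B (c + s • (d - c)) k * ‖a (B k)‖ →
        r.basis k = B k := by
  classical
  induction N generalizing B s with
  | zero => exact absurd hN (Nat.not_lt_zero _)
  | succ N ih =>
    have hinj := injective_of_linInd hB.1
    have hSB : S₀ ⊆ Finset.univ.image B := by
      rw [← hS]; exact Finset.image_subset_image (Finset.subset_univ S)
    have hmemS : ∀ k, B k ∉ S₀ ↔ k ∉ S := fun k => by
      rw [← hS, hinj.mem_finset_image]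
    obtain ⟨hend, hpair⟩ := hgen B hB hSB
    have hp : ∀ (B : Fin n → Fin m) t k, coords a B (c + t • (d - c)) k =
        coords a B c k + t * (coords a B d k - coords a B c k) := fun B t k => by
      rw [coords_add, coords_smul, coords_sub]
    simp only [hp] at hpair hstart ⊢
    rw [loop]
    rcases iteration_spec he hpos hbdd hB S c d with
      ⟨h1, h2⟩ | ⟨i, j, h1, hiS, hneg, hB', hdec, hlam1, hmin⟩
    · rw [h1]
      refine ⟨_, rfl, hB, fun k _ => rfl, fun k hk => ?_, Nat.zero_le _, fun k _ _ => rfl⟩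
      change 0 < coords a B d k
      have h3 := hstart k hk
      by_cases hdk : coords a B d k < coords a B c k
      · have h4 := h2 k hk hdk
        rw [le_div_iff₀ (sub_pos.2 hdk)] at h4
        exact lt_of_le_of_ne (by linarith) (Ne.symm (hend k ((hmemS k).2 hk)))
      · nlinarith
    · rw [h1]
      set lam := coords a B c i / (coords a B c i - coords a B d i) with hlam
      have hgap : 0 < coords a B c i - coords a B d i := sub_pos.2 hdec
      have hzero : coords a B c i + lam * (coords a B d i - coords a B c i) = 0 := by
        have : lam * (coords a B c i - coords a B d i) = coords a B c i :=
          div_mul_cancel₀ _ hgap.ne'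
        linarith
      have hslam : s < lam := by
        have := hstart i hiS
        by_contra! h
        nlinarith
      have hlam0 : 0 < lam := lt_of_le_of_lt hs0 hslam
      -- at the time `lam` only the coordinate at the position `i` vanishes
      have hposlam : ∀ k, k ∉ S → k ≠ i →
          0 < coords a B c k + lam * (coords a B d k - coords a B c k) := fun k hk hki => by
        refine lt_of_le_of_ne ?_ (Ne.symm (hpair lam hlam0 hlam1.le i k (Ne.symm hki)
          ((hmemS i).2 hiS) ((hmemS k).2 hk) hzero))
        by_cases hdk : coords a B d k < coords a B c k
        · have h4 := hmin k hk hdk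
          rw [le_div_iff₀ (sub_pos.2 hdk)] at h4
          linarith
        · have := hstart k hk
          nlinarith
      set B' := Function.update B i j with hB'def
      have hBk : ∀ k, k ≠ i → B' k = B k := fun k hk => Function.update_of_ne hk _ _
      have hcoords' := fun v k => congrFun (coords_update hB.1 hneg.ne v) k
      have hlam' : ∀ k, k ≠ i →
          coords a B' c k + lam * (coords a B' d k - coords a B' c k) =
          coords a B c k + lam * (coords a B d k - coords a B c k) := fun k hk => by
        rw [← hp, ← hp, hcoords', if_neg hk, hp B lam i, hzero]
        simp
      have hev : ∀ᶠ t in 𝓝[>] lam, ∀ k, k ∉ S →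
          0 < coords a B' c k + t * (coords a B' d k - coords a B' c k) := by
        rw [eventually_all]; intro k
        rw [eventually_imp_distrib_left]; intro hk
        by_cases hki : k = i
        · filter_upwards [self_mem_nhdsWithin] with t ht
          have ht : lam < t := ht
          rw [← hp, hcoords', if_pos hki, hp]
          refine div_pos_of_neg_of_neg ?_ hneg
          nlinarith
        · have hc : Continuous fun t =>
              coords a B' c k + t * (coords a B' d k - coords a B' c k) := by fun_prop
          refine eventually_nhdsWithin_of_eventually_nhds
            (continuousAt_const.eventually_lt hc.continuousAt ?_)
          rw [hlam' k hki]
          exact hposlam k hk hki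
      obtain ⟨t, hstart', ht1, hlt⟩ := (hev.and ((eventually_nhdsWithin_of_eventually_nhds
        (eventually_lt_nhds hlam1)).and self_mem_nhdsWithin)).exists
      have hlt : lam < t := hlt
      have hS' : S.image B' = S₀ := by
        rw [← hS]
        exact Finset.image_congr fun k hk => hBk k (by rintro rfl; exact hiS hk)
      have hcard : (exitsFrom a b e S₀ c d t).card < (exitsFrom a b e S₀ c d s).card := by
        apply Finset.card_lt_card
        rw [Finset.ssubset_iff_of_subset]
        · refine ⟨Finset.univ.image B, ?_, ?_⟩
          · rw [exitsFrom, Finset.mem_filter]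
            refine ⟨image_mem_faceBases hB hSB, ⟨s, le_rfl, hs1.le, ?_⟩, ?_⟩
            · rw [mem_cone_iff hB.1]
              intro k hk
              rw [hp]
              exact hstart k ((hmemS k).1 hk)
            · rw [mem_cone_iff hB.1]
              intro h
              have := h i ((hmemS i).2 hiS)
              nlinarith
          · rw [exitsFrom, Finset.mem_filter]
            rintro ⟨-, ⟨u, hu, -, hmem⟩, -⟩
            rw [mem_cone_iff hB.1] at hmem
            have := hmem i ((hmemS i).2 hiS)
            rw [hp] at this
            nlinarith
        · intro R hR
          rw [exitsFrom, Finset.mem_filter] at hR ⊢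
          obtain ⟨hR1, ⟨u, hu1, hu2, hu3⟩, hR3⟩ := hR
          exact ⟨hR1, ⟨u, by linarith, hu2, hu3⟩, hR3⟩
      have hstart'' : ∀ k, k ∉ S → 0 < coords a B' (c + t • (d - c)) k := fun k hk => by
        rw [hp]; exact hstart' k hk
      obtain ⟨r, hr1, hr2, hr3, hr4, hr5, hr6⟩ := ih (by linarith) ht1 hS' hB' hstart''
        (by omega)
      refine ⟨⟨r.basis, (iteration b e S (initialTableau a B c d)).ops :: r.pivotCosts⟩,
        by simp only [hr1]; rfl, hr2, fun k hk => ?_, hr4, ?_, fun k hk hbig => ?_⟩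
      · rw [← hBk k (by rintro rfl; exact hiS hk)]
        exact hr3 k hk
      · simp only [List.length_cons]
        omega
      · have hrate : ∀ (B : Fin n → Fin m), EpsFeasible a b e B →
            |coords a B d k - coords a B c k| * ‖a (B k)‖ ≤ ρ * ‖d - c‖ := fun B hB => by
          rw [← coords_sub]; exact hρ B hB _ _
        have hr := hrate B hB
        have hr' := hrate B' hB'
        have habs := neg_abs_le (coords a B d k - coords a B c k)
        have habs' := neg_abs_le (coords a B' d k - coords a B' c k)
        have hn0 := norm_nonneg (a (B k))
        have hL : 0 ≤ ρ * ‖d - c‖ := le_trans (by positivity) hr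
        have hq : -(ρ * ‖d - c‖) ≤ (coords a B d k - coords a B c k) * ‖a (B k)‖ := by
          nlinarith
        have hblam : (1 - lam) * (ρ * ‖d - c‖) <
            (coords a B c k + lam * (coords a B d k - coords a B c k)) * ‖a (B k)‖ := by
          nlinarith
        have hki : k ≠ i := by
          rintro rfl
          rw [hzero, zero_mul] at hblam
          exact absurd hblam (not_lt.2 (mul_nonneg (by linarith) hL))
        rw [← hBk k hki]
        refine hr6 k hk ?_
        rw [hp]
        rw [← hlam' k hki, ← hBk k hki] at hblam
        have hn0' := norm_nonneg (a (B' k))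
        have hq' : -(ρ * ‖d - c‖) ≤ (coords a B' d k - coords a B' c k) * ‖a (B' k)‖ := by
          nlinarith
        nlinarith

/-- The shadow simplex method follows a generic segment that starts in the cone of the given basis
to its end. -/
lemma shadowSimplex_spec (he : Function.Injective e) (hpos : ∀ i, 0 < e i)
    (hbdd : Bornology.IsBounded (polyhedron a b)) {ρ : ℝ}
    (hρ : ∀ B : Fin n → Fin m, EpsFeasible a b e B → ∀ z k,
      |coords a B z k| * ‖a (B k)‖ ≤ ρ * ‖z‖)
    {S : Finset (Fin n)} {c d : Euc n} (hgen : GenericSegment a b e (S.image B) c d)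
    (hB : EpsFeasible a b e B) (hstart : ∀ k, k ∉ S → 0 < coords a B c k) :
    ∃ r, shadowSimplex a b e S B c d = some r ∧ EpsFeasible a b e r.basis ∧
      (∀ k ∈ S, r.basis k = B k) ∧ (∀ k, k ∉ S → 0 < coords a r.basis d k) ∧
      r.pivotCosts.length ≤ (exits a b e (S.image B) c d).card ∧
      ∀ k, k ∉ S → ρ * ‖d - c‖ < coords a B c k * ‖a (B k)‖ → r.basis k = B k := by
  obtain ⟨r, h1, h2, h3, h4, h5, h6⟩ := loop_spec he hpos hbdd hρ hgen _ le_rfl zero_lt_one rfl hB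
    (by simpa using hstart) (Nat.lt_succ_self _)
  refine ⟨r, shadowSimplex_eq_some_iff.2 ⟨_, h1⟩, h2, h3, h4, h5, fun k hk hb => h6 k hk ?_⟩
  simpa using hb

end

section

variable {m n : ℕ}

/-! ### Measurability of the output -/

section Fibers

variable {Ω α β : Type*} [MeasurableSpace Ω]

/-- All fibers are measurable; for a countable codomain, this is measurability with respect to the
discrete σ-algebra. -/
def MeasurableFibers (f : Ω → α) : Prop := ∀ y, MeasurableSet {ω | f ω = y}

lemma MeasurableFibers.const (y : α) : MeasurableFibers fun _ : Ω => y := fun _ =>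
  MeasurableSet.const _

lemma MeasurableFibers.bind [Countable β] {h : Ω → β} (hh : MeasurableFibers h)
    {F : β → Ω → α} (hF : ∀ v : β, MeasurableFibers (F v)) :
    MeasurableFibers fun ω => F (h ω) ω := by
  intro y
  have : {ω | F (h ω) ω = y} = ⋃ v, {ω | h ω = v} ∩ {ω | F v ω = y} := by
    ext ω; simp
  rw [this]
  exact MeasurableSet.iUnion fun v => (hh v).inter (hF v y)

/-- It suffices to check measurability on each fiber of `h`. -/
lemma MeasurableFibers.of_fibers [Countable β] {h : Ω → β} (hh : MeasurableFibers h) {f : Ω → α}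
    (hf : ∀ v, ∃ g, MeasurableFibers g ∧ ∀ ω, h ω = v → f ω = g ω) : MeasurableFibers f := by
  choose g hg1 hg2 using hf
  have := hh.bind hg1
  rwa [show f = fun ω => g (h ω) ω from funext fun ω => hg2 _ ω rfl]

lemma MeasurableFibers.comp [Countable β] {h : Ω → β} (hh : MeasurableFibers h) (g : β → α) :
    MeasurableFibers fun ω => g (h ω) :=
  hh.bind (F := fun v _ => g v) fun _ => .const _

lemma MeasurableFibers.ite {p : Ω → Prop} [∀ ω, Decidable (p ω)] (hp : MeasurableSet {ω | p ω})
    {f g : Ω → α} (hf : MeasurableFibers f) (hg : MeasurableFibers g) :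
    MeasurableFibers fun ω => if p ω then f ω else g ω := by
  intro y
  have : {ω | (if p ω then f ω else g ω) = y} =
      ({ω | p ω} ∩ {ω | f ω = y}) ∪ ({ω | p ω}ᶜ ∩ {ω | g ω = y}) := by
    ext ω
    by_cases h : p ω <;> simp [h]
  rw [this]
  exact (hp.inter (hf y)).union (hp.compl.inter (hg y))

lemma MeasurableFibers.option_bind [Countable β] {h : Ω → Option β} (hh : MeasurableFibers h)
    {F : β → Ω → Option α} (hF : ∀ v, MeasurableFibers (F v)) :
    MeasurableFibers fun ω => (h ω).bind fun v => F v ω :=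
  hh.bind (F := fun u ω => u.bind fun v => F v ω) fun u => by
    cases u with
    | none => exact .const _
    | some v => exact hF v

lemma MeasurableFibers.pi {ι : Type*} [Countable ι] {h : Ω → ι → β}
    (hh : ∀ i, MeasurableFibers fun ω => h ω i) : MeasurableFibers h := by
  intro y
  have : {ω | h ω = y} = ⋂ i, {ω | h ω i = y i} := by
    ext ω; simp [funext_iff]
  rw [this]
  exact MeasurableSet.iInter fun i => hh i (y i)

end Fibers

instance : Countable (Output m n) :=
  Function.Injective.countable (f := fun r : Output m n => (r.basis, r.pivotCosts)) fun r s h => by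
    cases r; cases s; simpa using h

variable {Ω : Type*} [MeasurableSpace Ω] {a : Fin m → Euc n} {b : Fin m → ℝ} {e : Fin m → ℕ}

/-- With the basis and the matrix fixed, `leaving` depends on `c` and `d` through countably many
outcomes only: the chosen position and the cost; the returned time is a function of these and of
`c`, `d`. -/
lemma leaving_measurable (S : Finset (Fin n)) (B : Fin n → Fin m) (T : Fin m → Fin n → ℝ)
    {c d : Ω → Fin n → ℝ} (hc : Measurable c) (hd : Measurable d) :
    ∃ h : Ω → Option (Fin n) × ℕ, MeasurableFibers h ∧
      ∀ ω, leaving S (⟨B, T, c ω, d ω⟩ : Tableau m n) =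
        ⟨(h ω).1.map fun i => (i, c ω i / (c ω i - d ω i)), (h ω).2⟩ := by
  have hc' := fun i => (measurable_pi_apply (X := fun _ : Fin n => ℝ) i).comp hc
  have hd' := fun i => (measurable_pi_apply (X := fun _ : Fin n => ℝ) i).comp hd
  simp only [Function.comp_def] at hc' hd'
  unfold leaving
  suffices key : ∀ (l : List (Fin n)) (p : Option (Fin n)),
      ∃ h : Ω → Option (Fin n) × ℕ, MeasurableFibers h ∧ ∀ ω,
      (l.foldlM (fun best i =>
        if i ∈ S then pure best
        else do
          let decr ← rLt ((⟨B, T, c ω, d ω⟩ : Tableau m n).d i) ((⟨B, T, c ω, d ω⟩ : Tableau m n).c i)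
          if decr then do
            let s ← rSub ((⟨B, T, c ω, d ω⟩ : Tableau m n).c i) ((⟨B, T, c ω, d ω⟩ : Tableau m n).d i)
            let r ← rDiv ((⟨B, T, c ω, d ω⟩ : Tableau m n).c i) s
            match best with
            | none => pure (some (i, r))
            | some (i₀, r₀) => do
              let better ← rLt r r₀
              pure (if better then some (i, r) else some (i₀, r₀))
          else pure best) (p.map fun i => (i, c ω i / (c ω i - d ω i))) :
          Counted (Option (Fin n × ℝ))) =
        ⟨(h ω).1.map fun i => (i, c ω i / (c ω i - d ω i)), (h ω).2⟩ from
    key (List.finRange n) none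
  intro l
  induction l with
  | nil => intro p; exact ⟨fun _ => (p, 0), .const _, fun ω => rfl⟩
  | cons x l ih =>
    intro p
    choose g hg1 hg2 using ih
    classical
    let q : Ω → Option (Fin n) × ℕ := fun ω =>
      if x ∈ S then (p, 0) else if d ω x < c ω x then
        (match p with
        | none => (some x, 3)
        | some i => if c ω x / (c ω x - d ω x) < c ω i / (c ω i - d ω i) then (some x, 4)
          else (some i, 4))
      else (p, 1)
    have hq : MeasurableFibers q := by
      refine .ite (MeasurableSet.const _) (.const _) (.ite (measurableSet_lt (hd' x) (hc' x)) ?_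
        (.const _))
      cases p with
      | none => exact .const _
      | some i =>
        exact .ite (measurableSet_lt ((hc' x).div ((hc' x).sub (hd' x)))
          ((hc' i).div ((hc' i).sub (hd' i)))) (.const _) (.const _)
    refine ⟨fun ω => ((g (q ω).1 ω).1, (q ω).2 + (g (q ω).1 ω).2),
      hq.bind (F := fun v ω => ((g v.1 ω).1, v.2 + (g v.1 ω).2)) fun v =>
        (hg1 v.1).comp fun u => (u.1, v.2 + u.2), fun ω => ?_⟩
    rw [List.foldlM_cons]
    have hstep : ∀ (f : Option (Fin n × ℝ) → Counted (Option (Fin n × ℝ)))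
        (y : Counted (Option (Fin n × ℝ))),
        y = ⟨(q ω).1.map fun i => (i, c ω i / (c ω i - d ω i)), (q ω).2⟩ →
        f ((q ω).1.map fun i => (i, c ω i / (c ω i - d ω i))) =
          ⟨((g (q ω).1 ω).1).map fun i => (i, c ω i / (c ω i - d ω i)), (g (q ω).1 ω).2⟩ →
        (y >>= f) = ⟨((g (q ω).1 ω).1).map fun i => (i, c ω i / (c ω i - d ω i)),
          (q ω).2 + (g (q ω).1 ω).2⟩ := by
      rintro f y rfl h
      change (⟨(f _).val, _ + (f _).ops⟩ : Counted (Option (Fin n × ℝ))) = _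
      rw [h]
    refine hstep _ _ ?_ (hg2 (q ω).1 ω)
    have hext : ∀ (y : Counted (Option (Fin n × ℝ))) v k, y.val = v → y.ops = k → y = ⟨v, k⟩ := by
      rintro ⟨_, _⟩ _ _ rfl rfl; rfl
    refine hext _ _ _ ?_ ?_
    · simp only [val_ite, val_bind, val_rLt, val_pure, val_rSub, val_rDiv, q]
      cases p with
      | none => split_ifs <;> rfl
      | some i =>
        simp only [Option.map_some, val_bind, val_pure, val_rLt]
        split_ifs <;> rfl
    · simp only [ops_ite, ops_bind, ops_rLt, ops_pure, ops_rSub, ops_rDiv, val_rSub, val_rDiv,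
        val_rLt, q]
      cases p with
      | none => split_ifs <;> rfl
      | some i =>
        simp only [Option.map_some, ops_bind, ops_pure, ops_rLt]
        split_ifs <;> rfl

lemma ops_eliminate (i : Fin n) (q p : Fin n → ℝ) :
    (eliminate i q p).ops = 1 + ∑ k, if k = i then 0 else 2 := by
  simp [eliminate, forEach]

/-- On each fiber of the outcome of `leaving`, the entering row does not depend on `c` and `d`, and the
exchange step maps `c` and `d` measurably, so that induction applies to the new tableau. -/
lemma loop_measurable (S : Finset (Fin n)) (N : ℕ) (B : Fin n → Fin m) (T : Fin m → Fin n → ℝ)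
    {c d : Ω → Fin n → ℝ} (hc : Measurable c) (hd : Measurable d) :
    MeasurableFibers fun ω => loop b e S N (⟨B, T, c ω, d ω⟩ : Tableau m n) := by
  induction N generalizing B T c d with
  | zero => exact .const _
  | succ N ih =>
    have hc' := fun i => (measurable_pi_apply (X := fun _ : Fin n => ℝ) i).comp hc
    have hd' := fun i => (measurable_pi_apply (X := fun _ : Fin n => ℝ) i).comp hd
    simp only [Function.comp_def] at hc' hd'
    obtain ⟨h, hh, hl⟩ := leaving_measurable S B T hc hd
    refine hh.of_fibers ?_
    rintro ⟨_ | i, κ⟩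
    · refine ⟨_, .const (some ⟨B, []⟩), fun ω hω => ?_⟩
      simp only [loop, iteration, val_bind, hl, hω, Option.map_none, val_pure]
    have hlt : MeasurableSet {ω | c ω i / (c ω i - d ω i) < 1} :=
      measurableSet_lt ((hc' i).div ((hc' i).sub (hd' i))) measurable_const
    have hent : ∀ ω, entering b e (⟨B, T, c ω, d ω⟩ : Tableau m n) i =
        entering b e (⟨B, T, 0, 0⟩ : Tableau m n) i := fun ω => rfl
    classical
    rcases hj : (entering b e (⟨B, T, 0, 0⟩ : Tableau m n) i).val with _ | ⟨j, p⟩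
    · refine ⟨fun ω => if c ω i / (c ω i - d ω i) < 1 then none else some ⟨B, []⟩,
        .ite hlt (.const _) (.const _), fun ω hω => ?_⟩
      simp only [loop, iteration, val_bind, hl, hω, Option.map_some, val_ite, val_rLt, hent, hj,
        val_pure]
      split_ifs <;> rfl
    · let elim : (Fin n → ℝ) → Fin n → ℝ := fun v k =>
        if k = i then v i / T j i else v k - v i / T j i * T j k
      have helim : Measurable elim := by
        refine measurable_pi_lambda _ fun k => ?_
        by_cases hk : k = i
        · simp only [elim, hk, if_true]; fun_prop
        · simp only [elim, hk, if_false]; fun_prop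
      have hex : ∀ ω, (exchange (⟨B, T, c ω, d ω⟩ : Tableau m n) i j).val =
          ⟨Function.update B i j, fun l => elim (T l), elim (c ω), elim (d ω)⟩ := fun ω => by
        simp only [exchange, val_bind, val_pure, val_forEach, val_eliminate, elim]
      have hops : ∀ ω, (exchange (⟨B, T, c ω, d ω⟩ : Tableau m n) i j).ops =
          (exchange (⟨B, T, 0, 0⟩ : Tableau m n) i j).ops := fun ω => by
        simp only [exchange, ops_bind, ops_pure, forEach, ops_eliminate]
      let κ' : ℕ := κ + (1 + ((entering b e (⟨B, T, 0, 0⟩ : Tableau m n) i).ops +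
        (exchange (⟨B, T, 0, 0⟩ : Tableau m n) i j).ops))
      refine ⟨fun ω => if c ω i / (c ω i - d ω i) < 1 then
          (loop b e S N (⟨Function.update B i j, fun l => elim (T l), elim (c ω), elim (d ω)⟩ :
            Tableau m n)).map fun r => ⟨r.basis, κ' :: r.pivotCosts⟩
          else some ⟨B, []⟩,
        .ite hlt ((ih _ _ (helim.comp hc) (helim.comp hd)).comp _) (.const _), fun ω hω => ?_⟩
      simp only [loop, iteration, val_bind, ops_bind, hl, hω, Option.map_some, val_ite, ops_ite,
        val_rLt, ops_rLt, hent, hj, val_pure, ops_pure]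
      split_ifs
      · simp only [hex, hops, add_zero, κ']
      · rfl

lemma shadowSimplex_measurable (S : Finset (Fin n)) (B : Fin n → Fin m) {c d : Ω → Euc n}
    (hc : Measurable c) (hd : Measurable d) :
    MeasurableFibers fun ω => shadowSimplex a b e S B (c ω) (d ω) := by
  have hcoords : Measurable fun v : Euc n => coords a B v :=
    measurable_pi_lambda _ fun k => (continuous_coords a B k).measurable
  have hloop : ∀ N, MeasurableFibers fun ω => loop b e S N (initialTableau a B (c ω) (d ω)) :=
    fun N => loop_measurable S N B _ (hcoords.comp hc) (hcoords.comp hd)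
  have hsome : ∀ r, MeasurableSet {ω | shadowSimplex a b e S B (c ω) (d ω) = some r} := by
    intro r
    simp only [shadowSimplex_eq_some_iff, Set.ofPred_exists]
    exact MeasurableSet.iUnion fun N => hloop N (some r)
  intro y
  cases y with
  | some r => exact hsome r
  | none =>
    have : {ω | shadowSimplex a b e S B (c ω) (d ω) = none} =
        (⋃ r, {ω | shadowSimplex a b e S B (c ω) (d ω) = some r})ᶜ := by
      ext ω
      simp [Option.eq_none_iff_forall_ne_some]
    rw [this]
    exact (MeasurableSet.iUnion hsome).compl

lemma measurable_embedding (k : ℕ) (W : Submodule ℝ (Euc n)) : Measurable (embedding k W) := by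
  have h : Continuous (embedding k W) := LinearMap.continuous_of_finiteDimensional (embedding k W)
  exact h.measurable

/-- The stage of the optimization algorithm as a measurable function of the sample `x`; `F` stands for
the continuation on the smaller face. -/
lemma stage_measurable (S : Finset (Fin n)) (B : Fin n → Fin m) (c d : Euc n) (η θ : ℝ)
    (w : Fin m → ℝ) {x : Ω → Euc n} (hx : Measurable x)
    {F : Fin n → Output m n → Output m n → Output m n → Ω → Option (Output m n)}
    (hF : ∀ i r₁ r₂ r₃, MeasurableFibers (F i r₁ r₂ r₃)) :
    MeasurableFibers fun ω =>
      (shadowSimplex a b e S B c (c + x ω)).bind fun r₁ =>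
      (shadowSimplex a b e S r₁.basis (c + x ω) (d + x ω)).bind fun r₂ =>
      (shadowSimplex a b e S r₂.basis (d + x ω) (d + η • x ω)).bind fun r₃ =>
      ((List.finRange n).find? fun i => decide (i ∉ S ∧
        θ < coords a r₃.basis (d + η • x ω) i * w (r₃.basis i))).bind fun i =>
      F i r₁ r₂ r₃ ω := by
  have h1 : ∀ v : Euc n, Measurable fun ω => v + x ω := fun v => measurable_const.add hx
  have h2 : Measurable fun ω => d + η • x ω := measurable_const.add (hx.const_smul η)
  refine (shadowSimplex_measurable S B measurable_const (h1 c)).option_bind fun r₁ => ?_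
  refine (shadowSimplex_measurable S r₁.basis (h1 c) (h1 d)).option_bind fun r₂ => ?_
  refine (shadowSimplex_measurable S r₂.basis (h1 d) h2).option_bind fun r₃ => ?_
  have hfind : MeasurableFibers fun ω => (List.finRange n).find? fun i => decide (i ∉ S ∧
      θ < coords a r₃.basis (d + η • x ω) i * w (r₃.basis i)) := by
    refine MeasurableFibers.comp (β := Fin n → Bool) (MeasurableFibers.pi fun i => ?_)
      fun p => (List.finRange n).find? p
    have hmeas : MeasurableSet {ω | i ∉ S ∧
        θ < coords a r₃.basis (d + η • x ω) i * w (r₃.basis i)} :=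
      (MeasurableSet.const _).inter (measurableSet_lt measurable_const
        (((continuous_coords a r₃.basis i).measurable.comp h2).mul measurable_const))
    rintro (_ | _)
    · simp only [decide_eq_false_iff_not]
      exact hmeas.compl
    · simp only [decide_eq_true_eq]
      exact hmeas
  exact hfind.option_bind fun i => hF i r₁ r₂ r₃

lemma optimizeFace_measurable (δ : ℝ) (d : Euc n) (k : ℕ) (S : Finset (Fin n))
    (B : Fin n → Fin m) :
    MeasurableFibers fun X : (k : ℕ) → Euc k => optimizeFace a b δ d e X k S B := by
  induction k generalizing S B with
  | zero => exact .const _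
  | succ k ih =>
    simp only [optimizeFace]
    refine .ite (MeasurableSet.const _) (.const _) ?_
    exact stage_measurable S B _ _ _ _
      (fun j => ‖(Submodule.span ℝ ((fun l => a (B l)) '' (S : Set (Fin n))))ᗮ.starProjection (a j)‖)
      ((measurable_embedding (k + 1) _).comp (measurable_pi_apply (k + 1)))
      fun i r₁ r₂ r₃ => (ih (insert i S) r₃.basis).comp _

lemma numPivots_measurable (δ : ℝ) (d : Euc n) (k : ℕ) (S : Finset (Fin n)) (B : Fin n → Fin m) :
    Measurable fun X : (k : ℕ) → Euc k => numPivots (optimizeFace a b δ d e X k S B) :=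
  measurable_to_countable' fun y => (optimizeFace_measurable δ d k S B).comp numPivots y

end

section

/-! ### The exponential distribution -/

lemma integrable_exp_neg_norm (k : ℕ) : Integrable fun x : Euc k => Real.exp (-‖x‖) := by
  have h := (integrable_one_add_norm (E := Euc k) (μ := volume) (r := (k + 1 : ℝ))
    (by simp)).const_mul ((k + 1).factorial * Real.exp 1)
  refine h.mono' (by fun_prop) (Eventually.of_forall fun x => ?_)
  have hx : 0 < 1 + ‖x‖ := by positivity
  have h1 := Real.pow_div_factorial_le_exp (1 + ‖x‖) hx.le (k + 1)
  rw [div_le_iff₀ (by positivity)] at h1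
  rw [Real.norm_of_nonneg (Real.exp_pos _).le, Real.rpow_neg hx.le,
    show ((k : ℝ) + 1) = ((k + 1 : ℕ) : ℝ) by push_cast; ring, Real.rpow_natCast,
    ← div_eq_mul_inv, le_div_iff₀ (by positivity), Real.exp_neg, ← div_eq_inv_mul,
    div_le_iff₀ (Real.exp_pos _)]
  calc _ ≤ _ := h1
    _ = _ := by rw [Real.exp_add]; ring

lemma expMeasure_apply {k : ℕ} {s : Set (Euc k)} (hs : MeasurableSet s) :
    expMeasure k s = ENNReal.ofReal (∫ x in s, Real.exp (-‖x‖)) := by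
  rw [expMeasure, withDensity_apply _ hs, ofReal_integral_eq_lintegral_ofReal
    (integrable_exp_neg_norm k).integrableOn (Eventually.of_forall fun x => (Real.exp_pos _).le)]

instance (k : ℕ) : IsFiniteMeasure (expMeasure k) :=
  ⟨by rw [expMeasure_apply MeasurableSet.univ]; exact ENNReal.ofReal_lt_top⟩

/-- Exponential moments bound the mass outside of the ball of radius `2 k` by `(2 / e) ^ k`. -/
lemma expMeasure_univ_le {k : ℕ} (hk : 1 ≤ k) :
    expMeasure k Set.univ ≤ 4 * expMeasure k (Metric.closedBall 0 (2 * (k : ℝ))) := by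
  set s := Metric.closedBall (0 : Euc k) (2 * (k : ℝ)) with hs
  have hsm : MeasurableSet s := Metric.isClosed_closedBall.measurableSet
  have hint := integrable_exp_neg_norm k
  set Z := ∫ x : Euc k, Real.exp (-‖x‖) with hZ
  have hZ0 : 0 ≤ Z := integral_nonneg fun x => (Real.exp_pos _).le
  have hhalf : ∫ x : Euc k, Real.exp (-‖(1 / 2 : ℝ) • x‖) = 2 ^ k * Z := by
    rw [Measure.integral_comp_smul volume (fun x : Euc k => Real.exp (-‖x‖)) (1 / 2)]
    simp [hZ]
  have hint2 : Integrable fun x : Euc k => Real.exp (-‖(1 / 2 : ℝ) • x‖) :=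
    hint.comp_smul (by norm_num)
  have htail : ∫ x in sᶜ, Real.exp (-‖x‖) ≤ Real.exp (-1) ^ k * (2 ^ k * Z) := by
    rw [← hhalf, ← integral_const_mul]
    refine (setIntegral_mono_on hint.integrableOn (hint2.const_mul _).integrableOn hsm.compl
      fun x hx => ?_).trans (setIntegral_le_integral (hint2.const_mul _)
        (Eventually.of_forall fun x => by positivity))
    rw [← Real.exp_nat_mul, ← Real.exp_add, Real.exp_le_exp, norm_smul]
    simp only [hs, Set.mem_compl_iff, Metric.mem_closedBall, dist_zero_right, not_le] at hx
    norm_num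
    linarith
  have hsplit := integral_add_compl hsm hint
  rw [← hZ] at hsplit
  have h34 : Real.exp (-1) ^ k * (2 ^ k * Z) ≤ 3 / 4 * Z := by
    rw [← mul_assoc, ← mul_pow]
    have h1 : Real.exp (-1) * 2 ≤ 3 / 4 := by
      rw [Real.exp_neg, ← div_eq_inv_mul, div_le_iff₀ (Real.exp_pos 1)]
      linarith [Real.exp_one_gt_d9]
    have h2 : (Real.exp (-1) * 2) ^ k ≤ 3 / 4 :=
      (pow_le_of_le_one (by positivity) (by linarith) (by omega)).trans h1
    exact mul_le_mul_of_nonneg_right h2 hZ0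
  rw [expMeasure_apply MeasurableSet.univ, expMeasure_apply hsm,
    show (4 : ℝ≥0∞) = ENNReal.ofReal 4 by simp, ← ENNReal.ofReal_mul (by norm_num),
    Measure.restrict_univ]
  apply ENNReal.ofReal_le_ofReal
  linarith

/-- A translation by `v` changes the exponential measure by at most the factor `e ^ ‖v‖`. -/
lemma expMeasure_translate_le {k : ℕ} {s : Set (Euc k)} (hs : MeasurableSet s) (v : Euc k) :
    expMeasure k ((fun x => x + v) ⁻¹' s) ≤
      ENNReal.ofReal (Real.exp ‖v‖) * expMeasure k s := by
  have hpre : MeasurableSet ((fun x => x + v) ⁻¹' s) := (measurable_add_const v) hs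
  have hm : Measurable fun x : Euc k => ENNReal.ofReal (Real.exp (-‖x‖)) := by fun_prop
  rw [expMeasure, withDensity_apply _ hpre, withDensity_apply _ hs,
    ← lintegral_const_mul _ hm, ← lintegral_indicator hpre, ← lintegral_indicator hs,
    ← lintegral_add_right_eq_self (s.indicator fun a : Euc k =>
      ENNReal.ofReal (Real.exp ‖v‖) * ENNReal.ofReal (Real.exp (-‖a‖))) v]
  refine lintegral_mono fun x => ?_
  by_cases hx : x + v ∈ s
  · rw [Set.indicator_of_mem (show x ∈ (fun x => x + v) ⁻¹' s from hx), Set.indicator_of_mem hx,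
      ← ENNReal.ofReal_mul (Real.exp_pos _).le, ← Real.exp_add]
    apply ENNReal.ofReal_le_ofReal
    rw [Real.exp_le_exp]
    linarith [norm_add_le x v]
  · rw [Set.indicator_of_notMem (show x ∉ (fun x => x + v) ⁻¹' s from hx),
      Set.indicator_of_notMem hx]

/-! ### Segments leaving cones -/

/-- An open convex cone with a point `center` such that the ball around it of radius `δ` is contained
in the cone. -/
structure WideCone (E : Type*) [NormedAddCommGroup E] [NormedSpace ℝ E] (δ : ℝ) where
  carrier : Set E
  center : E
  isOpen : IsOpen carrier
  add_mem : ∀ {x y}, x ∈ carrier → y ∈ carrier → x + y ∈ carrier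
  smul_mem : ∀ {x} {t : ℝ}, 0 < t → x ∈ carrier → t • x ∈ carrier
  center_add_mem : ∀ {w}, ‖w‖ < δ → center + w ∈ carrier

section Exit

variable {k : ℕ} {δ : ℝ}

/-- A short step leaves a wide cone with small probability: if `p ∈ K` and `q ∉ K` for nearby points
`p` and `q`, then a translation by a small multiple of the center of `K` moves `q` into `K`. -/
lemma expMeasure_step_le (hδ : 0 < δ) (K : WideCone (Euc k) δ) {κ : ℝ} (hκ : ‖K.center‖ ≤ κ)
    {z z' : Euc k} {σ σ' σm h r : ℝ} (hσm : 0 < σm) (hσ' : σm ≤ σ') (hr : 0 < r)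
    (hrh : h < r * δ) (s : Set (Euc k))
    (hs : ∀ x ∈ s, ‖(z + σ • x) - (z' + σ' • x)‖ ≤ h) :
    expMeasure k (s ∩ {x | z + σ • x ∈ K.carrier ∧ z' + σ' • x ∉ K.carrier}) ≤
      ENNReal.ofReal (Real.exp (r * κ / σm) - 1) *
        expMeasure k {x | z' + σ' • x ∈ K.carrier} := by
  have hσ0 : 0 < σ' := hσm.trans_le hσ'
  set A := {x : Euc k | z' + σ' • x ∈ K.carrier} with hA
  set v := (r / σ') • K.center with hv
  have hAm : MeasurableSet A :=
    (K.isOpen.preimage (by fun_prop : Continuous fun x : Euc k => z' + σ' • x)).measurableSet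
  have hpre : MeasurableSet ((fun x => x + v) ⁻¹' A) := (measurable_add_const v) hAm
  have hshift : ∀ x, z' + σ' • (x + v) = (z' + σ' • x) + r • K.center := fun x => by
    rw [hv, smul_add, smul_smul, mul_div_cancel₀ _ hσ0.ne', add_assoc]
  have hcenter : K.center ∈ K.carrier := by
    have := K.center_add_mem (w := 0) (by simpa using hδ)
    simpa using this
  have hsub1 : A ⊆ (fun x => x + v) ⁻¹' A := fun x hx => by
    change z' + σ' • (x + v) ∈ K.carrier
    rw [hshift]
    exact K.add_mem hx (K.smul_mem hr hcenter)
  have hsub2 : s ∩ {x | z + σ • x ∈ K.carrier ∧ z' + σ' • x ∉ K.carrier} ⊆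
      ((fun x => x + v) ⁻¹' A) \ A := by
    rintro x ⟨hxs, hx1, hx2⟩
    refine ⟨?_, hx2⟩
    change z' + σ' • (x + v) ∈ K.carrier
    have hw : z' + σ' • (x + v) = (z + σ • x) +
        r • (K.center + (-r⁻¹) • ((z + σ • x) - (z' + σ' • x))) := by
      rw [hshift, smul_add, smul_smul, mul_neg, mul_inv_cancel₀ hr.ne']
      module
    rw [hw]
    refine K.add_mem hx1 (K.smul_mem hr (K.center_add_mem ?_))
    rw [norm_smul, norm_neg, norm_inv, Real.norm_of_nonneg hr.le, ← div_eq_inv_mul,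
      div_lt_iff₀ hr, mul_comm]
    exact (hs x hxs).trans_lt hrh
  refine (measure_mono hsub2).trans ?_
  rw [measure_sdiff hsub1 hAm.nullMeasurableSet (measure_ne_top _ _)]
  have hvn : ‖v‖ ≤ r * κ / σm := by
    rw [hv, norm_smul, Real.norm_of_nonneg (by positivity), div_mul_eq_mul_div]
    have : 0 ≤ κ := (norm_nonneg _).trans hκ
    gcongr
  have h1 := expMeasure_translate_le hAm v
  have h2 : ENNReal.ofReal (Real.exp ‖v‖) ≤ ENNReal.ofReal (Real.exp (r * κ / σm)) :=
    ENNReal.ofReal_le_ofReal (Real.exp_le_exp.2 hvn)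
  rw [tsub_le_iff_right]
  refine h1.trans ((mul_le_mul_left h2 _).trans ?_)
  rw [ENNReal.ofReal_sub _ zero_le_one, ENNReal.ofReal_one]
  have h3 : (1 : ℝ≥0∞) ≤ ENNReal.ofReal (Real.exp (r * κ / σm)) := by
    rw [← ENNReal.ofReal_one]
    refine ENNReal.ofReal_le_ofReal (Real.one_le_exp ?_)
    exact le_trans (norm_nonneg _) hvn
  conv_rhs => rw [← one_mul (expMeasure k A), ← mul_assoc, mul_one, ← add_mul,
    tsub_add_cancel_of_le h3]

open Classical in
/-- The number of cones of a family that the segment `[p, q]` leaves. -/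
noncomputable def exitCount {E ι : Type*} [NormedAddCommGroup E] [NormedSpace ℝ E]
    (F : Finset ι) (K : ι → Set E) (p q : E) : ℕ :=
  (F.filter fun r => (∃ t : ℝ, 0 ≤ t ∧ t ≤ 1 ∧ p + t • (q - p) ∈ K r) ∧ q ∉ K r).card

/-- An exit from an open set is noticed on every sufficiently fine uniform partition. -/
lemma eventually_exists_step {E : Type*} [NormedAddCommGroup E] [NormedSpace ℝ E] {K : Set E}
    (hK : IsOpen K) {p q : E} {t : ℝ} (ht0 : 0 ≤ t) (ht1 : t ≤ 1) (ht : p + t • (q - p) ∈ K)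
    (hq : q ∉ K) : ∀ᶠ N : ℕ in atTop, ∃ j < N, p + ((j : ℝ) / N) • (q - p) ∈ K ∧
      p + (((j + 1 : ℕ) : ℝ) / N) • (q - p) ∉ K := by
  have hc : Continuous fun t : ℝ => p + t • (q - p) := by fun_prop
  obtain ⟨ε, hε, hball⟩ := Metric.isOpen_iff.1 (hK.preimage hc) t ht
  obtain ⟨N₀, hN₀⟩ := exists_nat_gt (1 / ε)
  filter_upwards [eventually_ge_atTop (N₀ + 1)] with N hN
  have hN0 : (0 : ℝ) < N := by exact_mod_cast (by omega : 0 < N)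
  have hNε : 1 / (N : ℝ) < ε := by
    have : (N₀ : ℝ) ≤ N := by exact_mod_cast (by omega : N₀ ≤ N)
    rw [div_lt_comm₀ hN0 hε]
    linarith
  have hstart : p + (((⌈t * N⌉₊ : ℕ) : ℝ) / N) • (q - p) ∈ K := by
    apply hball
    rw [Metric.mem_ball, Real.dist_eq]
    have h1 := Nat.le_ceil (t * N)
    have h2 := Nat.ceil_lt_add_one (by positivity : 0 ≤ t * N)
    have h3 : t ≤ (⌈t * N⌉₊ : ℝ) / N := by rwa [le_div_iff₀ hN0]
    rw [abs_of_nonneg (by linarith)]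
    refine lt_of_le_of_lt ?_ hNε
    rw [sub_le_iff_le_add, div_le_iff₀ hN0, add_mul, one_div, inv_mul_cancel₀ hN0.ne']
    linarith
  have hle : ⌈t * N⌉₊ ≤ N := by
    apply Nat.ceil_le.2
    nlinarith
  by_contra! hcon
  have hall : ∀ j, ⌈t * N⌉₊ ≤ j → j ≤ N → p + ((j : ℝ) / N) • (q - p) ∈ K := by
    intro j hj
    induction j, hj using Nat.le_induction with
    | base => intro _; exact hstart
    | succ j hj ih => intro h; exact hcon j (by omega) (ih (by omega))
  have := hall N hle le_rfl
  rw [div_self hN0.ne', one_smul, add_sub_cancel] at this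
  exact hq this

/-- The expected number of wide cones that a random segment leaves, in terms of the distance `L`
that it covers and of the smallest scale `σm` of the randomness. -/
lemma lintegral_exitCount_le (hδ : 0 < δ) {ι : Type*} (F : Finset ι)
    (K : ι → WideCone (Euc k) δ) {κ : ℝ} (hκ0 : 0 ≤ κ) (hκ : ∀ r ∈ F, ‖(K r).center‖ ≤ κ)
    (hdisj : ∀ r ∈ F, ∀ r' ∈ F, ∀ z, z ∈ (K r).carrier → z ∈ (K r').carrier → r = r')
    {z₀ z₁ : Euc k} {σ₀ σ₁ σm L : ℝ} (hL : 0 < L) (hσm : 0 < σm) (hσ₀ : σm ≤ σ₀) (hσ₁ : σm ≤ σ₁)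
    {s : Set (Euc k)} (hs : ∀ x ∈ s, ‖(z₁ + σ₁ • x) - (z₀ + σ₀ • x)‖ ≤ L) :
    ∫⁻ x in s, (exitCount F (fun r => (K r).carrier) (z₀ + σ₀ • x) (z₁ + σ₁ • x) : ℝ≥0∞)
        ∂expMeasure k ≤
      ENNReal.ofReal (4 * (L * κ / (δ * σm))) * expMeasure k Set.univ := by
  classical
  set z : ℝ → Euc k := fun t => z₀ + t • (z₁ - z₀) with hz
  set σ : ℝ → ℝ := fun t => σ₀ + t * (σ₁ - σ₀) with hσ
  have hpath : ∀ t x, (z₀ + σ₀ • x) + t • ((z₁ + σ₁ • x) - (z₀ + σ₀ • x)) = z t + σ t • x :=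
    fun t x => by simp only [hz, hσ]; module
  let D : ℕ → ι → ℕ → Set (Euc k) := fun N r j =>
    {x | z ((j : ℝ) / N) + σ ((j : ℝ) / N) • x ∈ (K r).carrier ∧
      z (((j + 1 : ℕ) : ℝ) / N) + σ (((j + 1 : ℕ) : ℝ) / N) • x ∉ (K r).carrier}
  have hKm : ∀ r t, MeasurableSet {x : Euc k | z t + σ t • x ∈ (K r).carrier} := fun r t =>
    ((K r).isOpen.preimage (by fun_prop : Continuous fun x : Euc k => z t + σ t • x)).measurableSet
  have hDm : ∀ N r j, MeasurableSet (D N r j) := fun N r j => (hKm r _).inter (hKm r _).compl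
  let g : ℕ → Euc k → ℝ≥0∞ := fun N x =>
    ∑ r ∈ F, ∑ j ∈ Finset.range N, (D N r j).indicator (fun _ => 1) x
  have hgm : ∀ N, Measurable (g N) := fun N =>
    Finset.measurable_fun_sum _ fun r _ => Finset.measurable_fun_sum _ fun j _ =>
      measurable_const.indicator (hDm N r j)
  -- each exit is noticed by all sufficiently fine partitions; the limit is handled by Fatou's lemma
  have hcount : ∀ x, (exitCount F (fun r => (K r).carrier) (z₀ + σ₀ • x) (z₁ + σ₁ • x) : ℝ≥0∞) ≤
      liminf (fun N => g N x) atTop := by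
    intro x
    apply le_liminf_of_le (by isBoundedDefault)
    have hev : ∀ r ∈ F, ∀ᶠ N : ℕ in atTop,
        (((∃ t : ℝ, 0 ≤ t ∧ t ≤ 1 ∧ (z₀ + σ₀ • x) + t • ((z₁ + σ₁ • x) - (z₀ + σ₀ • x)) ∈
          (K r).carrier) ∧ z₁ + σ₁ • x ∉ (K r).carrier) →
        ∃ j < N, x ∈ D N r j) := by
      intro r _
      rw [eventually_imp_distrib_left]
      rintro ⟨⟨t, ht0, ht1, ht⟩, hq⟩
      filter_upwards [eventually_exists_step (K r).isOpen ht0 ht1 ht hq] with N hN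
      obtain ⟨j, hj, h1, h2⟩ := hN
      rw [hpath] at h1 h2
      exact ⟨j, hj, h1, h2⟩
    filter_upwards [(Finset.eventually_all F).2 hev] with N hN
    rw [exitCount, Finset.card_filter, Nat.cast_sum]
    refine Finset.sum_le_sum fun r hr => ?_
    split_ifs with h
    · obtain ⟨j, hj, hx⟩ := hN r hr h
      rw [Nat.cast_one]
      calc (1 : ℝ≥0∞) = (D N r j).indicator (fun _ => 1) x := by rw [Set.indicator_of_mem hx]
        _ ≤ _ := Finset.single_le_sum (f := fun j => (D N r j).indicator (fun _ => (1:ℝ≥0∞)) x)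
          (fun _ _ => zero_le) (Finset.mem_range.2 hj)
    · simp
  -- a step of length `L / N` needs a shift by more than `L / (N δ)` centers; `2 L / (N δ)` will do
  set θ := 2 * (L * κ / (δ * σm)) with hθ
  have hθ0 : 0 ≤ θ := by positivity
  have hbound : ∀ᶠ N : ℕ in atTop, ∫⁻ x in s, g N x ∂expMeasure k ≤
      ENNReal.ofReal (4 * (L * κ / (δ * σm))) * expMeasure k Set.univ := by
    obtain ⟨N₀, hN₀⟩ := exists_nat_ge θ
    filter_upwards [eventually_ge_atTop (N₀ + 1)] with N hN
    have hN0 : (0 : ℝ) < N := by exact_mod_cast (by omega : 0 < N)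
    have hθN : θ / N ≤ 1 := by
      rw [div_le_one hN0]
      exact hN₀.trans (by exact_mod_cast (by omega : N₀ ≤ N))
    have hstep : ∀ r ∈ F, ∀ j ∈ Finset.range N, expMeasure k (s ∩ D N r j) ≤
        ENNReal.ofReal (2 * (θ / N)) * expMeasure k {x | z (((j + 1 : ℕ) : ℝ) / N) +
          σ (((j + 1 : ℕ) : ℝ) / N) • x ∈ (K r).carrier} := by
      intro r hr j hj
      have hj1 : ((j + 1 : ℕ) : ℝ) / N ≤ 1 := by
        rw [div_le_one hN0]; exact_mod_cast Finset.mem_range.1 hj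
      have hj0 : 0 ≤ ((j + 1 : ℕ) : ℝ) / N := by positivity
      have hσj : σm ≤ σ (((j + 1 : ℕ) : ℝ) / N) := by
        simp only [hσ]; nlinarith
      have hdiff : ∀ x, (z ((j : ℝ) / N) + σ ((j : ℝ) / N) • x) -
          (z (((j + 1 : ℕ) : ℝ) / N) + σ (((j + 1 : ℕ) : ℝ) / N) • x) =
          (-(1 / (N : ℝ))) • ((z₁ + σ₁ • x) - (z₀ + σ₀ • x)) := fun x => by
        rw [← hpath, ← hpath]
        push_cast
        rw [add_div]
        module
      refine (expMeasure_step_le hδ (K r) (hκ r hr) (h := L / N) (r := 2 * L / (N * δ)) hσm hσj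
        (by positivity) ?_ s fun x hx => ?_).trans ?_
      · rw [div_mul_eq_mul_div, mul_div_mul_right _ _ hδ.ne']
        gcongr
        linarith
      · rw [hdiff, norm_smul, norm_neg, Real.norm_of_nonneg (by positivity), one_div,
          ← div_eq_inv_mul]
        gcongr
        exact hs x hx
      · gcongr
        have heq : 2 * L / (N * δ) * κ / σm = θ / N := by
          rw [hθ]; field_simp
        rw [heq]
        have := Real.abs_exp_sub_one_le (x := θ / N) (by rwa [abs_of_nonneg (by positivity)])
        rw [abs_of_nonneg (by positivity : 0 ≤ θ / N)] at this
        exact (le_abs_self _).trans this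
    have hg : ∫⁻ x in s, g N x ∂expMeasure k =
        ∑ r ∈ F, ∑ j ∈ Finset.range N, expMeasure k (s ∩ D N r j) := by
      simp only [g]
      rw [lintegral_finsetSum _ fun r _ => Finset.measurable_fun_sum _ fun j _ =>
        measurable_const.indicator (hDm N r j)]
      refine Finset.sum_congr rfl fun r _ => ?_
      rw [lintegral_finsetSum _ fun j _ => measurable_const.indicator (hDm N r j)]
      refine Finset.sum_congr rfl fun j _ => ?_
      rw [lintegral_indicator_const (hDm N r j), one_mul, Measure.restrict_apply (hDm N r j),
        Set.inter_comm]
    rw [hg, Finset.sum_comm]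
    calc ∑ j ∈ Finset.range N, ∑ r ∈ F, expMeasure k (s ∩ D N r j)
        ≤ ∑ j ∈ Finset.range N, ENNReal.ofReal (2 * (θ / N)) * expMeasure k Set.univ := by
          refine Finset.sum_le_sum fun j hj => ?_
          refine (Finset.sum_le_sum fun r hr => hstep r hr j hj).trans ?_
          rw [← Finset.mul_sum]
          gcongr
          -- the cones are disjoint, so that at each time their probabilities add up to at most one
          rw [← measure_biUnion_finset]
          · exact measure_mono (Set.subset_univ _)
          · intro r hr r' hr' hne
            exact Set.disjoint_left.2 fun x hx hx' => hne (hdisj r hr r' hr' _ hx hx')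
          · exact fun r _ => hKm r _
      _ = ENNReal.ofReal (4 * (L * κ / (δ * σm))) * expMeasure k Set.univ := by
          rw [Finset.sum_const, Finset.card_range, nsmul_eq_mul, ← mul_assoc,
            ← ENNReal.ofReal_natCast, ← ENNReal.ofReal_mul hN0.le]
          congr 2
          rw [hθ]; field_simp; ring
  calc _ ≤ ∫⁻ x in s, liminf (fun N => g N x) atTop ∂expMeasure k := lintegral_mono hcount
    _ ≤ liminf (fun N => ∫⁻ x in s, g N x ∂expMeasure k) atTop := lintegral_liminf_le hgm
    _ ≤ _ := liminf_le_of_frequently_le' hbound.frequently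

/-- Conditioning on the ball costs a factor of at most `4`. -/
lemma lintegral_truncExp_le (hk : 1 ≤ k) {f : Euc k → ℝ≥0∞} {M : ℝ}
    (hf : ∫⁻ x in Metric.closedBall 0 (2 * (k : ℝ)), f x ∂expMeasure k ≤
      ENNReal.ofReal M * expMeasure k Set.univ) :
    ∫⁻ x, f x ∂truncExp k ≤ ENNReal.ofReal (4 * M) := by
  rw [truncExp, ProbabilityTheory.cond, lintegral_smul_measure, smul_eq_mul]
  set β := expMeasure k (Metric.closedBall 0 (2 * (k : ℝ))) with hβ
  have hβ0 : β ≠ 0 := by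
    intro h0
    have h1 : IsProbabilityMeasure (truncExp k) := inferInstance
    have h2 := h1.measure_univ
    rw [truncExp, ProbabilityTheory.cond, Measure.smul_apply, Measure.restrict_apply_univ,
      ← hβ, h0] at h2
    simp at h2
  calc β⁻¹ * _ ≤ β⁻¹ * (ENNReal.ofReal M * (4 * β)) := by
        gcongr
        exact hf.trans (by gcongr; exact expMeasure_univ_le hk)
    _ = (β⁻¹ * β) * (4 * ENNReal.ofReal M) := by ring
    _ = ENNReal.ofReal (4 * M) := by
        rw [ENNReal.inv_mul_cancel hβ0 (measure_ne_top _ _), one_mul,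
          ENNReal.ofReal_mul (by norm_num)]
        simp

end Exit

end

section

variable {m n : ℕ} {a : Fin m → Euc n} {b : Fin m → ℝ} {e : Fin m → ℕ} {B : Fin n → Fin m}
  {S₀ : Finset (Fin m)} {δ : ℝ}

/-! ### Faces and the `δ`-distance property -/

/-- In a basis with the `δ`-distance property, the normalized coordinates of `z` are at most
`‖z‖ / δ`. -/
lemma abs_coords_mul_norm_le (hpos : ∀ i, 0 < e i) (hδ : 0 < δ) (hloc : LocalDeltaDistance a b δ)
    (hB : EpsFeasible a b e B) (z : Euc n) (k : Fin n) :
    |coords a B z k| * ‖a (B k)‖ ≤ δ⁻¹ * ‖z‖ := by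
  rw [← div_eq_inv_mul, le_div_iff₀ hδ]
  by_cases hk : coords a B z k = 0
  · rw [hk]; simp
  have hdist := hloc _ (hB.isFeasibleBasis hpos) ⟨B k, Finset.mem_image_of_mem _ (Finset.mem_univ k)⟩
  simp only at hdist
  set y := ∑ l ∈ Finset.univ.erase k, coords a B z l • a (B l) with hy
  have hz : coords a B z k • a (B k) + y = z := by
    rw [hy, Finset.add_sum_erase _ (fun l => coords a B z l • a (B l)) (Finset.mem_univ k)]
    exact sum_coords hB.1 z
  have hmem : (-(coords a B z k)⁻¹) • y ∈ (Submodule.span ℝ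
      ((fun i : (Finset.univ.image B : Finset (Fin m)) => a i) ''
        {j | j ≠ ⟨B k, Finset.mem_image_of_mem _ (Finset.mem_univ k)⟩}) : Set (Euc n)) := by
    refine Submodule.smul_mem _ _ (Submodule.sum_mem _ fun l hl => Submodule.smul_mem _ _
      (Submodule.subset_span ?_))
    refine ⟨⟨B l, Finset.mem_image_of_mem _ (Finset.mem_univ l)⟩, ?_, rfl⟩
    intro h
    exact Finset.ne_of_mem_erase hl (injective_of_linInd hB.1 (congrArg Subtype.val h))
  have h1 := hdist.trans (Metric.infDist_le_dist_of_mem hmem)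
  have h2 : a (B k) - (-(coords a B z k)⁻¹) • y = (coords a B z k)⁻¹ • z := by
    have h3 : (coords a B z k)⁻¹ • z =
        (coords a B z k)⁻¹ • (coords a B z k • a (B k) + y) := by rw [hz]
    rw [h3, smul_add, smul_smul, inv_mul_cancel₀ hk]
    module
  rw [dist_eq_norm, h2, norm_smul, norm_inv, Real.norm_eq_abs, ← div_eq_inv_mul,
    le_div_iff₀ (abs_pos.2 hk)] at h1
  linarith

/-- The distance of a row from the span of other rows is at most its norm. -/
lemma delta_le_one (hδ : 0 < δ) (hloc : LocalDeltaDistance a b δ) (hpos : ∀ i, 0 < e i)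
    (hB : EpsFeasible a b e B) (hn : 1 ≤ n) : δ ≤ 1 := by
  have h := abs_coords_mul_norm_le hpos hδ hloc hB (a (B ⟨0, hn⟩)) ⟨0, hn⟩
  rw [coords_row hB.1, Pi.single_eq_same, abs_one, one_mul, ← div_eq_inv_mul, le_div_iff₀ hδ] at h
  have h0 : 0 < ‖a (B ⟨0, hn⟩)‖ := norm_pos_iff.2 (hB.1.ne_zero _)
  nlinarith

/-- The direction space of the face on which the rows in `S₀` are tight. -/
noncomputable def faceDir (a : Fin m → Euc n) (S₀ : Finset (Fin m)) : Submodule ℝ (Euc n) :=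
  (Submodule.span ℝ (a '' (S₀ : Set (Fin m))))ᗮ

lemma coords_eq_zero_of_mem_span (hB : LinearIndependent ℝ fun k => a (B k))
    (hS : S₀ ⊆ Finset.univ.image B) {k : Fin n} (hk : B k ∉ S₀) {z : Euc n}
    (hz : z ∈ Submodule.span ℝ (a '' (S₀ : Set (Fin m)))) : coords a B z k = 0 := by
  have hle : Submodule.span ℝ (a '' (S₀ : Set (Fin m))) ≤
      LinearMap.ker ((LinearMap.proj k).comp (coordsL a B)) := by
    rw [Submodule.span_le]
    rintro _ ⟨i, hi, rfl⟩
    obtain ⟨l, -, rfl⟩ := Finset.mem_image.1 (hS hi)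
    change coords a B (a (B l)) k = 0
    rw [coords_row hB, Pi.single_apply, if_neg]
    rintro rfl
    exact hk hi
  exact hle hz

/-- Projecting along the fixed rows does not change the other coordinates. -/
lemma coords_starProjection (hB : LinearIndependent ℝ fun k => a (B k))
    (hS : S₀ ⊆ Finset.univ.image B) {k : Fin n} (hk : B k ∉ S₀) (z : Euc n) :
    coords a B ((faceDir a S₀).starProjection z) k = coords a B z k := by
  have hmem : z - (faceDir a S₀).starProjection z ∈ Submodule.span ℝ (a '' (S₀ : Set (Fin m))) := by
    have := (faceDir a S₀).sub_starProjection_mem_orthogonal z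
    rwa [faceDir, Submodule.orthogonal_orthogonal] at this
  have := coords_eq_zero_of_mem_span hB hS hk hmem
  rw [coords_sub] at this
  linarith

/-- The sum of the normalized projected rows, the center of the normal cone. -/
noncomputable def coneCenter (a : Fin m → Euc n) (S₀ R : Finset (Fin m)) : Euc n :=
  ∑ i ∈ R \ S₀, ‖(faceDir a S₀).starProjection (a i)‖⁻¹ • (faceDir a S₀).starProjection (a i)

lemma coneCenter_mem (a : Fin m → Euc n) (S₀ R : Finset (Fin m)) :
    coneCenter a S₀ R ∈ faceDir a S₀ :=
  Submodule.sum_mem _ fun _ _ => Submodule.smul_mem _ _ (Submodule.starProjection_apply_mem _ _)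

lemma starProjection_row_ne_zero (hB : LinearIndependent ℝ fun k => a (B k))
    (hS : S₀ ⊆ Finset.univ.image B) {k : Fin n} (hk : B k ∉ S₀) :
    (faceDir a S₀).starProjection (a (B k)) ≠ 0 := by
  intro h
  have := coords_starProjection hB hS hk (a (B k))
  rw [h, coords_row hB, Pi.single_eq_same] at this
  simp [coords_eq_coordsL] at this

lemma norm_coneCenter_le (a : Fin m → Euc n) (S₀ R : Finset (Fin m)) :
    ‖coneCenter a S₀ R‖ ≤ (R \ S₀).card := by
  refine (norm_sum_le _ _).trans ?_
  rw [← nsmul_one, ← Finset.sum_const]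
  refine Finset.sum_le_sum fun i _ => ?_
  rw [norm_smul, norm_inv, norm_norm]
  exact inv_mul_le_one

lemma coords_coneCenter (hB : LinearIndependent ℝ fun k => a (B k))
    (hS : S₀ ⊆ Finset.univ.image B) {k : Fin n} (hk : B k ∉ S₀) :
    coords a B (coneCenter a S₀ (Finset.univ.image B)) k =
      ‖(faceDir a S₀).starProjection (a (B k))‖⁻¹ := by
  rw [coneCenter, coords_sum, Finset.sum_eq_single (B k)]
  · rw [coords_smul, coords_starProjection hB hS hk, coords_row hB, Pi.single_eq_same, mul_one]
  · intro i hi hik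
    obtain ⟨l, -, rfl⟩ := Finset.mem_image.1 (Finset.mem_sdiff.1 hi).1
    rw [coords_smul, coords_starProjection hB hS hk, coords_row hB, Pi.single_apply, if_neg,
      mul_zero]
    rintro rfl
    exact hik rfl
  · intro h
    exact absurd (Finset.mem_sdiff.2 ⟨Finset.mem_image_of_mem _ (Finset.mem_univ k), hk⟩) h

/-- The ball of radius `δ` around the center is contained in the normal cone. -/
lemma coneCenter_add_mem (hpos : ∀ i, 0 < e i) (hδ : 0 < δ) (hloc : LocalDeltaDistance a b δ)
    {R : Finset (Fin m)} (hR : R ∈ faceBases a b e S₀) {w : Euc n} (hw : ‖w‖ < δ) :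
    coneCenter a S₀ R + w ∈ cone a S₀ R := by
  classical
  rw [faceBases, Finset.mem_filter] at hR
  obtain ⟨-, hS, B, hB, rfl⟩ := hR
  rw [mem_cone_iff hB.1]
  intro k hk
  rw [coords_add, coords_coneCenter hB.1 hS hk]
  set p := (faceDir a S₀).starProjection (a (B k)) with hp
  have hp0 : 0 < ‖p‖ := norm_pos_iff.2 (starProjection_row_ne_zero hB.1 hS hk)
  have hpa : ‖p‖ ≤ ‖a (B k)‖ := Submodule.norm_starProjection_apply_le _ _
  have h1 := abs_coords_mul_norm_le hpos hδ hloc hB w k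
  have h2 : δ⁻¹ * ‖w‖ < 1 := by rwa [← div_eq_inv_mul, div_lt_one hδ]
  have h3 : |coords a B w k| * ‖p‖ < 1 :=
    lt_of_le_of_lt (mul_le_mul_of_nonneg_left hpa (abs_nonneg _)) (h1.trans_lt h2)
  have h4 : |coords a B w k| < ‖p‖⁻¹ := by
    rwa [← one_div, lt_div_iff₀ hp0]
  linarith [neg_abs_le (coords a B w k)]

lemma cone_add_mem {R : Finset (Fin m)} {x y : Euc n} (hx : x ∈ cone a S₀ R)
    (hy : y ∈ cone a S₀ R) : x + y ∈ cone a S₀ R := by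
  obtain ⟨μ, h1, rfl⟩ := hx
  obtain ⟨ν, h2, rfl⟩ := hy
  refine ⟨μ + ν, fun i hi hiS => add_pos (h1 i hi hiS) (h2 i hi hiS), ?_⟩
  simp only [Pi.add_apply, add_smul, Finset.sum_add_distrib]

lemma cone_smul_mem {R : Finset (Fin m)} {x : Euc n} {t : ℝ} (ht : 0 < t)
    (hx : x ∈ cone a S₀ R) : t • x ∈ cone a S₀ R := by
  obtain ⟨μ, h1, rfl⟩ := hx
  refine ⟨t • μ, fun i hi hiS => mul_pos ht (h1 i hi hiS), ?_⟩
  simp only [Pi.smul_apply, smul_eq_mul, Finset.smul_sum, mul_smul]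

lemma isOpen_cone {R : Finset (Fin m)} (hR : R ∈ faceBases a b e S₀) :
    IsOpen (cone a S₀ R) := by
  classical
  rw [faceBases, Finset.mem_filter] at hR
  obtain ⟨-, hS, B, hB, rfl⟩ := hR
  have : cone a S₀ (Finset.univ.image B) =
      ⋂ k : Fin n, {z | B k ∉ S₀ → 0 < coords a B z k} := by
    ext z
    rw [mem_cone_iff hB.1]
    simp
  rw [this]
  refine isOpen_iInter_of_finite fun k => ?_
  by_cases hk : B k ∈ S₀
  · simp [hk]
  · simpa [hk] using isOpen_lt continuous_const (continuous_coords a B k)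

/-- An isometric parametrization of the direction space of a face by `ℝᵏ`. -/
structure IsFaceParam (a : Fin m → Euc n) (S₀ : Finset (Fin m)) {k : ℕ}
    (L : Euc k →ₗ[ℝ] Euc n) : Prop where
  norm_map : ∀ x, ‖L x‖ = ‖x‖
  range_eq : LinearMap.range L = faceDir a S₀

lemma card_image_positions (hB : LinearIndependent ℝ fun k => a (B k)) {S : Finset (Fin n)} :
    (S.image B).card = S.card :=
  Finset.card_image_of_injective _ (injective_of_linInd hB)

lemma finrank_faceDir (hB : LinearIndependent ℝ fun k => a (B k)) {S : Finset (Fin n)} {k : ℕ}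
    (hk : S.card + k = n) : Module.finrank ℝ (faceDir a (S.image B)) = k := by
  have h1 := Submodule.finrank_add_finrank_orthogonal
    (Submodule.span ℝ (a '' ((S.image B : Finset (Fin m)) : Set (Fin m))))
  have h2 : Module.finrank ℝ
      (Submodule.span ℝ (a '' ((S.image B : Finset (Fin m)) : Set (Fin m)))) = S.card := by
    have h3 : a '' ((S.image B : Finset (Fin m)) : Set (Fin m)) =
        Set.range fun k : S => a (B k) := by
      ext z; simp
    rw [h3, finrank_span_eq_card]
    · simp
    · exact hB.comp (fun k : S => (k : Fin n)) Subtype.val_injective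
  rw [h2, finrank_euclideanSpace, Fintype.card_fin] at h1
  unfold faceDir
  omega

lemma isFaceParam_embedding (hB : LinearIndependent ℝ fun k => a (B k)) {S : Finset (Fin n)}
    {k : ℕ} (hk : S.card + k = n) :
    IsFaceParam a (S.image B) (embedding k (faceDir a (S.image B))) := by
  have hex : ∃ L : Euc k →ₗ[ℝ] Euc n, (∀ x, ‖L x‖ = ‖x‖) ∧
      LinearMap.range L = faceDir a (S.image B) := by
    have hfin := finrank_faceDir hB hk
    subst hfin
    refine ⟨(faceDir a (S.image B)).subtype ∘ₗ
      (stdOrthonormalBasis ℝ (faceDir a (S.image B))).repr.symm.toLinearEquiv.toLinearMap,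
      fun x => ?_, ?_⟩
    · exact (LinearIsometryEquiv.norm_map
        (stdOrthonormalBasis ℝ (faceDir a (S.image B))).repr.symm x)
    · rw [LinearMap.range_comp]
      simp
  have := Classical.epsilon_spec hex
  exact ⟨this.1, this.2⟩

lemma faceDir_image (a : Fin m → Euc n) (B : Fin n → Fin m) (S : Finset (Fin n)) :
    (Submodule.span ℝ ((fun l => a (B l)) '' (S : Set (Fin n))))ᗮ = faceDir a (S.image B) := by
  rw [faceDir, Finset.coe_image, Set.image_image]

lemma coneCenter_image (hB : LinearIndependent ℝ fun k => a (B k)) (S : Finset (Fin n)) :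
    ∑ i ∈ Sᶜ, ‖(faceDir a (S.image B)).starProjection (a (B i))‖⁻¹ •
      (faceDir a (S.image B)).starProjection (a (B i)) =
    coneCenter a (S.image B) (Finset.univ.image B) := by
  have hinj := injective_of_linInd hB
  rw [coneCenter, ← Finset.image_sdiff _ _ hinj, Finset.sum_image fun x _ y _ h => hinj h,
    Finset.compl_eq_univ_sdiff]

/-! ### Generic samples -/

/-- Hyperplanes, possibly empty, are null sets. -/
lemma volume_hyperplane {k : ℕ} {f : Euc k →ₗ[ℝ] ℝ} (hf : f ≠ 0) (c : ℝ) :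
    ∀ᵐ x : Euc k, f x ≠ c := by
  rw [ae_iff]
  simp only [ne_eq, not_not]
  rcases Set.eq_empty_or_nonempty {x | f x = c} with h | ⟨x₀, hx₀⟩
  · rw [h, measure_empty]
  · have : {x | f x = c} = (AffineSubspace.mk' x₀ (LinearMap.ker f) : Set (Euc k)) := by
      ext x
      have hx₀ : f x₀ = c := hx₀
      simp [AffineSubspace.mem_mk', sub_eq_zero, hx₀]
    rw [this]
    refine Measure.addHaar_affineSubspace _ _ fun h => hf ?_
    have h1 := AffineSubspace.direction_mk' x₀ (LinearMap.ker f)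
    rw [h, AffineSubspace.direction_top] at h1
    exact LinearMap.ker_eq_top.1 h1.symm

section Generic

variable {k : ℕ} {L : Euc k →ₗ[ℝ] Euc n}

lemma IsFaceParam.exists_row (hL : IsFaceParam a S₀ L)
    (hB : LinearIndependent ℝ fun k => a (B k)) (hS : S₀ ⊆ Finset.univ.image B) (i : Fin n) :
    ∃ x, ∀ j, B j ∉ S₀ → coords a B (L x) j = if j = i then 1 else 0 := by
  have : (faceDir a S₀).starProjection (a (B i)) ∈ LinearMap.range L := by
    rw [hL.range_eq]; exact Submodule.starProjection_apply_mem _ _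
  obtain ⟨x, hx⟩ := this
  refine ⟨x, fun j hj => ?_⟩
  rw [hx, coords_starProjection hB hS hj, coords_row hB, Pi.single_apply]

lemma ae_coords_ne_zero (hL : IsFaceParam a S₀ L) (u : Euc n) {σ : ℝ} (hσ : σ ≠ 0) :
    ∀ᵐ x : Euc k, ∀ B : Fin n → Fin m, EpsFeasible a b e B → S₀ ⊆ Finset.univ.image B →
      ∀ i, B i ∉ S₀ → coords a B (u + σ • L x) i ≠ 0 := by
  refine ae_all_iff.2 fun B => ?_
  rw [eventually_imp_distrib_left]; intro hB
  rw [eventually_imp_distrib_left]; intro hS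
  refine ae_all_iff.2 fun i => ?_
  rw [eventually_imp_distrib_left]; intro hi
  let f : Euc k →ₗ[ℝ] ℝ := ((LinearMap.proj i).comp (coordsL a B)).comp L
  have hf : f ≠ 0 := by
    obtain ⟨x, hx⟩ := hL.exists_row hB.1 hS i
    intro h
    have h1 : f x = 1 := (hx i hi).trans (if_pos rfl)
    rw [h] at h1
    simp at h1
  filter_upwards [volume_hyperplane hf (-(coords a B u i) / σ)] with x hx h
  apply hx
  change coords a B (L x) i = _
  rw [coords_add, coords_smul] at h
  field_simp
  linarith

/-- Two coordinates and a vector `u` are annihilated by a functional that does not vanish on the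
direction space: the codimension-two subspace and `u` do not span it. -/
lemma exists_functional (hL : IsFaceParam a S₀ L) (hB : LinearIndependent ℝ fun k => a (B k))
    (hS : S₀ ⊆ Finset.univ.image B) {i j : Fin n} (hij : i ≠ j) (hi : B i ∉ S₀) (hj : B j ∉ S₀)
    (u : Euc n) :
    ∃ f : Euc n →ₗ[ℝ] ℝ, f.comp L ≠ 0 ∧ f u = 0 ∧
      ∀ z, coords a B z i = 0 → coords a B z j = 0 → f z = 0 := by
  let c : Fin n → Euc n →ₗ[ℝ] ℝ := fun l => (LinearMap.proj l).comp (coordsL a B)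
  have hc : ∀ l z, c l z = coords a B z l := fun _ _ => rfl
  obtain ⟨x, hx⟩ := hL.exists_row hB hS i
  obtain ⟨y, hy⟩ := hL.exists_row hB hS j
  by_cases h : coords a B u i = 0
  · refine ⟨c i, fun h0 => ?_, h, fun z hz _ => hz⟩
    have h1 : (c i).comp L x = 1 := (hx i hi).trans (if_pos rfl)
    rw [h0] at h1
    simp at h1
  · refine ⟨coords a B u j • c i - coords a B u i • c j, fun h0 => ?_, ?_, fun z h1 h2 => ?_⟩
    · have h1 : (coords a B u j • c i - coords a B u i • c j).comp L y = - coords a B u i := by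
        simp only [LinearMap.comp_apply, LinearMap.sub_apply, LinearMap.smul_apply, hc, hy i hi,
          hy j hj, smul_eq_mul]
        simp [hij]
      rw [h0] at h1
      simp at h1
      exact h h1
    · simp only [LinearMap.sub_apply, LinearMap.smul_apply, hc, smul_eq_mul]; ring
    · simp only [LinearMap.sub_apply, LinearMap.smul_apply, hc, smul_eq_mul, h1, h2]; ring

/-- Almost no ray `u + σ x` meets the intersection of two facets of a cone. -/
lemma ae_ray_generic (hL : IsFaceParam a S₀ L) (u : Euc n) :
    ∀ᵐ x : Euc k, ∀ B : Fin n → Fin m, EpsFeasible a b e B → S₀ ⊆ Finset.univ.image B →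
      ∀ i j, i ≠ j → B i ∉ S₀ → B j ∉ S₀ → ∀ σ : ℝ, σ ≠ 0 →
        coords a B (u + σ • L x) i = 0 → coords a B (u + σ • L x) j ≠ 0 := by
  refine ae_all_iff.2 fun B => ?_
  rw [eventually_imp_distrib_left]; intro hB
  rw [eventually_imp_distrib_left]; intro hS
  refine ae_all_iff.2 fun i => ae_all_iff.2 fun j => ?_
  rw [eventually_imp_distrib_left]; intro hij
  rw [eventually_imp_distrib_left]; intro hi
  rw [eventually_imp_distrib_left]; intro hj
  obtain ⟨f, hf, hfu, hfz⟩ := exists_functional hL hB.1 hS hij hi hj u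
  filter_upwards [volume_hyperplane hf 0] with x hx σ hσ h1 h2
  have := hfz _ h1 h2
  rw [map_add, hfu, zero_add, map_smul, smul_eq_mul] at this
  exact hx ((mul_eq_zero.1 this).resolve_left hσ)

/-- Almost no translate of the line with direction `u` through `c` meets the intersection of two
facets of a cone. -/
lemma ae_line_generic (hL : IsFaceParam a S₀ L) (c u : Euc n) :
    ∀ᵐ x : Euc k, ∀ B : Fin n → Fin m, EpsFeasible a b e B → S₀ ⊆ Finset.univ.image B →
      ∀ i j, i ≠ j → B i ∉ S₀ → B j ∉ S₀ → ∀ t : ℝ,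
        coords a B (c + t • u + L x) i = 0 → coords a B (c + t • u + L x) j ≠ 0 := by
  refine ae_all_iff.2 fun B => ?_
  rw [eventually_imp_distrib_left]; intro hB
  rw [eventually_imp_distrib_left]; intro hS
  refine ae_all_iff.2 fun i => ae_all_iff.2 fun j => ?_
  rw [eventually_imp_distrib_left]; intro hij
  rw [eventually_imp_distrib_left]; intro hi
  rw [eventually_imp_distrib_left]; intro hj
  obtain ⟨f, hf, hfu, hfz⟩ := exists_functional hL hB.1 hS hij hi hj u
  filter_upwards [volume_hyperplane hf (-f c)] with x hx t h1 h2
  have := hfz _ h1 h2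
  rw [map_add, map_add, map_smul, hfu, smul_zero, add_zero] at this
  exact hx (by rw [LinearMap.comp_apply]; linarith)

end Generic

/-- The sample `x` (a vector in the direction space of the face) is generic for the three segments of
a stage, and for the continuation of the last segment towards `d`. -/
structure StageGeneric (a : Fin m → Euc n) (b : Fin m → ℝ) (e : Fin m → ℕ) (S₀ : Finset (Fin m))
    (c d : Euc n) (η : ℝ) (k : ℕ) (x : Euc n) : Prop where
  first : GenericSegment a b e S₀ c (c + x)
  second : GenericSegment a b e S₀ (c + x) (d + x)
  third : GenericSegment a b e S₀ (d + x) (d + η • x)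
  fourth : ∀ j : ℕ, GenericSegment a b e S₀ (d + η • x) (d + (η / (j + 1)) • x)
  norm_lt : ‖x‖ < 2 * k

lemma truncExp_absolutelyContinuous (k : ℕ) : truncExp k ≪ volume := by
  refine ProbabilityTheory.cond_absolutelyContinuous.trans ?_
  exact withDensity_absolutelyContinuous _ _

lemma ae_stageGeneric {k : ℕ} (hk : 1 ≤ k) {L : Euc k →ₗ[ℝ] Euc n} (hL : IsFaceParam a S₀ L)
    (c d : Euc n) {η : ℝ} (hη : 0 < η) :
    ∀ᵐ x ∂truncExp k, StageGeneric a b e S₀ c d η k (L x) := by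
  have hac := truncExp_absolutelyContinuous k
  have hball : ∀ᵐ x ∂truncExp k, ‖x‖ ≤ 2 * (k : ℝ) := by
    have := ProbabilityTheory.ae_cond_mem (μ := expMeasure k)
      (s := Metric.closedBall (0 : Euc k) (2 * (k : ℝ))) Metric.isClosed_closedBall.measurableSet
    filter_upwards [this] with x hx
    simpa using hx
  have hsphere : ∀ᵐ x : Euc k, ‖x‖ ≠ 2 * (k : ℝ) := by
    have hk0 : (2 * (k : ℝ)) ≠ 0 := by
      have : (1 : ℝ) ≤ k := by exact_mod_cast hk
      positivity
    have := Measure.addHaar_sphere_of_ne_zero (volume : Measure (Euc k)) 0 hk0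
    rw [ae_iff]
    convert this using 2
    ext x; simp
  filter_upwards [hball, hac.ae_le hsphere,
    hac.ae_le (ae_coords_ne_zero (b := b) (e := e) hL c one_ne_zero),
    hac.ae_le (ae_coords_ne_zero (b := b) (e := e) hL d one_ne_zero),
    hac.ae_le (ae_coords_ne_zero (b := b) (e := e) hL d hη.ne'),
    hac.ae_le (ae_all_iff.2 fun j : ℕ => ae_coords_ne_zero (b := b) (e := e) hL d
      (by positivity : η / ((j : ℝ) + 1) ≠ 0)),
    hac.ae_le (ae_ray_generic (b := b) (e := e) hL c),
    hac.ae_le (ae_ray_generic (b := b) (e := e) hL d),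
    hac.ae_le (ae_line_generic (b := b) (e := e) hL c (d - c))]
    with x h1 h2 h3 h4 h5 h6 h7 h8 h9
  refine ⟨fun B hB hS => ⟨?_, fun t ht0 ht1 i j hij hi hj => ?_⟩,
    fun B hB hS => ⟨?_, fun t ht0 ht1 i j hij hi hj => ?_⟩,
    fun B hB hS => ⟨?_, fun t ht0 ht1 i j hij hi hj => ?_⟩,
    fun l B hB hS => ⟨?_, fun t ht0 ht1 i j hij hi hj => ?_⟩, ?_⟩
  · simpa using h3 B hB hS
  · rw [add_sub_cancel_left]
    exact h7 B hB hS i j hij hi hj t ht0.ne'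
  · simpa using h4 B hB hS
  · rw [show c + L x + t • (d + L x - (c + L x)) = c + t • (d - c) + L x by module]
    exact h9 B hB hS i j hij hi hj t
  · exact h5 B hB hS
  · rw [show d + L x + t • (d + η • L x - (d + L x)) = d + (1 + t * (η - 1)) • L x by module]
    exact h8 B hB hS i j hij hi hj _ (by nlinarith)
  · exact h6 l B hB hS
  · rw [show d + η • L x + t • (d + (η / (l + 1)) • L x - (d + η • L x)) =
      d + (η + t * (η / (l + 1) - η)) • L x by module]
    refine h8 B hB hS i j hij hi hj _ ?_
    have : 0 < η / ((l : ℝ) + 1) := by positivity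
    nlinarith
  · rw [hL.norm_map]
    exact lt_of_le_of_ne h1 h2

end

section

variable {m n : ℕ} {a : Fin m → Euc n} {b : Fin m → ℝ} {e : Fin m → ℕ} {B : Fin n → Fin m}
  {S₀ : Finset (Fin m)} {δ : ℝ}

/-! ### Counting exits along a segment -/

section ExitCount

variable {E ι : Type*} [NormedAddCommGroup E] [NormedSpace ℝ E] {F : Finset ι} {K : ι → Set E}

lemma exitCount_eq_zero {p q : E}
    (h : ∀ r ∈ F, ∀ t : ℝ, 0 ≤ t → t ≤ 1 → p + t • (q - p) ∈ K r → q ∈ K r) :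
    exitCount F K p q = 0 := by
  classical
  rw [exitCount, Finset.card_eq_zero, Finset.filter_eq_empty_iff]
  rintro r hr ⟨⟨t, ht0, ht1, ht⟩, hn⟩
  exact hn (h r hr t ht0 ht1 ht)

@[simp] lemma exitCount_self (p : E) : exitCount F K p p = 0 :=
  exitCount_eq_zero fun r _ t _ _ h => by simpa using h

/-- If a segment is split in two, every exit happens on one of the parts. -/
lemma exitCount_le_add (p q : E) {s : ℝ} (hs0 : 0 ≤ s) (hs1 : s ≤ 1) :
    exitCount F K p q ≤ exitCount F K p (p + s • (q - p)) +
      exitCount F K (p + s • (q - p)) q := by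
  classical
  unfold exitCount
  refine le_trans (Finset.card_le_card ?_) (Finset.card_union_le _ _)
  intro r hr
  simp only [Finset.mem_filter, Finset.mem_union] at hr ⊢
  obtain ⟨hrF, ⟨t, ht0, ht1, ht⟩, hq⟩ := hr
  rcases le_or_gt t s with hts | hts
  · by_cases hm : p + s • (q - p) ∈ K r
    · exact Or.inr ⟨hrF, ⟨0, le_rfl, zero_le_one, by simpa using hm⟩, hq⟩
    · refine Or.inl ⟨hrF, ⟨t / s, div_nonneg ht0 hs0, div_le_one_of_le₀ hts hs0, ?_⟩, hm⟩
      rw [add_sub_cancel_left, smul_smul]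
      rcases eq_or_ne s 0 with rfl | hs
      · have : t = 0 := le_antisymm hts ht0
        subst this
        simpa using ht
      · rwa [div_mul_cancel₀ _ hs]
  · refine Or.inr ⟨hrF, ⟨(t - s) / (1 - s), div_nonneg (by linarith) (by linarith),
      div_le_one_of_le₀ (by linarith) (by linarith), ?_⟩, hq⟩
    have h1 : 1 - s ≠ 0 := by linarith
    have : p + s • (q - p) + ((t - s) / (1 - s)) • (q - (p + s • (q - p))) =
        p + t • (q - p) := by
      have h2 : q - (p + s • (q - p)) = (1 - s) • (q - p) := by module
      rw [h2, smul_smul, div_mul_cancel₀ _ h1]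
      module
    rwa [this]

/-- A longer segment leaves at least as many convex sets. -/
lemma exitCount_mono (hK : ∀ r ∈ F, Convex ℝ (K r)) (p q : E) {s : ℝ} (hs0 : 0 ≤ s) (hs1 : s ≤ 1) :
    exitCount F K p (p + s • (q - p)) ≤ exitCount F K p q := by
  classical
  unfold exitCount
  refine Finset.card_le_card fun r hr => ?_
  simp only [Finset.mem_filter] at hr ⊢
  obtain ⟨hrF, ⟨t, ht0, ht1, ht⟩, hm⟩ := hr
  rw [add_sub_cancel_left, smul_smul] at ht
  have hts : t * s ≤ s := by nlinarith
  refine ⟨hrF, ⟨t * s, by positivity, by nlinarith, ht⟩, fun hq => hm ?_⟩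
  have hconv := ((hK r hrF).affine_preimage (AffineMap.lineMap p q)).ordConnected
  have hline : ∀ u : ℝ, AffineMap.lineMap p q u = p + u • (q - p) := fun u => by
    rw [AffineMap.lineMap_apply, vsub_eq_sub, vadd_eq_add, add_comm]
  have h1 : t * s ∈ AffineMap.lineMap p q ⁻¹' K r := by rwa [Set.mem_preimage, hline]
  have h2 : (1 : ℝ) ∈ AffineMap.lineMap p q ⁻¹' K r := by simpa using hq
  have := hconv.out h1 h2 ⟨hts, hs1⟩
  rwa [Set.mem_preimage, hline] at this

lemma measurable_exitCount {X : Type*} [TopologicalSpace X] [MeasurableSpace X]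
    [OpensMeasurableSpace X] (hK : ∀ r ∈ F, IsOpen (K r)) {p q : X → E} (hp : Continuous p)
    (hq : Continuous q) : Measurable fun x => (exitCount F K (p x) (q x) : ℝ≥0∞) := by
  classical
  have : (fun x => (exitCount F K (p x) (q x) : ℝ≥0∞)) = fun x => ∑ r ∈ F,
      ({x | (∃ t : ℝ, 0 ≤ t ∧ t ≤ 1 ∧ p x + t • (q x - p x) ∈ K r) ∧ q x ∉ K r}.indicator
        (fun _ => 1) x : ℝ≥0∞) := by
    funext x
    rw [exitCount, Finset.card_filter, Nat.cast_sum]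
    refine Finset.sum_congr rfl fun r _ => ?_
    simp only [Set.indicator_apply, Set.mem_ofPred_eq]
    split_ifs <;> simp
  rw [this]
  refine Finset.measurable_fun_sum _ fun r hr => measurable_const.indicator (.inter ?_ ?_)
  · have h1 : {x | ∃ t : ℝ, 0 ≤ t ∧ t ≤ 1 ∧ p x + t • (q x - p x) ∈ K r} =
        ⋃ t ∈ Set.Icc (0 : ℝ) 1, {x | p x + t • (q x - p x) ∈ K r} := by
      ext x; simp [and_assoc]
    change MeasurableSet {x | ∃ t : ℝ, 0 ≤ t ∧ t ≤ 1 ∧ p x + t • (q x - p x) ∈ K r}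
    rw [h1]
    exact (isOpen_biUnion fun t _ => (hK r hr).preimage
      (hp.add (continuous_const.smul (hq.sub hp)))).measurableSet
  · exact ((hK r hr).preimage hq).measurableSet.compl

end ExitCount

/-! ### The expected number of pivots in one stage -/

section Stage

variable {k : ℕ} {L : Euc k →ₗ[ℝ] Euc n}

instance {E : Type*} [NormedAddCommGroup E] [NormedSpace ℝ E] : Inhabited (WideCone E δ) :=
  ⟨⟨Set.univ, 0, isOpen_univ, fun _ _ => trivial, fun _ _ => trivial, fun _ => trivial⟩⟩

/-- In the coordinates of the face, the normal cones are wide cones around their centers. -/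
lemma exists_wideCones (hpos : ∀ i, 0 < e i) (hδ : 0 < δ) (hloc : LocalDeltaDistance a b δ)
    (hL : IsFaceParam a S₀ L) :
    ∃ K : Finset (Fin m) → WideCone (Euc k) δ, ∀ R ∈ faceBases a b e S₀,
      (K R).carrier = L ⁻¹' cone a S₀ R ∧ L (K R).center = coneCenter a S₀ R := by
  have h : ∀ R, ∃ K : WideCone (Euc k) δ, R ∈ faceBases a b e S₀ →
      K.carrier = L ⁻¹' cone a S₀ R ∧ L K.center = coneCenter a S₀ R := by
    intro R
    by_cases hR : R ∈ faceBases a b e S₀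
    · have hmem : coneCenter a S₀ R ∈ LinearMap.range L := by
        rw [hL.range_eq]; exact coneCenter_mem a S₀ R
      obtain ⟨y, hy⟩ := hmem
      refine ⟨⟨L ⁻¹' cone a S₀ R, y,
        (isOpen_cone hR).preimage (LinearMap.continuous_of_finiteDimensional L),
        fun {u v} hu hv => ?_, fun {u t} ht hu => ?_, fun {w} hw => ?_⟩, fun _ => ⟨rfl, hy⟩⟩
      · change L (u + v) ∈ cone a S₀ R
        rw [map_add]; exact cone_add_mem hu hv
      · change L (t • u) ∈ cone a S₀ R
        rw [map_smul]; exact cone_smul_mem ht hu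
      · change L (y + w) ∈ cone a S₀ R
        rw [map_add, hy]
        exact coneCenter_add_mem hpos hδ hloc hR (by rwa [hL.norm_map])
    · exact ⟨default, fun h => absurd h hR⟩
  choose K hK using h
  exact ⟨K, hK⟩

lemma card_exits_eq {K : Finset (Fin m) → WideCone (Euc k) δ}
    (hK : ∀ R ∈ faceBases a b e S₀, (K R).carrier = L ⁻¹' cone a S₀ R) (p q : Euc k) :
    (exits a b e S₀ (L p) (L q)).card =
      exitCount (faceBases a b e S₀) (fun R => (K R).carrier) p q := by
  classical
  rw [exits, exitsFrom, exitCount]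
  congr 1
  refine Finset.filter_congr fun R hR => ?_
  rw [hK R hR]
  simp only [Set.mem_preimage, map_add, map_smul, map_sub]

lemma WideCone.convex {E : Type*} [NormedAddCommGroup E] [NormedSpace ℝ E] (K : WideCone E δ) :
    Convex ℝ K.carrier := by
  refine convex_iff_forall_pos.2 fun x hx y hy s t hs ht _ => ?_
  exact K.add_mem (K.smul_mem hs hx) (K.smul_mem ht hy)

lemma card_of_mem_faceBases {R : Finset (Fin m)} (hR : R ∈ faceBases a b e S₀) :
    R.card = n ∧ S₀ ⊆ R := by
  classical
  rw [faceBases, Finset.mem_filter] at hR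
  obtain ⟨-, hS, B, hB, rfl⟩ := hR
  refine ⟨?_, hS⟩
  rw [card_image_positions hB.1]; simp

lemma norm_center_le (hcard : S₀.card + k = n) (hL : IsFaceParam a S₀ L) {y : Euc k}
    {R : Finset (Fin m)} (hR : R ∈ faceBases a b e S₀) (hy : L y = coneCenter a S₀ R) :
    ‖y‖ ≤ k := by
  obtain ⟨h1, h2⟩ := card_of_mem_faceBases hR
  rw [← hL.norm_map, hy]
  refine (norm_coneCenter_le a S₀ R).trans ?_
  rw [Finset.card_sdiff_of_subset h2, h1]
  exact_mod_cast (by omega : n - S₀.card ≤ k)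

section Bounds

variable {ι : Type*} {F : Finset ι} {K : ι → WideCone (Euc k) δ}

/-- The mass, relative to the total mass, of the exits on a segment that scales the sample by a
factor between `1 / 2` and `2`. -/
lemma lintegral_exitCount_scale_le (hδ : 0 < δ) (hk : 1 ≤ k)
    (hκ : ∀ r ∈ F, ‖(K r).center‖ ≤ k)
    (hdisj : ∀ r ∈ F, ∀ r' ∈ F, ∀ z, z ∈ (K r).carrier → z ∈ (K r').carrier → r = r')
    (z : Euc k) {σ₀ σ₁ σm : ℝ} (hσm : 0 < σm) (h0 : σm ≤ σ₀) (h1 : σm ≤ σ₁)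
    (h01 : |σ₁ - σ₀| ≤ σm) :
    ∫⁻ x in Metric.closedBall 0 (2 * (k : ℝ)),
      (exitCount F (fun r => (K r).carrier) (z + σ₀ • x) (z + σ₁ • x) : ℝ≥0∞) ∂expMeasure k ≤
    ENNReal.ofReal (8 * (k : ℝ) ^ 2 / δ) * expMeasure k Set.univ := by
  have hk0 : (0 : ℝ) < k := by exact_mod_cast hk
  refine (lintegral_exitCount_le hδ F K hk0.le hκ hdisj (L := 2 * k * σm) (by positivity) hσm h0 h1
    fun x hx => ?_).trans (le_of_eq ?_)
  · rw [add_sub_add_left_eq_sub, ← sub_smul, norm_smul, Real.norm_eq_abs, mul_comm]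
    rw [Metric.mem_closedBall, dist_zero_right] at hx
    exact mul_le_mul hx h01 (abs_nonneg _) (by positivity)
  · congr 2
    field_simp
    ring

variable (F K) in
lemma measurable_exitCount_segment (z₀ z₁ : Euc k) (σ₀ σ₁ : ℝ) :
    Measurable fun x => (exitCount F (fun r => (K r).carrier) (z₀ + σ₀ • x) (z₁ + σ₁ • x) : ℝ≥0∞) :=
  measurable_exitCount (fun r _ => (K r).isOpen) (by fun_prop) (by fun_prop)

/-- Scaling the sample down from `1` to `2 ^ (-I)`. -/
lemma lintegral_exitCount_shrink_le (hδ : 0 < δ) (hk : 1 ≤ k)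
    (hκ : ∀ r ∈ F, ‖(K r).center‖ ≤ k)
    (hdisj : ∀ r ∈ F, ∀ r' ∈ F, ∀ z, z ∈ (K r).carrier → z ∈ (K r').carrier → r = r')
    (z : Euc k) (I : ℕ) :
    ∫⁻ x in Metric.closedBall 0 (2 * (k : ℝ)),
      (exitCount F (fun r => (K r).carrier) (z + (1 : ℝ) • x) (z + ((1 / 2 : ℝ) ^ I) • x) : ℝ≥0∞)
        ∂expMeasure k ≤
    ENNReal.ofReal (I * (8 * (k : ℝ) ^ 2 / δ)) * expMeasure k Set.univ := by
  induction I with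
  | zero => simp
  | succ I ih =>
    have hpow : (0 : ℝ) < (1 / 2) ^ I := by positivity
    have hsplit : ∀ x : Euc k,
        (exitCount F (fun r => (K r).carrier) (z + (1 : ℝ) • x) (z + ((1 / 2 : ℝ) ^ (I + 1)) • x) :
          ℝ≥0∞) ≤
        exitCount F (fun r => (K r).carrier) (z + (1 : ℝ) • x) (z + ((1 / 2 : ℝ) ^ I) • x) +
        exitCount F (fun r => (K r).carrier) (z + ((1 / 2 : ℝ) ^ I) • x)
          (z + ((1 / 2 : ℝ) ^ (I + 1)) • x) := by
      intro x
      have h1 : (1 / 2 : ℝ) ^ I ≤ 1 := pow_le_one₀ (by norm_num) (by norm_num)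
      have hd : 0 < 1 - (1 / 2 : ℝ) ^ (I + 1) := by rw [pow_succ]; linarith
      have h2 := exitCount_le_add (F := F) (K := fun r => (K r).carrier) (z + (1 : ℝ) • x)
        (z + ((1 / 2 : ℝ) ^ (I + 1)) • x)
        (s := (1 - (1 / 2) ^ I) / (1 - (1 / 2) ^ (I + 1)))
        (div_nonneg (by linarith) hd.le)
        (div_le_one_of_le₀ (by rw [pow_succ]; linarith) hd.le)
      have h3 : z + (1 : ℝ) • x + ((1 - (1 / 2 : ℝ) ^ I) / (1 - (1 / 2) ^ (I + 1))) •
          (z + ((1 / 2 : ℝ) ^ (I + 1)) • x - (z + (1 : ℝ) • x)) = z + ((1 / 2 : ℝ) ^ I) • x := by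
        have h4 : z + ((1 / 2 : ℝ) ^ (I + 1)) • x - (z + (1 : ℝ) • x) =
            (-(1 - (1 / 2 : ℝ) ^ (I + 1))) • x := by module
        rw [h4, smul_smul, mul_neg, div_mul_cancel₀ _ hd.ne']
        module
      rw [h3] at h2
      exact_mod_cast h2
    refine (lintegral_mono hsplit).trans ?_
    rw [lintegral_add_left (measurable_exitCount_segment F K _ _ _ _)]
    refine (add_le_add ih (lintegral_exitCount_scale_le hδ hk hκ hdisj z
      (σm := (1 / 2) ^ (I + 1)) (by positivity) ?_ le_rfl ?_)).trans (le_of_eq ?_)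
    · rw [pow_succ]; linarith
    · rw [pow_succ, abs_le]; constructor <;> linarith
    · rw [← add_mul, ← ENNReal.ofReal_add (by positivity) (by positivity)]
      congr 2
      push_cast; ring

/-- Scaling the sample up from `2 ^ (-I)` to `1`. -/
lemma lintegral_exitCount_grow_le (hδ : 0 < δ) (hk : 1 ≤ k)
    (hκ : ∀ r ∈ F, ‖(K r).center‖ ≤ k)
    (hdisj : ∀ r ∈ F, ∀ r' ∈ F, ∀ z, z ∈ (K r).carrier → z ∈ (K r').carrier → r = r')
    (z : Euc k) (I : ℕ) :
    ∫⁻ x in Metric.closedBall 0 (2 * (k : ℝ)),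
      (exitCount F (fun r => (K r).carrier) (z + ((1 / 2 : ℝ) ^ I) • x) (z + (1 : ℝ) • x) : ℝ≥0∞)
        ∂expMeasure k ≤
    ENNReal.ofReal (I * (8 * (k : ℝ) ^ 2 / δ)) * expMeasure k Set.univ := by
  induction I with
  | zero => simp
  | succ I ih =>
    have hpow : (0 : ℝ) < (1 / 2) ^ I := by positivity
    have hsplit : ∀ x : Euc k,
        (exitCount F (fun r => (K r).carrier) (z + ((1 / 2 : ℝ) ^ (I + 1)) • x) (z + (1 : ℝ) • x) :
          ℝ≥0∞) ≤
        exitCount F (fun r => (K r).carrier) (z + ((1 / 2 : ℝ) ^ (I + 1)) • x)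
          (z + ((1 / 2 : ℝ) ^ I) • x) +
        exitCount F (fun r => (K r).carrier) (z + ((1 / 2 : ℝ) ^ I) • x) (z + (1 : ℝ) • x) := by
      intro x
      have h1 : (1 / 2 : ℝ) ^ I ≤ 1 := pow_le_one₀ (by norm_num) (by norm_num)
      have hd : 0 < 1 - (1 / 2 : ℝ) ^ (I + 1) := by rw [pow_succ]; linarith
      have h2 := exitCount_le_add (F := F) (K := fun r => (K r).carrier)
        (z + ((1 / 2 : ℝ) ^ (I + 1)) • x) (z + (1 : ℝ) • x)
        (s := (1 / 2) ^ (I + 1) / (1 - (1 / 2) ^ (I + 1)))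
        (div_nonneg (by positivity) hd.le)
        (div_le_one_of_le₀ (by rw [pow_succ]; linarith) hd.le)
      have h3 : z + ((1 / 2 : ℝ) ^ (I + 1)) • x +
          ((1 / 2 : ℝ) ^ (I + 1) / (1 - (1 / 2) ^ (I + 1))) •
          (z + (1 : ℝ) • x - (z + ((1 / 2 : ℝ) ^ (I + 1)) • x)) = z + ((1 / 2 : ℝ) ^ I) • x := by
        have h4 : z + (1 : ℝ) • x - (z + ((1 / 2 : ℝ) ^ (I + 1)) • x) =
            (1 - (1 / 2 : ℝ) ^ (I + 1)) • x := by module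
        rw [h4, smul_smul, div_mul_cancel₀ _ hd.ne', add_assoc, ← add_smul]
        congr 2
        rw [pow_succ]; ring
      rw [h3] at h2
      exact_mod_cast h2
    refine (lintegral_mono hsplit).trans ?_
    rw [lintegral_add_left (measurable_exitCount_segment F K _ _ _ _)]
    refine (add_le_add (lintegral_exitCount_scale_le hδ hk hκ hdisj z
      (σm := (1 / 2) ^ (I + 1)) (by positivity) le_rfl ?_ ?_) ih).trans (le_of_eq ?_)
    · rw [pow_succ]; linarith
    · rw [pow_succ, abs_le]; constructor <;> linarith
    · rw [← add_mul, ← ENNReal.ofReal_add (by positivity) (by positivity)]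
      congr 2
      push_cast; ring

end Bounds

/-- The number of cones that the three segments of a stage leave. -/
noncomputable def stageExits (a : Fin m → Euc n) (b : Fin m → ℝ) (e : Fin m → ℕ)
    (S₀ : Finset (Fin m)) (c d : Euc n) (η : ℝ) (x : Euc n) : ℕ :=
  (exits a b e S₀ c (c + x)).card + (exits a b e S₀ (c + x) (d + x)).card +
    (exits a b e S₀ (d + x) (d + η • x)).card

/-- The expected number of cones that the three segments of a stage leave. The first segment starts
at the center of a cone, and the last one ends at the scale `η` of the sample, which is why only
logarithmically many scales matter. -/
lemma lintegral_stageExits_le (he : Function.Injective e) (hpos : ∀ i, 0 < e i) (hδ : 0 < δ)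
    (hloc : LocalDeltaDistance a b δ) (hk : 1 ≤ k) (hcard : S₀.card + k = n)
    (hL : IsFaceParam a S₀ L) {R₀ : Finset (Fin m)} (hR₀ : R₀ ∈ faceBases a b e S₀)
    {d : Euc n} (hd : d ∈ faceDir a S₀) (hd2 : ‖d‖ ≤ 2) {η : ℝ} (hη1 : η ≤ 1) {I : ℕ}
    (hI : (1 / 2 : ℝ) ^ I ≤ η) (hI' : (1 / 2 : ℝ) ^ I * (2 * k) < δ) :
    ∫⁻ x, (stageExits a b e S₀ (coneCenter a S₀ R₀) d η (L x) : ℝ≥0∞) ∂truncExp k ≤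
      ENNReal.ofReal ((64 * I + 48) * ((k : ℝ) ^ 2 / δ)) := by
  have hk0 : (1 : ℝ) ≤ k := by exact_mod_cast hk
  obtain ⟨K, hK⟩ := exists_wideCones hpos hδ hloc hL
  have hKc := fun R hR => (hK R hR).1
  have hκ : ∀ R ∈ faceBases a b e S₀, ‖(K R).center‖ ≤ k := fun R hR =>
    norm_center_le hcard hL hR (hK R hR).2
  have hdisj : ∀ R ∈ faceBases a b e S₀, ∀ R' ∈ faceBases a b e S₀, ∀ z,
      z ∈ (K R).carrier → z ∈ (K R').carrier → R = R' := fun R hR R' hR' z hz hz' => by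
    rw [hKc R hR] at hz
    rw [hKc R' hR'] at hz'
    exact faceBases_disjoint he hpos hR hR' hz hz'
  obtain ⟨d', rfl⟩ : d ∈ LinearMap.range L := by rw [hL.range_eq]; exact hd
  set c := (K R₀).center with hc
  rw [← (hK R₀ hR₀).2, ← hc]
  rw [hL.norm_map] at hd2
  set F := faceBases a b e S₀
  set G : Euc k → Euc k → ℕ := exitCount F fun R => (K R).carrier with hG
  have hpow : (0 : ℝ) < (1 / 2) ^ I := by positivity
  -- up to the scale `2 ^ (-I)`, the first segment stays in the ball around the center of its cone
  have hfirst : ∀ x ∈ Metric.closedBall (0 : Euc k) (2 * (k : ℝ)),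
      G c (c + (1 : ℝ) • x) ≤ G (c + ((1 / 2 : ℝ) ^ I) • x) (c + (1 : ℝ) • x) := by
    intro x hx
    rw [Metric.mem_closedBall, dist_zero_right] at hx
    have h1 := exitCount_le_add (F := F) (K := fun R => (K R).carrier) c (c + (1 : ℝ) • x)
      (s := (1 / 2 : ℝ) ^ I) hpow.le (pow_le_one₀ (by norm_num) (by norm_num))
    have h2 : c + ((1 / 2 : ℝ) ^ I) • (c + (1 : ℝ) • x - c) = c + ((1 / 2 : ℝ) ^ I) • x := by
      module
    rw [h2] at h1
    have hin : ∀ t : ℝ, 0 ≤ t → t ≤ 1 → c + (t * (1 / 2 : ℝ) ^ I) • x ∈ (K R₀).carrier := by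
      intro t ht0 ht1
      refine (K R₀).center_add_mem ?_
      rw [norm_smul, Real.norm_of_nonneg (by positivity)]
      refine lt_of_le_of_lt ?_ hI'
      have : t * (1 / 2 : ℝ) ^ I ≤ (1 / 2) ^ I := by nlinarith
      exact mul_le_mul this hx (norm_nonneg _) hpow.le
    have h3 : exitCount F (fun R => (K R).carrier) c (c + ((1 / 2 : ℝ) ^ I) • x) = 0 := by
      refine exitCount_eq_zero fun R hR t ht0 ht1 ht => ?_
      rw [add_sub_cancel_left, smul_smul] at ht
      have := hdisj R hR R₀ hR₀ _ ht (hin t ht0 ht1)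
      subst this
      have := hin 1 zero_le_one le_rfl
      rwa [one_mul] at this
    simp only [hG]
    omega
  -- prolonging the last segment to the scale `2 ^ (-I)` can only increase the number of exits
  have hthird : ∀ x, G (d' + (1 : ℝ) • x) (d' + η • x) ≤
      G (d' + (1 : ℝ) • x) (d' + ((1 / 2 : ℝ) ^ I) • x) := by
    intro x
    rcases eq_or_lt_of_le (hI.trans hη1) with h | h
    · have : η = (1 / 2) ^ I := by linarith
      rw [this]
    have h0 : 0 < 1 - (1 / 2 : ℝ) ^ I := by linarith
    have h1 := exitCount_mono (F := F) (K := fun R => (K R).carrier) (fun R _ => (K R).convex)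
      (d' + (1 : ℝ) • x) (d' + ((1 / 2 : ℝ) ^ I) • x) (s := (1 - η) / (1 - (1 / 2) ^ I))
      (div_nonneg (by linarith) h0.le) (div_le_one_of_le₀ (by linarith) h0.le)
    have h2 : d' + (1 : ℝ) • x + ((1 - η) / (1 - (1 / 2 : ℝ) ^ I)) •
        (d' + ((1 / 2 : ℝ) ^ I) • x - (d' + (1 : ℝ) • x)) = d' + η • x := by
      have h4 : d' + ((1 / 2 : ℝ) ^ I) • x - (d' + (1 : ℝ) • x) =
          (-(1 - (1 / 2 : ℝ) ^ I)) • x := by module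
      rw [h4, smul_smul, mul_neg, div_mul_cancel₀ _ h0.ne']
      module
    rwa [h2] at h1
  have hstage : ∀ x, (stageExits a b e S₀ (L c) (L d') η (L x) : ℝ≥0∞) =
      G c (c + (1 : ℝ) • x) + G (c + (1 : ℝ) • x) (d' + (1 : ℝ) • x) +
        G (d' + (1 : ℝ) • x) (d' + η • x) := fun x => by
    rw [stageExits, ← map_smul, ← map_add, ← map_add, ← map_add, card_exits_eq hKc,
      card_exits_eq hKc, card_exits_eq hKc]
    simp only [hG, one_smul, Nat.cast_add, F]
  have hfin : (64 * (I : ℝ) + 48) * ((k : ℝ) ^ 2 / δ) = 4 * ((I * (8 * (k : ℝ) ^ 2 / δ) +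
      12 * ((k : ℝ) ^ 2 / δ)) + I * (8 * (k : ℝ) ^ 2 / δ)) := by ring
  rw [hfin]
  refine lintegral_truncExp_le hk ?_
  have hm : Measurable fun x => (G c (c + (1 : ℝ) • x) : ℝ≥0∞) :=
    measurable_exitCount (fun r _ => (K r).isOpen) (by fun_prop) (by fun_prop)
  have hm' : Measurable fun x => (G (d' + (1 : ℝ) • x) (d' + η • x) : ℝ≥0∞) :=
    measurable_exitCount_segment F K _ _ _ _
  simp only [hstage]
  rw [lintegral_add_right _ hm', lintegral_add_left hm,
    ENNReal.ofReal_add (by positivity) (by positivity),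
    ENNReal.ofReal_add (by positivity) (by positivity), add_mul, add_mul]
  refine add_le_add (add_le_add ?_ ?_) ?_
  · refine le_trans (setLIntegral_mono_ae' Metric.isClosed_closedBall.measurableSet
      (Eventually.of_forall fun x hx => ?_))
      (lintegral_exitCount_grow_le hδ hk hκ hdisj c I)
    exact_mod_cast hfirst x hx
  · have hcn := hκ R₀ hR₀
    refine (lintegral_exitCount_le hδ F K (by positivity : (0 : ℝ) ≤ k) hκ hdisj
      (L := 3 * k) (σm := 1) (by positivity) one_pos le_rfl le_rfl fun x _ => ?_).trans
      (le_of_eq ?_)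
    · rw [add_sub_add_right_eq_sub]
      exact (norm_sub_le _ _).trans (by linarith)
    · congr 2
      ring
  · refine le_trans (lintegral_mono fun x => ?_)
      (lintegral_exitCount_shrink_le hδ hk hκ hdisj d' I)
    exact Nat.cast_le.2 (hthird x)

end Stage

end

section

variable {m n : ℕ} {a : Fin m → Euc n} {b : Fin m → ℝ} {e : Fin m → ℕ} {B : Fin n → Fin m}
  {S₀ : Finset (Fin m)} {δ : ℝ}

/-! ### Optimal faces -/

/-- For small `ε > 0`, the perturbed face on which the rows in `S₀` are tight contains a maximizer
of `d`: every point of the perturbed polyhedron is dominated by a point of the face. -/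
def FaceOptimal (a : Fin m → Euc n) (b : Fin m → ℝ) (e : Fin m → ℕ) (d : Euc n)
    (S₀ : Finset (Fin m)) : Prop :=
  ∀ᶠ ε in 𝓝[>] (0 : ℝ), ∀ x ∈ polyhedron a (rhs b e ε), ∃ x' ∈ polyhedron a (rhs b e ε),
    (∀ i ∈ S₀, inner ℝ (a i) x' = rhs b e ε i) ∧ inner ℝ d x ≤ inner ℝ d x'

lemma faceOptimal_empty (d : Euc n) : FaceOptimal a b e d ∅ :=
  Eventually.of_forall fun _ x hx => ⟨x, hx, by simp, le_rfl⟩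

/-- If `d` is normal to an optimal face, then every basis of the face is optimal for `d`. -/
lemma FaceOptimal.coords_nonneg (he : Function.Injective e) (hpos : ∀ i, 0 < e i)
    (hB : EpsFeasible a b e B) {d : Euc n} (hS : S₀ ⊆ Finset.univ.image B)
    (hopt : FaceOptimal a b e d S₀) (hd : d ∈ Submodule.span ℝ (a '' (S₀ : Set (Fin m))))
    (l : Fin n) : 0 ≤ coords a B d l := by
  refine hB.coords_nonneg he hpos ?_ l
  filter_upwards [hopt] with ε hε x hx
  obtain ⟨x', -, htight, hle⟩ := hε x hx
  refine hle.trans (le_of_eq ?_)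
  rw [inner_eq_sum_coords hB.1, inner_eq_sum_coords hB.1 d (pvert a b e B ε)]
  refine Finset.sum_congr rfl fun k _ => ?_
  by_cases hk : B k ∈ S₀
  · rw [htight _ hk, inner_pvert hB.1]
  · rw [coords_eq_zero_of_mem_span hB.1 hS hk hd, zero_mul, zero_mul]

/-- A basis of an optimal face for which the coordinates of `d` outside the face are nonnegative has
its perturbed vertex among the maximizers, so that fixing more of its rows keeps the face optimal. -/
lemma FaceOptimal.of_coords_nonneg (hB : EpsFeasible a b e B) {d : Euc n}
    {S₁ : Finset (Fin m)} (hS₁ : S₁ ⊆ Finset.univ.image B) (hopt : FaceOptimal a b e d S₀)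
    (hd : ∀ l, B l ∉ S₀ → 0 ≤ coords a B d l) : FaceOptimal a b e d S₁ := by
  filter_upwards [hopt, hB.2] with ε hε hfeas x hx
  obtain ⟨x', hx', htight, hle⟩ := hε x hx
  refine ⟨_, hfeas, fun i hi => ?_, hle.trans ?_⟩
  · obtain ⟨k, -, rfl⟩ := Finset.mem_image.1 (hS₁ hi)
    exact inner_pvert hB.1 ε k
  · rw [inner_eq_sum_coords hB.1, inner_eq_sum_coords hB.1 d (pvert a b e B ε)]
    refine Finset.sum_le_sum fun k _ => ?_
    rw [inner_pvert hB.1]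
    by_cases hk : B k ∈ S₀
    · rw [htight _ hk]
    · exact mul_le_mul_of_nonneg_left (hx' _) (hd k hk)

/-- A basis of the perturbed polyhedron in whose cone `d` lies is optimal, and its vertex maximizes
`d` over the polyhedron. -/
lemma EpsFeasible.optimal (hpos : ∀ i, 0 < e i) (hB : EpsFeasible a b e B) {d : Euc n}
    (hd : ∀ l, 0 ≤ coords a B d l) :
    IsOptimalBasis a b d (Finset.univ.image B) ∧
      ∃ v ∈ (polyhedron a b).extremePoints ℝ, (∀ k, inner ℝ (a (B k)) v = b (B k)) ∧
        ∀ x ∈ polyhedron a b, inner ℝ d x ≤ inner ℝ d v := by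
  have hinj := injective_of_linInd hB.1
  refine ⟨⟨hB.isFeasibleBasis hpos, Function.extend B (coords a B d) 0, fun i => ?_, ?_⟩,
    vert a B fun k => b (B k), ⟨hB.vert_mem hpos, ?_⟩, inner_vert hB.1 _, fun x hx => ?_⟩
  · by_cases hi : ∃ k, B k = i
    · obtain ⟨k, rfl⟩ := hi
      rw [hinj.extend_apply]
      exact hd k
    · rw [Function.extend_apply' _ _ _ hi]
      rfl
  · rw [Finset.sum_image fun x _ y _ h => hinj h]
    simp only [hinj.extend_apply]
    exact (sum_coords hB.1 d).symm
  · rintro x hx y hy ⟨s, t, hs, ht, hst, hxy⟩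
    refine eq_of_inner_rows hB.1 fun k => ?_
    have h1 := inner_vert hB.1 (fun k => b (B k)) k
    have h2 := hx (B k)
    have h3 := hy (B k)
    rw [← hxy] at h1 ⊢
    rw [h1]
    rw [inner_add_right, real_inner_smul_right, real_inner_smul_right] at h1
    refine le_antisymm h2 (le_of_not_gt fun hlt => ?_)
    have h4 := mul_lt_mul_of_pos_left hlt hs
    have h5 := mul_le_mul_of_nonneg_left h3 ht.le
    have h6 : s * b (B k) + t * b (B k) = b (B k) := by rw [← add_mul, hst, one_mul]
    linarith
  · rw [inner_eq_sum_coords hB.1, inner_eq_sum_coords hB.1 d (vert a B _)]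
    refine Finset.sum_le_sum fun k _ => mul_le_mul_of_nonneg_left ?_ (hd k)
    rw [inner_vert hB.1]
    exact hx _

/-! ### One stage of the optimization algorithm -/

/-- On a `k`-dimensional face, a direction of norm more than `1` has a normalized coordinate larger
than `1 / k`. -/
lemma exists_large_coord (hB : LinearIndependent ℝ fun k => a (B k)) {S : Finset (Fin n)} {k : ℕ}
    (hk : 1 ≤ k) (hcard : S.card + k = n) {z : Euc n} (hz : z ∈ faceDir a (S.image B))
    (hz1 : 1 < ‖z‖) (hpos : ∀ l, l ∉ S → 0 < coords a B z l) :
    ∃ i, i ∉ S ∧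
      1 / (k : ℝ) < coords a B z i * ‖(faceDir a (S.image B)).starProjection (a (B i))‖ := by
  by_contra! h
  set π := (faceDir a (S.image B)).starProjection with hπ
  have h0 : ∀ l ∈ S, π (a (B l)) = 0 := fun l hl => by
    rw [hπ, Submodule.starProjection_apply_eq_zero_iff]
    rw [faceDir, Submodule.orthogonal_orthogonal]
    exact Submodule.subset_span ⟨B l, by simpa using ⟨l, hl, rfl⟩, rfl⟩
  have h1 : z = ∑ l ∈ Sᶜ, coords a B z l • π (a (B l)) := by
    conv_lhs => rw [← Submodule.starProjection_eq_self_iff.2 hz, ← sum_coords hB z, map_sum]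
    rw [← Finset.sum_add_sum_compl S, Finset.sum_eq_zero, zero_add]
    · exact Finset.sum_congr rfl fun l _ => map_smul _ _ _
    · intro l hl
      rw [map_smul, ← hπ, h0 l hl, smul_zero]
  have h2 : ‖z‖ ≤ ∑ _l ∈ Sᶜ, 1 / (k : ℝ) := by
    rw [h1]
    refine (norm_sum_le _ _).trans (Finset.sum_le_sum fun l hl => ?_)
    have hl := Finset.mem_compl.1 hl
    rw [norm_smul, Real.norm_of_nonneg (hpos l hl).le]
    exact h l hl
  rw [Finset.sum_const, Finset.card_compl, Fintype.card_fin, nsmul_eq_mul,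
    show n - S.card = k by omega, mul_one_div_cancel] at h2
  · linarith
  · have : (1 : ℝ) ≤ k := by exact_mod_cast hk
    positivity

/-- The normalized objective on the face on which the rows in `S₀` are tight. -/
noncomputable def stageTarget (a : Fin m → Euc n) (S₀ : Finset (Fin m)) (d : Euc n) : Euc n :=
  (2 / ‖(faceDir a S₀).starProjection d‖) • (faceDir a S₀).starProjection d

lemma stageTarget_mem (a : Fin m → Euc n) (S₀ : Finset (Fin m)) (d : Euc n) :
    stageTarget a S₀ d ∈ faceDir a S₀ :=
  Submodule.smul_mem _ _ (Submodule.starProjection_apply_mem _ _)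

lemma norm_stageTarget {d : Euc n} (hd : (faceDir a S₀).starProjection d ≠ 0) :
    ‖stageTarget a S₀ d‖ = 2 := by
  rw [stageTarget, norm_smul, Real.norm_of_nonneg (by positivity),
    div_mul_cancel₀ _ (norm_ne_zero_iff.2 hd)]

lemma norm_scaled_sample_lt (hδ : 0 < δ) {k : ℕ} (hk : 1 ≤ k) {x : Euc n} (hx : ‖x‖ < 2 * k) :
    δ / (2 * (k : ℝ) ^ 3) * ‖x‖ < δ / (k : ℝ) ^ 2 := by
  have hk0 : (0 : ℝ) < k := by exact_mod_cast hk
  have : δ / (k : ℝ) ^ 2 = δ / (2 * (k : ℝ) ^ 3) * (2 * k) := by field_simp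
  rw [this]
  exact mul_lt_mul_of_pos_left hx (by positivity)

/-- After a stage, the row with a large coordinate is tight at some maximizer of `d` over the face:
if the method continued to shrink the sample towards `d` itself, this row would keep its place,
because its coordinate cannot drop to zero on such a short segment. -/
lemma FaceOptimal.insert (he : Function.Injective e) (hpos : ∀ i, 0 < e i)
    (hbdd : Bornology.IsBounded (polyhedron a b)) (hδ : 0 < δ) (hloc : LocalDeltaDistance a b δ)
    {S : Finset (Fin n)} {k : ℕ} (hk : 1 ≤ k) (hB : EpsFeasible a b e B) {d x : Euc n}
    (hd : (faceDir a (S.image B)).starProjection d ≠ 0)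
    (hgen : ∀ j : ℕ, GenericSegment a b e (S.image B)
      (stageTarget a (S.image B) d + (δ / (2 * (k : ℝ) ^ 3)) • x)
      (stageTarget a (S.image B) d + (δ / (2 * (k : ℝ) ^ 3) / (j + 1)) • x))
    (hx : ‖x‖ < 2 * k)
    (hstart : ∀ l, l ∉ S →
      0 < coords a B (stageTarget a (S.image B) d + (δ / (2 * (k : ℝ) ^ 3)) • x) l)
    {i : Fin n} (hi : i ∉ S)
    (hlarge : 1 / (k : ℝ) < coords a B (stageTarget a (S.image B) d + (δ / (2 * (k : ℝ) ^ 3)) • x) i *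
      ‖(faceDir a (S.image B)).starProjection (a (B i))‖)
    (hopt : FaceOptimal a b e d (S.image B)) :
    FaceOptimal a b e d ((insert i S).image B) := by
  have hk1 : (1 : ℝ) ≤ k := by exact_mod_cast hk
  set d' := stageTarget a (S.image B) d with hd'
  set η := δ / (2 * (k : ℝ) ^ 3) with hη
  have hη0 : 0 < η := by positivity
  have hρ : ∀ B : Fin n → Fin m, EpsFeasible a b e B → ∀ z k,
      |coords a B z k| * ‖a (B k)‖ ≤ δ⁻¹ * ‖z‖ := fun B hB =>
    abs_coords_mul_norm_le hpos hδ hloc hB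
  -- the bases reached by prolonging the segment to the scales `η / (j + 1)`
  have hlong : ∀ j : ℕ, ∃ B' : Fin n → Fin m, EpsFeasible a b e B' ∧
      (∀ l ∈ Insert.insert i S, B' l = B l) ∧
      ∀ l, l ∉ S → 0 < coords a B' (d' + (η / (j + 1)) • x) l := by
    intro j
    obtain ⟨r, -, h2, h3, h4, -, h6⟩ := shadowSimplex_spec he hpos hbdd hρ (hgen j) hB hstart
    refine ⟨r.basis, h2, fun l hl => ?_, h4⟩
    rcases Finset.mem_insert.1 hl with rfl | hl
    · refine h6 _ hi ?_
      have h7 : ‖d' + (η / (j + 1)) • x - (d' + η • x)‖ ≤ η * ‖x‖ := by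
        rw [add_sub_add_left_eq_sub, ← sub_smul, norm_smul, Real.norm_eq_abs]
        refine mul_le_mul_of_nonneg_right ?_ (norm_nonneg _)
        have h8 : 0 ≤ η / ((j : ℝ) + 1) := by positivity
        have h9 : η / ((j : ℝ) + 1) ≤ η := div_le_self hη0.le (by linarith [j.cast_nonneg (α := ℝ)])
        rw [abs_le]; constructor <;> linarith
      calc δ⁻¹ * ‖d' + (η / (j + 1)) • x - (d' + η • x)‖ ≤ δ⁻¹ * (η * ‖x‖) :=
            mul_le_mul_of_nonneg_left h7 (inv_nonneg.2 hδ.le)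
        _ ≤ δ⁻¹ * (δ / (k : ℝ) ^ 2) :=
            mul_le_mul_of_nonneg_left (norm_scaled_sample_lt hδ hk hx).le (inv_nonneg.2 hδ.le)
        _ = 1 / (k : ℝ) ^ 2 := by field_simp
        _ ≤ 1 / (k : ℝ) := one_div_le_one_div_of_le (by linarith) (by nlinarith)
        _ < _ := hlarge
        _ ≤ _ := mul_le_mul_of_nonneg_left (Submodule.norm_starProjection_apply_le _ _)
            (hstart _ hi).le
    · exact h3 l hl
  choose bas hbas1 hbas2 hbas3 using hlong
  -- one basis is reached infinitely often
  obtain ⟨B', hB'⟩ : ∃ B', ∃ᶠ j in atTop, bas j = B' := by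
    by_contra! h
    have h1 : ∀ᶠ j in atTop, ∀ B', bas j ≠ B' := eventually_all.2 h
    obtain ⟨j, hj⟩ := h1.exists
    exact hj _ rfl
  obtain ⟨j₀, hj₀⟩ := hB'.exists
  have hf : EpsFeasible a b e B' := hj₀ ▸ hbas1 j₀
  have hag : ∀ l ∈ Insert.insert i S, B' l = B l := hj₀ ▸ hbas2 j₀
  have himg : (Insert.insert i S).image B = (Insert.insert i S).image B' :=
    Finset.image_congr fun l hl => (hag l hl).symm
  have himgS : S.image B = S.image B' :=
    Finset.image_congr fun l hl => (hag l (Finset.mem_insert_of_mem hl)).symm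
  refine FaceOptimal.of_coords_nonneg hf ?_ hopt fun l hl => ?_
  · rw [himg]
    exact Finset.image_subset_image (Finset.subset_univ _)
  have hlS : l ∉ S := fun h => hl (by
    rw [himgS]; exact Finset.mem_image_of_mem _ h)
  have hlim : Tendsto (fun j : ℕ => coords a B' (d' + (η / ((j : ℝ) + 1)) • x) l) atTop
      (𝓝 (coords a B' d' l)) := by
    have h1 : Tendsto (fun j : ℕ => d' + (η / ((j : ℝ) + 1)) • x) atTop
        (𝓝 (d' + (0 : ℝ) • x)) := by
      refine tendsto_const_nhds.add (Tendsto.smul_const ?_ x)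
      have := (tendsto_one_div_add_atTop_nhds_zero_nat (𝕜 := ℝ)).const_mul η
      simpa only [mul_one_div, mul_zero] using this
    rw [zero_smul, add_zero] at h1
    exact ((continuous_coords a B' l).tendsto _).comp h1
  -- in the limit, `d'` lies in the closed cone of this basis
  have hd'0 : 0 ≤ coords a B' d' l := by
    by_contra! hneg
    obtain ⟨j, hj1, hj2⟩ := (hB'.and_eventually (hlim.eventually_lt_const hneg)).exists
    have := hbas3 j l hlS
    rw [hj1] at this
    linarith
  have hsub : S.image B ⊆ Finset.univ.image B' := by
    rw [himgS]; exact Finset.image_subset_image (Finset.subset_univ _)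
  rw [hd', stageTarget, coords_smul, coords_starProjection hf.1 hsub hl] at hd'0
  have : 0 < 2 / ‖(faceDir a (S.image B)).starProjection d‖ :=
    div_pos two_pos (norm_pos_iff.2 hd)
  exact nonneg_of_mul_nonneg_right hd'0 this

/-- A sample that is generic for all `k`-dimensional faces that the algorithm may visit. -/
def GenericSample (a : Fin m → Euc n) (b : Fin m → ℝ) (e : Fin m → ℕ) (δ : ℝ) (d : Euc n) (k : ℕ)
    (x : Euc k) : Prop :=
  ∀ (S : Finset (Fin n)) (B : Fin n → Fin m), EpsFeasible a b e B → S.card + k = n →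
    StageGeneric a b e (S.image B) (coneCenter a (S.image B) (Finset.univ.image B))
      (stageTarget a (S.image B) d) (δ / (2 * (k : ℝ) ^ 3)) k
      (embedding k (faceDir a (S.image B)) x)

lemma ae_genericSample (hδ : 0 < δ) (d : Euc n) {k : ℕ} (hk : 1 ≤ k) :
    ∀ᵐ x ∂truncExp k, GenericSample a b e δ d k x := by
  have hk0 : (0 : ℝ) < k := by exact_mod_cast hk
  refine ae_all_iff.2 fun S => ae_all_iff.2 fun B => ?_
  rw [eventually_imp_distrib_left]; intro hB
  rw [eventually_imp_distrib_left]; intro hcard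
  exact ae_stageGeneric hk (isFaceParam_embedding hB.1 hcard) _ _ (by positivity)

/-- One stage of the algorithm: it fixes one more row, keeps the face optimal, and makes at most one
pivot for each cone that its segments leave. -/
lemma optimizeFace_succ (he : Function.Injective e) (hpos : ∀ i, 0 < e i)
    (hbdd : Bornology.IsBounded (polyhedron a b)) (hδ : 0 < δ) (hloc : LocalDeltaDistance a b δ)
    {S : Finset (Fin n)} {k : ℕ} (hB : EpsFeasible a b e B) (hcard : S.card + (k + 1) = n)
    {d : Euc n} (hd : (faceDir a (S.image B)).starProjection d ≠ 0) {x : Euc (k + 1)}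
    (hx : GenericSample a b e δ d (k + 1) x) :
    ∃ i B', i ∉ S ∧ EpsFeasible a b e B' ∧
      (FaceOptimal a b e d (S.image B) → FaceOptimal a b e d ((insert i S).image B')) ∧
      ∃ l : List ℕ, l.length ≤ stageExits a b e (S.image B)
          (coneCenter a (S.image B) (Finset.univ.image B)) (stageTarget a (S.image B) d)
          (δ / (2 * ((k + 1 : ℕ) : ℝ) ^ 3)) (embedding (k + 1) (faceDir a (S.image B)) x) ∧
        ∀ X : (k : ℕ) → Euc k, X (k + 1) = x → optimizeFace a b δ d e X (k + 1) S B =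
          (optimizeFace a b δ d e X k (insert i S) B').map fun r => ⟨r.basis, l ++ r.pivotCosts⟩ := by
  have hgen := hx S B hB hcard
  have hL := isFaceParam_embedding hB.1 hcard
  have hSB : S.image B ⊆ Finset.univ.image B :=
    Finset.image_subset_image (Finset.subset_univ _)
  have hmem : ∀ l, l ∉ S → B l ∉ S.image B := fun l hl => by
    rwa [(injective_of_linInd hB.1).mem_finset_image]
  have hρ : ∀ B : Fin n → Fin m, EpsFeasible a b e B → ∀ z k,
      |coords a B z k| * ‖a (B k)‖ ≤ δ⁻¹ * ‖z‖ := fun B hB =>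
    abs_coords_mul_norm_le hpos hδ hloc hB
  set c := coneCenter a (S.image B) (Finset.univ.image B) with hc
  set d' := stageTarget a (S.image B) d with hd'
  set η := δ / (2 * ((k + 1 : ℕ) : ℝ) ^ 3) with hη
  set y := embedding (k + 1) (faceDir a (S.image B)) x with hy
  have hη0 : 0 < η := by positivity
  obtain ⟨r₁, h11, h12, h13, h14, h15, -⟩ := shadowSimplex_spec he hpos hbdd hρ hgen.first hB
    (fun l hl => by
      rw [coords_coneCenter hB.1 hSB (hmem l hl)]
      exact inv_pos.2 (norm_pos_iff.2 (starProjection_row_ne_zero hB.1 hSB (hmem l hl))))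
  have hS1 : S.image r₁.basis = S.image B := Finset.image_congr fun l hl => h13 l hl
  obtain ⟨r₂, h21, h22, h23, h24, h25, -⟩ := shadowSimplex_spec he hpos hbdd hρ (S := S)
    (by rw [hS1]; exact hgen.second) h12 h14
  rw [hS1] at h25
  have hS2 : S.image r₂.basis = S.image B := by
    rw [← hS1]; exact Finset.image_congr fun l hl => h23 l hl
  obtain ⟨r₃, h31, h32, h33, h34, h35, -⟩ := shadowSimplex_spec he hpos hbdd hρ (S := S)
    (by rw [hS2]; exact hgen.third) h22 h24
  rw [hS2] at h35
  have hS3 : S.image r₃.basis = S.image B := by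
    rw [← hS2]; exact Finset.image_congr fun l hl => h33 l hl
  have hlt := norm_scaled_sample_lt hδ (Nat.le_add_left 1 k) hgen.norm_lt
  have hδ1 := delta_le_one hδ hloc hpos hB (by omega)
  have hbig : 1 < ‖d' + η • y‖ := by
    have h1 : ‖η • y‖ < 1 := by
      rw [norm_smul, Real.norm_of_nonneg hη0.le]
      refine hlt.trans_le (div_le_one_of_le₀ (hδ1.trans ?_) (by positivity))
      have : (1 : ℝ) ≤ (k + 1 : ℕ) := by exact_mod_cast Nat.le_add_left 1 k
      nlinarith
    have h2 : ‖d'‖ = 2 := norm_stageTarget hd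
    have h3 := norm_sub_le (d' + η • y) (η • y)
    rw [add_sub_cancel_right, h2] at h3
    linarith
  have hdir : d' + η • y ∈ faceDir a (S.image B) := by
    refine Submodule.add_mem _ (stageTarget_mem _ _ _) (Submodule.smul_mem _ _ ?_)
    rw [← hL.range_eq]
    exact LinearMap.mem_range_self _ _
  obtain ⟨i₀, hi₀S, hi₀⟩ := exists_large_coord h32.1 (Nat.le_add_left 1 k) hcard
    (by rw [hS3]; exact hdir) hbig h34
  rw [hS3] at hi₀
  obtain ⟨i, hi⟩ : ∃ i, ((List.finRange n).find? fun i => decide (i ∉ S ∧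
      1 / ((k + 1 : ℕ) : ℝ) < coords a r₃.basis (d' + η • y) i *
        ‖(faceDir a (S.image B)).starProjection (a (r₃.basis i))‖)) = some i := by
    rw [← Option.isSome_iff_exists, List.find?_isSome]
    exact ⟨i₀, List.mem_finRange _, by simpa using ⟨hi₀S, by simpa using hi₀⟩⟩
  have hi' := List.find?_some hi
  rw [decide_eq_true_eq] at hi'
  refine ⟨i, r₃.basis, hi'.1, h32, fun hopt => ?_, r₁.pivotCosts ++ r₂.pivotCosts ++ r₃.pivotCosts,
    ?_, fun X hX => ?_⟩
  · refine FaceOptimal.insert he hpos hbdd hδ hloc (Nat.le_add_left 1 k) h32 (x := y) ?_ ?_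
      hgen.norm_lt ?_ hi'.1 ?_ ?_
    · rwa [hS3]
    · rw [hS3]; exact hgen.fourth
    · rw [hS3]; exact h34
    · rw [hS3]; exact hi'.2
    · rwa [hS3]
  · simp only [List.length_append, stageExits]
    omega
  · have hπ : ¬ (faceDir a (S.image B)).starProjection d = 0 := hd
    simp only [optimizeFace, faceDir_image, hX]
    rw [if_neg hπ]
    have hd'' : (2 / ‖(faceDir a (S.image B)).starProjection d‖) •
      (faceDir a (S.image B)).starProjection d = d' := rfl
    simp only [coneCenter_image hB.1, hd'', ← hc, ← hη, ← hy, h11, h21, h31, Option.bind_some]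
    rw [hi]
    rfl

/-- For generic samples the algorithm returns an optimal basis. -/
lemma optimizeFace_spec (he : Function.Injective e) (hpos : ∀ i, 0 < e i)
    (hbdd : Bornology.IsBounded (polyhedron a b)) (hδ : 0 < δ) (hloc : LocalDeltaDistance a b δ)
    {d : Euc n} {X : (k : ℕ) → Euc k} (hX : ∀ k, 1 ≤ k → GenericSample a b e δ d k (X k)) (k : ℕ)
    {S : Finset (Fin n)} (hB : EpsFeasible a b e B) (hcard : S.card + k = n)
    (hopt : FaceOptimal a b e d (S.image B)) :
    ∃ r, optimizeFace a b δ d e X k S B = some r ∧ EpsFeasible a b e r.basis ∧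
      ∀ l, 0 ≤ coords a r.basis d l := by
  induction k generalizing S B with
  | zero =>
    refine ⟨_, rfl, hB, hopt.coords_nonneg he hpos hB
      (Finset.image_subset_image (Finset.subset_univ _)) ?_⟩
    have hS : S = Finset.univ := by
      rw [← Finset.card_eq_iff_eq_univ, Fintype.card_fin]; omega
    rw [hS, ← sum_coords hB.1 d]
    exact Submodule.sum_mem _ fun l _ => Submodule.smul_mem _ _
      (Submodule.subset_span ⟨B l, by simp, rfl⟩)
  | succ k ih =>
    by_cases hd : (faceDir a (S.image B)).starProjection d = 0
    · refine ⟨⟨B, []⟩, ?_, hB, hopt.coords_nonneg he hpos hB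
        (Finset.image_subset_image (Finset.subset_univ _)) ?_⟩
      · simp only [optimizeFace, faceDir_image]
        rw [if_pos hd]
      · rw [Submodule.starProjection_apply_eq_zero_iff, faceDir,
          Submodule.orthogonal_orthogonal] at hd
        exact hd
    · obtain ⟨i, B', hi, hB', hface, l, -, hrec⟩ := optimizeFace_succ he hpos hbdd hδ hloc hB hcard
        hd (hX (k + 1) (Nat.le_add_left 1 k))
      obtain ⟨r, h1, h2, h3⟩ := ih hB' (S := insert i S)
        (by rw [Finset.card_insert_of_notMem hi]; omega) (hface hopt)
      refine ⟨⟨r.basis, l ++ r.pivotCosts⟩, ?_, h2, h3⟩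
      rw [hrec X rfl, h1]
      rfl

end

section

variable {m n : ℕ} {a : Fin m → Euc n} {b : Fin m → ℝ} {e : Fin m → ℕ} {B : Fin n → Fin m}
  {δ : ℝ}

/-! ### The expected number of pivots -/

instance : IsProbabilityMeasure sampleLaw :=
  inferInstanceAs (IsProbabilityMeasure (Measure.infinitePi truncExp))

/-- The sample for dimension `k` may be drawn separately from the others. -/
lemma measurePreserving_update (k : ℕ) :
    MeasurePreserving (fun p : Euc k × ((k : ℕ) → Euc k) => Function.update p.2 k p.1)
      ((truncExp k).prod sampleLaw) sampleLaw := by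
  have hm : Measurable fun p : Euc k × ((k : ℕ) → Euc k) => Function.update p.2 k p.1 := by
    refine measurable_pi_iff.2 fun j => ?_
    by_cases hj : j = k
    · subst hj
      simpa using measurable_fst
    · simp only [Function.update_of_ne hj]
      fun_prop
  refine ⟨hm, Measure.eq_infinitePi _ fun s t ht => ?_⟩
  rw [Measure.map_apply hm (MeasurableSet.pi s.countable_toSet fun i _ => ht i)]
  have hpre : (fun p : Euc k × ((k : ℕ) → Euc k) => Function.update p.2 k p.1) ⁻¹'
      (s : Set ℕ).pi t = {x | k ∈ s → x ∈ t k} ×ˢ ((s.erase k : Finset ℕ) : Set ℕ).pi t := by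
    ext ⟨x, X⟩
    simp only [Set.mem_preimage, Set.mem_pi, Finset.mem_coe, Set.mem_prod, Finset.mem_erase]
    constructor
    · intro h
      refine ⟨fun hk => by simpa using h k hk, fun j hj => ?_⟩
      have := h j hj.2
      rwa [Function.update_of_ne hj.1] at this
    · rintro ⟨h1, h2⟩ j hj
      by_cases hjk : j = k
      · subst hjk
        simpa using h1 hj
      · rw [Function.update_of_ne hjk]
        exact h2 j ⟨hjk, hj⟩
  rw [hpre, Measure.prod_prod, sampleLaw, Measure.infinitePi_pi _ fun i _ => ht i]
  by_cases hk : k ∈ s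
  · have : {x | k ∈ s → x ∈ t k} = t k := by ext; simp [hk]
    rw [this, Finset.mul_prod_erase s (fun i => truncExp i (t i)) hk]
  · have : {x : Euc k | k ∈ s → x ∈ t k} = Set.univ := by ext; simp [hk]
    rw [this, measure_univ, one_mul, Finset.erase_eq_of_notMem hk]

/-- On a `k`-dimensional face only the samples for dimensions at most `k` are used. -/
lemma optimizeFace_update {d : Euc n} {j : ℕ} (x : Euc j) (X : (k : ℕ) → Euc k) {k : ℕ} (hk : k < j)
    (S : Finset (Fin n)) (B : Fin n → Fin m) :
    optimizeFace a b δ d e (Function.update X j x) k S B = optimizeFace a b δ d e X k S B := by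
  induction k generalizing S B with
  | zero => rfl
  | succ k ih =>
    simp only [optimizeFace, ih (Nat.lt_of_succ_lt hk), Function.update_of_ne hk.ne]

/-- If `β` bounds the expected number of pivots in each stage, then the expected number of pivots on
a `k`-dimensional face is at most `k * β`. -/
lemma lintegral_numPivots_le (he : Function.Injective e) (hpos : ∀ i, 0 < e i)
    (hbdd : Bornology.IsBounded (polyhedron a b)) (hδ : 0 < δ) (hloc : LocalDeltaDistance a b δ)
    {d : Euc n} {β : ℝ≥0∞}
    (hβ : ∀ (k : ℕ) (S : Finset (Fin n)) (B : Fin n → Fin m), 1 ≤ k → EpsFeasible a b e B →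
      S.card + k = n → (faceDir a (S.image B)).starProjection d ≠ 0 →
      ∫⁻ x, (stageExits a b e (S.image B) (coneCenter a (S.image B) (Finset.univ.image B))
        (stageTarget a (S.image B) d) (δ / (2 * (k : ℝ) ^ 3))
        (embedding k (faceDir a (S.image B)) x) : ℝ≥0∞) ∂truncExp k ≤ β)
    (k : ℕ) {S : Finset (Fin n)} (hB : EpsFeasible a b e B) (hcard : S.card + k = n) :
    ∫⁻ X, (numPivots (optimizeFace a b δ d e X k S B) : ℝ≥0∞) ∂sampleLaw ≤ k * β := by
  induction k generalizing S B with
  | zero => simp [optimizeFace, numPivots]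
  | succ k ih =>
    by_cases hd : (faceDir a (S.image B)).starProjection d = 0
    · have : ∀ X, numPivots (optimizeFace a b δ d e X (k + 1) S B) = 0 := fun X => by
        simp only [optimizeFace, faceDir_image]
        rw [if_pos hd]
        rfl
      simp [this]
    have hmeas : Measurable fun X : (k : ℕ) → Euc k =>
        (numPivots (optimizeFace a b δ d e X (k + 1) S B) : ℝ≥0∞) :=
      measurable_from_nat.comp (numPivots_measurable δ d (k + 1) S B)
    have hmp := measurePreserving_update (k + 1)
    have hfubini := lintegral_prod _ (hmeas.comp hmp.measurable).aemeasurable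
      (μ := truncExp (k + 1)) (ν := sampleLaw)
    simp only [Function.comp_apply] at hfubini
    rw [← hmp.lintegral_comp hmeas, hfubini]
    have hstep : ∀ᵐ x ∂truncExp (k + 1),
        ∫⁻ X, (numPivots (optimizeFace a b δ d e (Function.update X (k + 1) x) (k + 1) S B) : ℝ≥0∞)
          ∂sampleLaw ≤
        (stageExits a b e (S.image B) (coneCenter a (S.image B) (Finset.univ.image B))
          (stageTarget a (S.image B) d) (δ / (2 * ((k + 1 : ℕ) : ℝ) ^ 3))
          (embedding (k + 1) (faceDir a (S.image B)) x) : ℝ≥0∞) + k * β := by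
      filter_upwards [ae_genericSample (a := a) (b := b) (e := e) hδ d (Nat.le_add_left 1 k)]
        with x hx
      obtain ⟨i, B', hi, hB', -, l, hl, hrec⟩ := optimizeFace_succ he hpos hbdd hδ hloc hB hcard
        hd hx
      have hle : ∀ X : (k : ℕ) → Euc k,
          numPivots (optimizeFace a b δ d e (Function.update X (k + 1) x) (k + 1) S B) ≤
          l.length + numPivots (optimizeFace a b δ d e X k (insert i S) B') := fun X => by
        rw [hrec _ (Function.update_self _ _ _), optimizeFace_update _ _ (Nat.lt_succ_self k)]
        rcases optimizeFace a b δ d e X k (insert i S) B' with _ | r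
        · exact Nat.zero_le _
        · simp [numPivots]
      calc _ ≤ ∫⁻ X, ((l.length : ℝ≥0∞) +
              numPivots (optimizeFace a b δ d e X k (insert i S) B')) ∂sampleLaw :=
            lintegral_mono fun X => (Nat.cast_le.2 (hle X)).trans_eq (Nat.cast_add _ _)
        _ ≤ _ := by
            rw [lintegral_add_left measurable_const, lintegral_const, measure_univ, mul_one]
            refine add_le_add (by exact_mod_cast hl) (ih hB' ?_)
            rw [Finset.card_insert_of_notMem hi]
            omega
    refine (lintegral_mono_ae hstep).trans ?_
    rw [lintegral_add_right _ measurable_const, lintegral_const, measure_univ, mul_one]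
    refine (add_le_add_left (hβ (k + 1) S B (Nat.le_add_left 1 k) hB hcard hd) _).trans
      (le_of_eq ?_)
    push_cast
    ring

/-- The number `I` of dyadic scales between the sample and `δ / (4 n ^ 3)` is logarithmic. -/
lemma exists_scales (hδ : 0 < δ) (hδ1 : δ ≤ 1) (hn : 1 ≤ n) :
    ∃ I : ℕ, (1 / 2 : ℝ) ^ I ≤ δ / (4 * (n : ℝ) ^ 3) ∧
      64 * (I : ℝ) + 48 ≤ 240 + 280 * Real.log (n / δ) := by
  have hn1 : (1 : ℝ) ≤ n := by exact_mod_cast hn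
  have hq : 0 < 4 * (n : ℝ) ^ 3 / δ := by positivity
  have hlog2 := Real.log_two_gt_d9
  have hlogn : 0 ≤ Real.log n := Real.log_nonneg hn1
  have hlogδ : Real.log δ ≤ 0 := Real.log_nonpos hδ.le hδ1
  have hlogq : Real.log (4 * (n : ℝ) ^ 3 / δ) =
      2 * Real.log 2 + 3 * Real.log n - Real.log δ := by
    rw [Real.log_div (by positivity) hδ.ne', Real.log_mul (by norm_num) (by positivity),
      Real.log_pow, show (4 : ℝ) = 2 ^ 2 by norm_num, Real.log_pow]
    push_cast
    ring
  refine ⟨⌈Real.logb 2 (4 * (n : ℝ) ^ 3 / δ)⌉₊, ?_, ?_⟩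
  · have h1 := Nat.le_ceil (Real.logb 2 (4 * (n : ℝ) ^ 3 / δ))
    rw [Real.logb_le_iff_le_rpow one_lt_two hq, Real.rpow_natCast] at h1
    rw [one_div, inv_pow, ← inv_div (4 * (n : ℝ) ^ 3) δ]
    exact inv_anti₀ hq h1
  · have h0 : 0 ≤ Real.logb 2 (4 * (n : ℝ) ^ 3 / δ) := by
      refine div_nonneg ?_ (by linarith)
      rw [hlogq]
      linarith
    have h1 := (Nat.ceil_lt_add_one h0).le
    have h2 : Real.logb 2 (4 * (n : ℝ) ^ 3 / δ) * Real.log 2 =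
        2 * Real.log 2 + 3 * Real.log n - Real.log δ := by
      rw [← hlogq, Real.logb, div_mul_cancel₀ _ (by linarith)]
    rw [Real.log_div (by positivity) hδ.ne']
    have h3 : (Real.logb 2 (4 * (n : ℝ) ^ 3 / δ) - 2) * Real.log 2 ≤
        3 * (Real.log n - Real.log δ) := by linarith
    have h4 : (Real.logb 2 (4 * (n : ℝ) ^ 3 / δ) - 2) * 0.693 ≤
        3 * (Real.log n - Real.log δ) := by
      rcases le_total 0 (Real.logb 2 (4 * (n : ℝ) ^ 3 / δ) - 2) with h | h
      · exact le_trans (mul_le_mul_of_nonneg_left (by linarith) h) h3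
      · nlinarith
    linarith

lemma lintegral_numPivots_optimizeFace_le (he : Function.Injective e) (hpos : ∀ i, 0 < e i)
    (hbdd : Bornology.IsBounded (polyhedron a b)) (hδ : 0 < δ) (hloc : LocalDeltaDistance a b δ)
    (hn : 1 ≤ n) (d : Euc n) (hB : EpsFeasible a b e B) :
    ∫⁻ X, (numPivots (optimizeFace a b δ d e X n ∅ B) : ℝ≥0∞) ∂sampleLaw ≤
      ENNReal.ofReal ((n : ℝ) ^ 3 / δ * (240 + 280 * Real.log (n / δ))) := by
  have hδ1 := delta_le_one hδ hloc hpos hB hn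
  obtain ⟨I, hI, hI'⟩ := exists_scales hδ hδ1 hn
  have h := lintegral_numPivots_le he hpos hbdd hδ hloc (d := d)
    (β := ENNReal.ofReal ((64 * I + 48) * ((n : ℝ) ^ 2 / δ)))
    (fun k S B hk hB hcard hd => ?_) n hB (S := ∅) (by simp)
  · refine h.trans ?_
    rw [← ENNReal.ofReal_natCast, ← ENNReal.ofReal_mul (Nat.cast_nonneg n)]
    refine ENNReal.ofReal_le_ofReal ?_
    calc (n : ℝ) * ((64 * I + 48) * ((n : ℝ) ^ 2 / δ)) = (n : ℝ) ^ 3 / δ * (64 * I + 48) := by ring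
      _ ≤ _ := mul_le_mul_of_nonneg_left hI' (by positivity)
  · have hk1 : (1 : ℝ) ≤ k := by exact_mod_cast hk
    have hkn : (k : ℝ) ≤ n := by exact_mod_cast (by omega : k ≤ n)
    have hk3 : (1 / 2 : ℝ) ^ I ≤ δ / (4 * (k : ℝ) ^ 3) := hI.trans (by gcongr)
    have hS : S.image B ⊆ Finset.univ.image B :=
      Finset.image_subset_image (Finset.subset_univ _)
    refine (lintegral_stageExits_le he hpos hδ hloc hk
      (by rw [card_image_positions hB.1]; exact hcard) (isFaceParam_embedding hB.1 hcard)
      (image_mem_faceBases hB hS) (stageTarget_mem _ _ _) (norm_stageTarget hd).le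
      (I := I) ?_ (hk3.trans (by gcongr; norm_num)) ?_).trans ?_
    · rw [div_le_one (by positivity)]
      have : (1 : ℝ) ≤ (k : ℝ) ^ 3 := one_le_pow₀ hk1
      linarith
    · calc (1 / 2 : ℝ) ^ I * (2 * k) ≤ δ / (4 * (k : ℝ) ^ 3) * (2 * k) :=
            mul_le_mul_of_nonneg_right hk3 (by positivity)
        _ = δ / (2 * (k : ℝ) ^ 2) := by field_simp; norm_num
        _ < δ := by
            rw [div_lt_iff₀ (by positivity)]
            have := mul_le_mul_of_nonneg_left (one_le_pow₀ hk1 : (1 : ℝ) ≤ (k : ℝ) ^ 2) hδ.le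
            linarith
    · exact ENNReal.ofReal_le_ofReal (by gcongr)

end

end ShadowSimplex

theorem theorem3 :
    ∃ C : ℝ, 0 < C ∧
      ∀ (n m : ℕ) (a : Fin m → Euc n) (b : Fin m → ℝ) (δ : ℝ) (B : Fin n → Fin m) (d : Euc n),
        1 ≤ n → 0 < δ →
        Bornology.IsBounded (polyhedron a b) → (interior (polyhedron a b)).Nonempty →
        LocalDeltaDistance a b δ →
        IsFeasibleBasis a b (Finset.univ.image B) →
        -- with probability one the algorithm returns an optimal basis, and its vertex is optimal
        (∀ᵐ X ∂sampleLaw, ∃ r : Output m n, optimize a b δ B d X = some r ∧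
          IsOptimalBasis a b d (Finset.univ.image r.basis) ∧
          ∃ v ∈ (polyhedron a b).extremePoints ℝ, (∀ k, inner ℝ (a (r.basis k)) v = b (r.basis k)) ∧
            ∀ x ∈ polyhedron a b, inner ℝ d x ≤ inner ℝ d v) ∧
        -- the expected number of pivots
        MeasureTheory.Integrable (fun X => (numPivots (optimize a b δ B d X) : ℝ)) sampleLaw ∧
        (2 ≤ n → ∫ X, (numPivots (optimize a b δ B d X) : ℝ) ∂sampleLaw ≤
          C * ((n : ℝ) ^ 3 / δ * Real.log (n / δ))) ∧
        (n = 1 → ∫ X, (numPivots (optimize a b δ B d X) : ℝ) ∂sampleLaw ≤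
          C * (1 / δ * (1 + Real.log (1 / δ)))) ∧
        -- the number of arithmetic operations of each pivot
        (∀ (X : (k : ℕ) → Euc k) (r : Output m n), optimize a b δ B d X = some r →
          ∀ t ∈ r.pivotCosts, (t : ℝ) ≤ C * (m * n)) := by
  refine ⟨700, by norm_num, ?_⟩
  intro n m a b δ B d hn hδ hbdd _ hloc hfeas
  have he := exponent_injective B
  have hpos := exponent_pos B
  have hB := epsFeasible_exponent hfeas
  have hδ1 := delta_le_one hδ hloc hpos hB hn
  have hn1 : (1 : ℝ) ≤ n := by exact_mod_cast hn
  have hlog : 0 ≤ Real.log (n / δ) := Real.log_nonneg (by rw [le_div_iff₀ hδ]; linarith)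
  have hbound : ∫⁻ X, ENNReal.ofReal (numPivots (optimize a b δ B d X) : ℝ) ∂sampleLaw ≤
      ENNReal.ofReal ((n : ℝ) ^ 3 / δ * (240 + 280 * Real.log (n / δ))) := by
    simp only [ENNReal.ofReal_natCast]
    exact lintegral_numPivots_optimizeFace_le he hpos hbdd hδ hloc hn d hB
  have hmeas : Measurable fun X => (numPivots (optimize a b δ B d X) : ℝ) :=
    measurable_from_nat.comp (numPivots_measurable δ d n ∅ B)
  have hmean : ∫ X, (numPivots (optimize a b δ B d X) : ℝ) ∂sampleLaw ≤
      (n : ℝ) ^ 3 / δ * (240 + 280 * Real.log (n / δ)) := by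
    rw [integral_eq_lintegral_of_nonneg_ae (Filter.Eventually.of_forall fun _ => Nat.cast_nonneg _)
      hmeas.aestronglyMeasurable]
    exact ENNReal.toReal_le_of_le_ofReal (by positivity) hbound
  refine ⟨?_, ⟨hmeas.aestronglyMeasurable, ?_⟩, fun hn2 => hmean.trans ?_,
    fun hn1' => hmean.trans ?_, fun X r hr t ht => ?_⟩
  · have hgen : ∀ᵐ X ∂sampleLaw, ∀ k, 1 ≤ k → GenericSample a b (exponent B) δ d k (X k) := by
      refine ae_all_iff.2 fun k => ?_
      rw [Filter.eventually_imp_distrib_left]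
      intro hk
      exact (measurePreserving_eval_infinitePi truncExp k).quasiMeasurePreserving.ae
        (ae_genericSample hδ d hk)
    filter_upwards [hgen] with X hX
    obtain ⟨r, h1, h2, h3⟩ := optimizeFace_spec he hpos hbdd hδ hloc hX n hB (S := ∅) (by simp)
      (by rw [Finset.image_empty]; exact faceOptimal_empty d)
    exact ⟨r, h1, h2.optimal hpos h3⟩
  · rw [hasFiniteIntegral_iff_ofReal (Filter.Eventually.of_forall fun _ => Nat.cast_nonneg _)]
    exact hbound.trans_lt ENNReal.ofReal_lt_top
  · have h2 : (2 : ℝ) ≤ n / δ := by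
      rw [le_div_iff₀ hδ]
      have : (2 : ℝ) ≤ n := by exact_mod_cast hn2
      linarith
    have h3 := Real.log_le_log two_pos h2
    have h4 := Real.log_two_gt_d9
    calc _ ≤ (n : ℝ) ^ 3 / δ * (700 * Real.log (n / δ)) :=
          mul_le_mul_of_nonneg_left (by linarith) (by positivity)
      _ = _ := by ring
  · subst hn1'
    rw [Nat.cast_one] at hlog ⊢
    calc _ ≤ (1 : ℝ) ^ 3 / δ * (700 * (1 + Real.log (1 / δ))) :=
          mul_le_mul_of_nonneg_left (by linarith) (by positivity)
      _ = _ := by ring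
  · have hnm : n ≤ m := by
      simpa using Fintype.card_le_of_injective B (injective_of_linInd hB.1)
    have h1 : (t : ℝ) ≤ 48 * (m * n) := by exact_mod_cast optimizeFace_costs hn hnm n hr t ht
    have h2 : (0 : ℝ) ≤ m * n := by positivity
    linarith
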